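/- Let $N\ge 1$ and $v_1,\dots,v_N>0$. Consider particles $x_k^n\in\mathbb Z$, $1\le k\le n\le N$, with fully packed initial condition $x_k^n(0)=k-n-1$ and the following continuous-time dynamics. Each particle $(k,n)$ has an independent exponential clock of rate $v_n$. When the clock of $(k,n)$ rings, nothing happens if $k\le n-1$ and $x_k^n\ge x_k^{n-1}-1$ (the particle is blocked); otherwise let $c\ge1$ be the largest integer with $x_k^n=x_{k+1}^{n+1}=\dots=x_{k+c-1}^{n+c-1}$, and all these $c$ particles jump to the right by one. Fix $t\ge 0$. Let $\tilde\varrho_t^m$ be the $m$-point correlation function, with respect to counting measure on $\mathbb Z\times\{1,\dots,N\}$, of the point process $\{(x_k^n(t),n):1\le k\le n\le N\}$, i.e. $\tilde\varrho_t^m((x_1,n_1),\dots,(x_m,n_m))$ is the expected number of $m$-tuples of distinct particles of which the $i$-th sits at $(x_i,n_i)$ for every $i$. For integers $x,x'$, $n,n'\in\{1,\dots,N\}$ and $k,\ell\ge1$ put $$\tilde\phi^{(n,n')}(x,x')=\frac{\mathbf 1_{[n<n']}}{2\pi i}\oint_{\Gamma_{0,v}}\frac{dz}{z^{x-x'+1}}\,\frac{z^{n'-n}}{(z-v_{n+1})\cdots(z-v_{n'})},$$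 $$\tilde\Psi^{n,t}_{n-k}(x)=\frac1{2\pi i}\oint_{\Gamma_{0,v}}dz\,\frac{e^{tz}}{z^{x+n+1}}\,\frac{(z-v_1)\cdots(z-v_n)}{(z-v_1)\cdots(z-v_k)},$$ $$\tilde\Phi^{n,t}_{n-\ell}(x)=\frac1{2\pi i}\oint_{\Gamma_v}dw\,\frac{w^{x+n}}{e^{tw}}\,\frac{(w-v_1)\cdots(w-v_{\ell-1})}{(w-v_1)\cdots(w-v_n)},$$ where $\Gamma_{0,v}$ is any positively oriented circle enclosing $0,v_1,\dots,v_N$, and $\Gamma_v$ is any positively oriented circle enclosing $v_1,\dots,v_N$ but not $0$ (any other simple contour enclosing the same poles gives the same values), and let $$\widetilde K^v_t((x,n),(x',n'))=-\tilde\phi^{(n,n')}(x,x')+\sum_{k=1}^{n'}\tilde\Psi^{n,t}_{n-k}(x)\,\tilde\Phi^{n',t}_{n'-k}(x').$$ Then: 1. almost surely $x_k^{n+1}(t)<x_k^n(t)\le x_{k+1}^{n+1}(t)$ for $1\le k\le n<N$, i.e. $x(t)$ lies in the discrete Gelfand–Tsetlin pattern; 2. for every $m$ and all $(x_1,n_1),\dots,(x_m,n_m)\in\mathbb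 Z\times\{1,\dots,N\}$, $$\tilde\varrho^m_t((x_1,n_1),\dots,(x_m,n_m))=\det\bigl[\widetilde K^v_t((x_i,n_i),(x_j,n_j))\bigr]_{1\le i,j\le m};$$ 3. for $1\le n\le N$ and $1\le k,\ell\le n$, the sum $\sum_{x\in\mathbb Z}\tilde\Psi^{n,t}_{n-k}(x)\,\tilde\Phi^{n,t}_{n-\ell}(x)$ converges absolutely and equals $\delta_{k\ell}$; 4. for $1\le n\le N$, the functions $\tilde\Phi^{n,t}_{n-\ell}$, $1\le\ell\le n$, on $\mathbb Z$ have the same complex linear span as the functions $x\mapsto u^x x^{j}$, where $u$ runs through the distinct values of $v_1,\dots,v_n$ and $0\le j<\alpha(u)$, with $\alpha(u)$ the multiplicity of $u$ among $v_1,\dots,v_n$. -/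

import Mathlib

open MeasureTheory ProbabilityTheory Filter Topology
open scoped NNReal

noncomputable section

namespace GTParticles

/-! ### Particles, configurations and the discrete Gelfand–Tsetlin pattern -/

/-- The index set of the particles: pairs `(n, k)` with `1 ≤ k ≤ n ≤ N`. -/
def indexSet (N : ℕ) : Finset (ℕ × ℕ) :=
  (Finset.Icc 1 N ×ˢ Finset.Icc 1 N).filter fun p => p.2 ≤ p.1

/-- A particle is an index `(n, k)` with `1 ≤ k ≤ n ≤ N`. -/
abbrev Particle (N : ℕ) : Type := {p : ℕ × ℕ // p ∈ indexSet N}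

/-- The level `n` of the particle `(n, k)`. -/
def Particle.level {N : ℕ} (p : Particle N) : ℕ := p.1.1

/-- The label `k` of the particle `(n, k)` within its level. -/
def Particle.label {N : ℕ} (p : Particle N) : ℕ := p.1.2

/-- Positions of all the particles; `x p` with `p = (n, k)` is `x_k^n`. -/
abbrev Config (N : ℕ) : Type := Particle N → ℤ

/-- The discrete Gelfand–Tsetlin pattern: `x_k^{n+1} < x_k^n ≤ x_{k+1}^{n+1}`. -/
def pattern (N : ℕ) : Set (Config N) :=
  {x | ∀ p q : Particle N, q.level = p.level + 1 →
    (q.label = p.label → x q < x p) ∧ (q.label = p.label + 1 → x p ≤ x q)}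

/-- The fully packed configuration `x_k^n = k - n - 1`. -/
def packed (N : ℕ) : Config N := fun p => (p.label : ℤ) - (p.level : ℤ) - 1

/-! ### The dynamics -/

/-- `x_k^n` is blocked by `x_k^{n-1}` (for `k ≤ n - 1`) unless `x_k^n < x_k^{n-1} - 1`.
A particle with `k = n` is never blocked. -/
def Blocked {N : ℕ} (x : Config N) (p : Particle N) : Prop :=
  ∃ q : Particle N, q.level + 1 = p.level ∧ q.label = p.label ∧ ¬ x p < x q - 1

/-- `q` belongs to the string that moves with `p = (n, k)`: `q = (n + l, k + l)` for some `l ≥ 0`,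
and `x_k^n = x_{k+1}^{n+1} = ⋯ = x_{k+l}^{n+l}`. -/
def InString {N : ℕ} (x : Config N) (p q : Particle N) : Prop :=
  ∃ l : ℕ, q.level = p.level + l ∧ q.label = p.label + l ∧
    ∀ j ≤ l, ∀ r : Particle N, r.level = p.level + j → r.label = p.label + j → x r = x p

open Classical in
/-- The configuration just after the clock of `p` has rung: nothing happens if `p` is blocked;
otherwise the whole string of `p` jumps to the right by one. -/
def jump {N : ℕ} (p : Particle N) (x : Config N) : Config N :=
  if Blocked x p then x else fun q => if InString x p q then x q + 1 else x q

/-- A Poisson process of the given rate, i.e. the number of rings up to time `t` of a clock with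
independent exponential waiting times of that rate. -/
structure IsPoissonProcess {Ω : Type*} [MeasurableSpace Ω] (rate : ℝ≥0) (C : ℝ≥0 → Ω → ℕ)
    (P : Measure Ω) : Prop where
  measurable : ∀ t, Measurable (C t)
  zero : ∀ᵐ ω ∂P, C 0 ω = 0
  path : ∀ᵐ ω ∂P, Monotone (fun t => C t ω) ∧
    ∀ t, ContinuousWithinAt (fun s => C s ω) (Set.Ici t) t
  indep : HasIndepIncrements C P
  law : ∀ s t : ℝ≥0, s ≤ t →
    HasLaw (fun ω => C t ω - C s ω) (poissonMeasure (rate * (t - s))) P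

/-- `X` is the particle system started from the fully packed configuration, in which the
particle `(n, k)` carries an independent exponential clock of rate `v n` (whose number of rings is
`C (n, k)`) and the configuration is changed by `jump p` whenever the clock of `p` rings.

Almost surely no two clocks ring at the same time, and finitely many rings occur in a bounded
time interval. Hence the last field says exactly that the path is constant as long as no clock
rings, and that a ring of the clock of `p` changes the configuration by `jump p`. -/
structure IsParticleSystem {N : ℕ} {Ω : Type*} [MeasurableSpace Ω] (v : ℕ → ℝ)
    (C : Particle N → ℝ≥0 → Ω → ℕ) (X : ℝ≥0 → Ω → Config N) (P : Measure Ω) : Prop where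
  clocks : ∀ p : Particle N, IsPoissonProcess (v p.level).toNNReal (C p) P
  clocks_indep : iIndepFun (fun (p : Particle N) (ω : Ω) (t : ℝ≥0) => C p t ω) P
  measurable : ∀ t, Measurable (X t)
  init : ∀ᵐ ω ∂P, X 0 ω = packed N
  evolution : ∀ᵐ ω ∂P, ∀ s t : ℝ≥0, s ≤ t →
    ((∀ p, C p t ω = C p s ω) → X t ω = X s ω) ∧
    (∀ p, C p t ω = C p s ω + 1 → (∀ q, q ≠ p → C q t ω = C q s ω) →
      X t ω = jump p (X s ω))

/-! ### Correlation functions -/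

/-- The `m`-point correlation function, with respect to counting measure on `ℤ × {1, …, N}`, of the
point process of all `(x_k^n, n)`, where `x = Y ω` is a random configuration: the expected number of
ways to choose distinct particles sitting at the points `y 0, …, y (m - 1)`, respectively. -/
def correlation {N : ℕ} {Ω : Type*} [MeasurableSpace Ω] (P : Measure Ω) (Y : Ω → Config N)
    {m : ℕ} (y : Fin m → ℤ × ℕ) : ℝ :=
  ∫ ω, (Set.ncard {p : Fin m ↪ Particle N |
    ∀ i, Y ω (p i) = (y i).1 ∧ (p i).level = (y i).2} : ℝ) ∂P

/-! ### The kernel -/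

/-- A positively oriented circle. An integral over a simple contour enclosing a given part of the
poles depends only on which poles are enclosed; circles of arbitrary centre and radius are used. -/
structure CircleContour where
  center : ℂ
  radius : ℝ

/-- `a` lies inside the circle. -/
def CircleContour.Inside (Γ : CircleContour) (a : ℂ) : Prop := a ∈ Metric.ball Γ.center Γ.radius

/-- `a` lies outside the circle. -/
def CircleContour.Outside (Γ : CircleContour) (a : ℂ) : Prop := a ∉ Metric.closedBall Γ.center Γ.radius

/-- `(2πi)⁻¹ ∮_Γ f(z) dz`. -/
def contour (Γ : CircleContour) (f : ℂ → ℂ) : ℂ :=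
  (2 * Real.pi * Complex.I)⁻¹ * circleIntegral f Γ.center Γ.radius

/-- `(z - v_a) ⋯ (z - v_b)`, the empty product if `b < a`. -/
def factors (v : ℕ → ℝ) (a b : ℕ) (z : ℂ) : ℂ := ∏ j ∈ Finset.Icc a b, (z - (v j : ℂ))

/-- `φ̃^{(n,n')}(x, x')`, with `Γ` in the role of `Γ_{0,v}`. -/
def phi (v : ℕ → ℝ) (Γ : CircleContour) (n n' : ℕ) (x x' : ℤ) : ℂ :=
  if n < n' then
    contour Γ fun z => 1 / z ^ (x - x' + 1) * (z ^ (n' - n) / factors v (n + 1) n' z)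
  else 0

/-- `Ψ̃_{n-k}^{n,t}(x)`, with `Γ` in the role of `Γ_{0,v}`. -/
def Psi (v : ℕ → ℝ) (Γ : CircleContour) (t : ℝ) (n k : ℕ) (x : ℤ) : ℂ :=
  contour Γ fun z =>
    Complex.exp (t * z) / z ^ (x + n + 1) * (factors v 1 n z / factors v 1 k z)

/-- `Φ̃_{n-l}^{n,t}(x)`, with `Γ` in the role of `Γ_v`. -/
def Phi (v : ℕ → ℝ) (Γ : CircleContour) (t : ℝ) (n l : ℕ) (x : ℤ) : ℂ :=
  contour Γ fun w =>
    w ^ (x + n) / Complex.exp (t * w) * (factors v 1 (l - 1) w / factors v 1 n w)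

/-- The correlation kernel, with `Γ₀` in the role of `Γ_{0,v}` and `Γ₁` in the role of `Γ_v`. -/
def kernel (v : ℕ → ℝ) (Γ₀ Γ₁ : CircleContour) (t : ℝ) (a b : ℤ × ℕ) : ℂ :=
  -phi v Γ₀ a.2 b.2 a.1 b.1 +
    ∑ k ∈ Finset.Icc 1 b.2, Psi v Γ₀ t a.2 k a.1 * Phi v Γ₁ t b.2 k b.1

open Classical in
/-- The space `V_n`, spanned by the functions `x ↦ u ^ x * x ^ j`, where `u` runs through the values
`v_1, …, v_n` and `0 ≤ j <` the multiplicity of `u` among them. -/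
def spaceV (v : ℕ → ℝ) (n : ℕ) : Submodule ℂ (ℤ → ℂ) :=
  Submodule.span ℂ {f | ∃ i ∈ Finset.Icc 1 n, ∃ j : ℕ,
    j < ((Finset.Icc 1 n).filter fun i' => v i' = v i).card ∧
    f = fun x : ℤ => (v i : ℂ) ^ x * (x : ℂ) ^ j}

end GTParticles

end

/-!
The one-time law of the particle system is explicit. For `x` in the Gelfand–Tsetlin pattern

  `P (X_t = x) = κ e^{-Rt} ∏ₙ v_n ^ (|x^n| - |x^{n-1}|) det [Ψ^{N,t}_{N-i}(x_j^N)]`,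

where `R = v_1 + ⋯ + v_N` and `|x^n|` is the sum of the positions of level `n`; see `hasPatternLaw`.
Everything else follows from this formula by linear algebra.

*The law.* Write `w_t(x)` for the weight times the determinant, without `κ e^{-Rt}`. A transition
into a pattern `x` is undone by lowering a block of equal positions on a diagonal
(`exists_lower_of_jump`, `jump_lower`), and the blocks are indexed by their last particle `q`. The
rate of the transition times the weight of the lowered configuration telescopes along the block
(`weight_lower`): if `q` has level `n < N`, then what remains is `v_{n+1}` times the weight of `x`,
the rate of the particle that `q` would otherwise block; if `q` is in the top level, then it is the
weight of `x`. So the inflow through levels below the top cancels against the outflow, up to `R`,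
and what is left is a sum of independent backward steps of the top row (`generator_patternFun`).
Because `∂ₜ Ψ(x) = Ψ(x - 1)`, this sum is the time derivative of the determinant. At time `0` the
functions `Ψ` are the coefficients of monic polynomials, so `w_0` vanishes except at the packed
configuration. On the other hand, the probabilities `P (X_t = x)` solve the same forward equation
(`hasDerivWithinAt_prob`). This rests on the Markov property (`prob_inter_rings`), which is obtained
by comparing the path with a chain driven by the increments of the clocks over a fine grid; the two
differ only if there are two rings between neighbouring grid times. Solutions are unique because jumps
move particles to the right and positions are bounded below (`eq_zero_of_forward`). The same
comparison shows that `X_t` stays in the pattern (`ae_invariant`).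

*The kernel.* The functions `Φ` solve a first order difference equation in the level, so that the
sum of the weights over all patterns with a given top row is, up to a constant, `det [Φ(x_j^N)]`
(`patternSum_eq_det`). This remains true with an additional factor `1 + g` for every particle on one
of finitely many sites, if `Φ` is replaced by a deformation built from `φ` (`deformedPhi`). Then
Cauchy–Binet and the biorthogonality of `Ψ` and `Φ` show that the expectation of `∏ (1 + g)` is
`det (1 + g K)` (`integral_prod_siteFactor`), and the correlation functions follow by
inclusion–exclusion (`correlation_eq_det`).

*Biorthogonality and span.* The generating function of `Ψ` turns `∑ₓ Ψ(x) Φ(x)` into the contour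
integral of the reciprocal of a product of linear factors, all of whose roots are enclosed; it
vanishes unless there is exactly one factor (`contour_rootProd_inv`). The functions `Φ` lie in
the space of the functions `u ^ x * x ^ j` by partial fractions, and being `n` linearly independent
elements of a space of dimension at most `n`, they span it (`span_Phi_eq_spaceV`).
-/

noncomputable section

namespace GTParticles

/-! ### Contour integrals of rational functions -/

namespace CircleContour

/-- The points of the circle itself. -/
def circle (Γ : CircleContour) : Set ℂ := Metric.sphere Γ.center Γ.radius

lemma Inside.radius_pos {Γ : CircleContour} {a : ℂ} (h : Γ.Inside a) : 0 < Γ.radius :=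
  Metric.pos_of_mem_ball h

lemma Inside.ne {Γ : CircleContour} {a z : ℂ} (h : Γ.Inside a) (hz : z ∈ Γ.circle) : z ≠ a := by
  rintro rfl
  have h1 : dist z Γ.center < Γ.radius := h
  have h2 : dist z Γ.center = Γ.radius := hz
  exact absurd h2 h1.ne

lemma Outside.ne {Γ : CircleContour} {a z : ℂ} (h : Γ.Outside a) (hz : z ∈ Γ.circle) : z ≠ a := by
  rintro rfl
  exact h (Metric.sphere_subset_closedBall hz)

end CircleContour

lemma contour_congr {Γ : CircleContour} (hR : 0 ≤ Γ.radius) {f g : ℂ → ℂ}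
    (h : Set.EqOn f g Γ.circle) : contour Γ f = contour Γ g := by
  unfold contour
  rw [circleIntegral.integral_congr hR h]

lemma contour_const_mul (Γ : CircleContour) (a : ℂ) (f : ℂ → ℂ) :
    contour Γ (fun z => a * f z) = a * contour Γ f := by
  unfold contour
  rw [circleIntegral.integral_const_mul]
  ring

lemma contour_add {Γ : CircleContour} (hR : 0 ≤ Γ.radius) {f g : ℂ → ℂ}
    (hf : ContinuousOn f Γ.circle) (hg : ContinuousOn g Γ.circle) :
    contour Γ (fun z => f z + g z) = contour Γ f + contour Γ g := by
  unfold contour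
  rw [circleIntegral.integral_add (hf.circleIntegrable hR) (hg.circleIntegrable hR)]
  ring

lemma contour_sub {Γ : CircleContour} (hR : 0 ≤ Γ.radius) {f g : ℂ → ℂ}
    (hf : ContinuousOn f Γ.circle) (hg : ContinuousOn g Γ.circle) :
    contour Γ (fun z => f z - g z) = contour Γ f - contour Γ g := by
  unfold contour
  rw [circleIntegral.integral_sub (hf.circleIntegrable hR) (hg.circleIntegrable hR)]
  ring

lemma contour_sub_const_mul {Γ : CircleContour} (hR : 0 ≤ Γ.radius) {f g : ℂ → ℂ} (a : ℂ)
    (hf : ContinuousOn f Γ.circle) (hg : ContinuousOn g Γ.circle) :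
    contour Γ (fun z => f z - a * g z) = contour Γ f - a * contour Γ g := by
  rw [contour_sub hR hf (g := fun z => a * g z) (continuousOn_const.mul hg), contour_const_mul]

lemma contour_sum {Γ : CircleContour} (hR : 0 ≤ Γ.radius) {ι : Type*} (s : Finset ι)
    {f : ι → ℂ → ℂ} (hf : ∀ i ∈ s, ContinuousOn (f i) Γ.circle) :
    contour Γ (fun z => ∑ i ∈ s, f i z) = ∑ i ∈ s, contour Γ (f i) := by
  unfold contour
  rw [circleIntegral.integral_fun_sum (fun i hi => (hf i hi).circleIntegrable hR),
    Finset.mul_sum]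

lemma contour_eq_zero {Γ : CircleContour} (hR : 0 ≤ Γ.radius) {f : ℂ → ℂ}
    (hf : ∀ z ∈ Metric.closedBall Γ.center Γ.radius, DifferentiableAt ℂ f z) :
    contour Γ f = 0 := by
  unfold contour
  rw [Complex.circleIntegral_eq_zero_of_differentiable_on_off_countable hR Set.countable_empty
    (fun z hz => (hf z hz).continuousAt.continuousWithinAt)
    (fun z hz => hf z (Metric.ball_subset_closedBall hz.1)), mul_zero]

lemma contour_inv_sub {Γ : CircleContour} {a : ℂ} (ha : Γ.Inside a) :
    contour Γ (fun z => (z - a)⁻¹) = 1 := by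
  unfold contour
  rw [circleIntegral.integral_sub_inv_of_mem_ball ha]
  exact inv_mul_cancel₀ Complex.two_pi_I_ne_zero

lemma contour_zpow {Γ : CircleContour} (h0 : Γ.Inside 0) (q : ℤ) :
    contour Γ (fun z => z ^ q) = if q = -1 then 1 else 0 := by
  split_ifs with h
  · subst h
    simpa [zpow_neg_one] using contour_inv_sub h0
  · have := circleIntegral.integral_sub_zpow_of_ne h Γ.center 0 Γ.radius
    simp only [sub_zero] at this
    rw [contour, this, mul_zero]

/-- The product of the linear factors `z - a`, where `a` runs through a multiset. -/
def rootProd (s : Multiset ℂ) (z : ℂ) : ℂ := (s.map fun a => z - a).prod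

@[simp] lemma rootProd_zero (z : ℂ) : rootProd 0 z = 1 := by simp [rootProd]

@[simp] lemma rootProd_cons (a : ℂ) (s : Multiset ℂ) (z : ℂ) :
    rootProd (a ::ₘ s) z = (z - a) * rootProd s z := by simp [rootProd]

lemma rootProd_replicate (k : ℕ) (a z : ℂ) :
    rootProd (Multiset.replicate k a) z = (z - a) ^ k := by simp [rootProd]

lemma rootProd_ne_zero {Γ : CircleContour} {s : Multiset ℂ} (hs : ∀ a ∈ s, Γ.Inside a) {z : ℂ}
    (hz : z ∈ Γ.circle) : rootProd s z ≠ 0 := by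
  rw [rootProd, Ne, Multiset.prod_eq_zero_iff, Multiset.mem_map]
  rintro ⟨a, ha, h⟩
  exact (hs a ha).ne hz (sub_eq_zero.mp h)

lemma continuous_rootProd (s : Multiset ℂ) : Continuous (rootProd s) := by
  induction s using Multiset.induction with
  | empty =>
    have : rootProd 0 = fun _ => 1 := by ext; simp
    rw [this]; exact continuous_const
  | cons a s ih =>
    have : rootProd (a ::ₘ s) = fun z => (z - a) * rootProd s z := by ext; simp
    rw [this]; fun_prop

lemma continuousOn_rootProd_inv {Γ : CircleContour} {s : Multiset ℂ}
    (hs : ∀ a ∈ s, Γ.Inside a) : ContinuousOn (fun z => (rootProd s z)⁻¹) Γ.circle :=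
  (continuous_rootProd s).continuousOn.inv₀ fun _ hz => rootProd_ne_zero hs hz

/-- Two different poles are separated by the partial fraction identity
`1 / ((z - a)(z - b)) = (1 / (z - a) - 1 / (z - b)) / (a - b)`. -/
lemma rootProd_inv_partial_fractions {a b z : ℂ} (s : Multiset ℂ) (hab : a ≠ b) (ha : z ≠ a)
    (hb : z ≠ b) : (rootProd (a ::ₘ b ::ₘ s) z)⁻¹ =
      (a - b)⁻¹ * ((rootProd (a ::ₘ s) z)⁻¹ - (rootProd (b ::ₘ s) z)⁻¹) := by
  have h1 := sub_ne_zero.mpr hab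
  have h2 := sub_ne_zero.mpr ha
  have h3 := sub_ne_zero.mpr hb
  simp only [rootProd_cons, mul_inv]
  field_simp
  ring

/-- A multiset is a power of a single element, or contains two different elements. -/
lemma multiset_replicate_or (s : Multiset ℂ) (h : s ≠ 0) :
    (∃ a k, s = Multiset.replicate (k + 1) a) ∨
      ∃ a b s', a ≠ b ∧ s = a ::ₘ b ::ₘ s' := by
  obtain ⟨a, ha⟩ := Multiset.exists_mem_of_ne_zero h
  obtain ⟨s', rfl⟩ := Multiset.exists_cons_of_mem ha
  by_cases hs : ∀ b ∈ s', b = a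
  · left
    refine ⟨a, s'.card, ?_⟩
    rw [Multiset.replicate_succ, ← Multiset.eq_replicate_card.mpr hs]
  · right
    push Not at hs
    obtain ⟨b, hb, hba⟩ := hs
    obtain ⟨s'', rfl⟩ := Multiset.exists_cons_of_mem hb
    exact ⟨a, b, s'', hba.symm, rfl⟩

/-- If all the poles are enclosed, then the integral of the reciprocal of a product of linear
factors vanishes unless there is exactly one factor. -/
lemma contour_rootProd_inv {Γ : CircleContour} (hR : 0 ≤ Γ.radius) (s : Multiset ℂ)
    (hs : ∀ a ∈ s, Γ.Inside a) :
    contour Γ (fun z => (rootProd s z)⁻¹) = if s.card = 1 then 1 else 0 := by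
  induction hn : s.card using Nat.strong_induction_on generalizing s with
  | _ n ih =>
    by_cases h0 : s = 0
    · subst h0
      have : n = 0 := by simpa using hn.symm
      subst this
      have := circleIntegral.integral_sub_zpow_of_ne (n := 0) (by norm_num) Γ.center 0 Γ.radius
      simp only [zpow_zero] at this
      simp [contour, this]
    rcases multiset_replicate_or s h0 with ⟨a, k, rfl⟩ | ⟨a, b, s', hab, rfl⟩
    · have ha : Γ.Inside a := hs a (by simp)
      have hk : n = k + 1 := by simpa using hn.symm
      simp only [rootProd_replicate]
      rcases Nat.eq_zero_or_pos k with rfl | hk0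
      · subst hk
        simpa using contour_inv_sub ha
      · have := circleIntegral.integral_sub_zpow_of_ne (n := -((k + 1 : ℕ) : ℤ)) (by push_cast; omega)
          Γ.center a Γ.radius
        simp only [zpow_neg, zpow_natCast] at this
        rw [contour, this, mul_zero, if_neg (by omega)]
    · have hn' : n = s'.card + 2 := by simpa using hn.symm
      have has : ∀ c ∈ a ::ₘ s', Γ.Inside c := fun c hc => hs c (by
        simp only [Multiset.mem_cons] at hc ⊢; tauto)
      have hbs : ∀ c ∈ b ::ₘ s', Γ.Inside c := fun c hc => hs c (by
        simp only [Multiset.mem_cons] at hc ⊢; tauto)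
      rw [contour_congr hR (fun z hz => rootProd_inv_partial_fractions s' hab
        ((hs a (by simp)).ne hz) ((hs b (by simp)).ne hz)), contour_const_mul,
        contour_sub hR (continuousOn_rootProd_inv has) (continuousOn_rootProd_inv hbs),
        ih (s'.card + 1) (by omega) (a ::ₘ s') has (by simp),
        ih (s'.card + 1) (by omega) (b ::ₘ s') hbs (by simp), if_neg (show ¬ n = 1 by omega)]
      simp

lemma factors_eq_rootProd (v : ℕ → ℝ) (a b : ℕ) (z : ℂ) :
    factors v a b z = rootProd ((Finset.Icc a b).val.map fun j => (v j : ℂ)) z := by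
  rw [factors, rootProd, Multiset.map_map]
  rfl

lemma factors_ne_zero {v : ℕ → ℝ} {Γ : CircleContour} {a b : ℕ}
    (h : ∀ j ∈ Finset.Icc a b, Γ.Inside (v j)) {z : ℂ} (hz : z ∈ Γ.circle) :
    factors v a b z ≠ 0 :=
  Finset.prod_ne_zero_iff.mpr fun j hj => sub_ne_zero.mpr ((h j hj).ne hz)

@[fun_prop]
lemma continuous_factors (v : ℕ → ℝ) (a b : ℕ) : Continuous (factors v a b) := by
  unfold factors
  fun_prop

lemma factors_succ (v : ℕ → ℝ) {a b : ℕ} (h : a ≤ b + 1) (z : ℂ) :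
    factors v a (b + 1) z = factors v a b z * (z - v (b + 1)) := by
  rw [factors, ← Finset.insert_Icc_right_eq_Icc_add_one h, Finset.prod_insert (by simp), mul_comm]
  rfl

lemma factors_mul (v : ℕ → ℝ) {a b c : ℕ} (h : a ≤ b + 1) (h' : b ≤ c) (z : ℂ) :
    factors v a b z * factors v (b + 1) c z = factors v a c z := by
  induction c, h' using Nat.le_induction with
  | base => simp [factors]
  | succ c hc ih => rw [factors_succ v (by omega), factors_succ v (by omega), ← mul_assoc, ih]

/-! ### The functions `Psi`, `Phi` and `phi` -/

lemma hasSum_of_eq {ι : Type*} {f g : ι → ℂ} {a b : ℂ} (h : HasSum f a) (hf : ∀ i, g i = f i)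
    (hb : b = a) : HasSum g b := by
  rw [show g = f from funext hf, hb]
  exact h

/-- An exponential factor under the contour integral can be expanded into its power series. -/
lemma hasSum_contour_exp {Γ : CircleContour} (hR : 0 ≤ Γ.radius) {g : ℂ → ℂ}
    (hg : ContinuousOn g Γ.circle) (t : ℂ) :
    HasSum (fun m : ℕ => t ^ m / (m.factorial : ℂ) * contour Γ (fun z => z ^ m * g z))
      (contour Γ (fun z => Complex.exp (t * z) * g z)) := by
  set γ := circleMap Γ.center Γ.radius with hγ
  have hγc : Continuous γ := continuous_circleMap _ _
  have hgc : Continuous fun θ => g (γ θ) :=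
    hg.comp_continuous hγc fun θ => circleMap_mem_sphere _ hR θ
  have hdc : Continuous fun θ => deriv γ θ := by
    have : (fun θ => deriv γ θ) = fun θ => circleMap 0 Γ.radius θ * Complex.I := by
      ext θ; exact deriv_circleMap _ _ _
    rw [this]
    exact (continuous_circleMap _ _).mul continuous_const
  have hs : ∀ θ, HasSum (fun m : ℕ => (‖t‖ * ‖γ θ‖) ^ m / (m.factorial : ℝ) *
      ‖deriv γ θ * g (γ θ)‖) (Real.exp (‖t‖ * ‖γ θ‖) * ‖deriv γ θ * g (γ θ)‖) := fun θ => by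
    have := NormedSpace.expSeries_div_hasSum_exp (‖t‖ * ‖γ θ‖)
    rw [← Real.exp_eq_exp_ℝ] at this
    exact this.mul_right _
  have key : HasSum (fun m : ℕ => ∫ θ in (0 : ℝ)..2 * Real.pi,
      deriv γ θ • (t ^ m / (m.factorial : ℂ) * (γ θ ^ m * g (γ θ))))
      (∫ θ in (0 : ℝ)..2 * Real.pi, deriv γ θ • (Complex.exp (t * γ θ) * g (γ θ))) := by
    refine intervalIntegral.hasSum_integral_of_dominated_convergence
      (fun m θ => (‖t‖ * ‖γ θ‖) ^ m / (m.factorial : ℝ) * ‖deriv γ θ * g (γ θ)‖) ?_ ?_ ?_ ?_ ?_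
    · intro m
      exact (hdc.smul (continuous_const.mul ((hγc.pow m).mul hgc))).aestronglyMeasurable
    · intro m
      refine ae_of_all _ fun θ _ => le_of_eq ?_
      simp only [smul_eq_mul, norm_mul, norm_div, norm_pow, Complex.norm_natCast, mul_pow]
      ring
    · exact ae_of_all _ fun θ _ => (hs θ).summable
    · have : (fun θ => ∑' m : ℕ, (‖t‖ * ‖γ θ‖) ^ m / (m.factorial : ℝ) * ‖deriv γ θ * g (γ θ)‖) =
          fun θ => Real.exp (‖t‖ * ‖γ θ‖) * ‖deriv γ θ * g (γ θ)‖ := by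
        ext θ; exact (hs θ).tsum_eq
      rw [this]
      exact ((Real.continuous_exp.comp (continuous_const.mul hγc.norm)).mul
        (hdc.mul hgc).norm).intervalIntegrable _ _
    · refine ae_of_all _ fun θ _ => ?_
      have := NormedSpace.expSeries_div_hasSum_exp (t * γ θ)
      rw [← Complex.exp_eq_exp_ℂ] at this
      have := (this.mul_right (g (γ θ))).mul_left (deriv γ θ)
      refine hasSum_of_eq this (fun m => ?_) (by rw [smul_eq_mul])
      rw [smul_eq_mul, mul_pow]
      ring
  refine hasSum_of_eq (key.mul_left (2 * Real.pi * Complex.I : ℂ)⁻¹) (fun m => ?_) rfl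
  rw [← contour_const_mul]
  rfl

/-- The coefficient of `z ^ m` in the power series of `exp (t * z)`; it is `0` for `m < 0`. -/
def expCoeff (t : ℂ) (m : ℤ) : ℂ := if 0 ≤ m then t ^ m.toNat / (m.toNat.factorial : ℂ) else 0

lemma expCoeff_natCast (t : ℂ) (m : ℕ) : expCoeff t m = t ^ m / (m.factorial : ℂ) := by
  simp [expCoeff]

lemma expCoeff_of_neg (t : ℂ) {m : ℤ} (h : m < 0) : expCoeff t m = 0 := by
  simp [expCoeff, h]

lemma expCoeff_zero (m : ℤ) : expCoeff 0 m = if m = 0 then 1 else 0 := by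
  rcases lt_trichotomy m 0 with h | rfl | h
  · rw [expCoeff_of_neg _ h, if_neg h.ne]
  · simp [expCoeff]
  · rw [expCoeff, if_pos h.le, if_neg h.ne', zero_pow (by omega), zero_div]

lemma hasDerivAt_expCoeff (m : ℤ) (t : ℝ) :
    HasDerivAt (fun t : ℝ => expCoeff t m) (expCoeff t (m - 1)) t := by
  rcases lt_or_ge m 0 with h | h
  · simp only [expCoeff_of_neg _ h, expCoeff_of_neg _ (show m - 1 < 0 by omega)]
    exact hasDerivAt_const _ _
  obtain ⟨m, rfl⟩ := Int.eq_ofNat_of_zero_le h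
  rcases m with _ | m
  · simp only [expCoeff_natCast, pow_zero]
    rw [expCoeff_of_neg _ (by simp)]
    exact hasDerivAt_const _ _
  · rw [show ((m + 1 : ℕ) : ℤ) - 1 = (m : ℕ) by push_cast; ring]
    simp only [expCoeff_natCast]
    have h1 : HasDerivAt (fun t : ℝ => (t : ℂ) ^ (m + 1)) (((m + 1 : ℕ) : ℂ) * (t : ℂ) ^ m) t := by
      simpa using (hasDerivAt_pow (m + 1) (t : ℂ)).comp_ofReal
    refine (h1.div_const (((m + 1).factorial : ℕ) : ℂ)).congr_deriv ?_
    rw [Nat.factorial_succ]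
    have := Nat.cast_ne_zero (R := ℂ).mpr (Nat.succ_ne_zero m)
    have := Nat.cast_ne_zero (R := ℂ).mpr (Nat.factorial_ne_zero m)
    push_cast at *
    field_simp

lemma contour_exp_mul_zpow {Γ : CircleContour} (h0 : Γ.Inside 0) (t : ℂ) (p : ℤ) :
    contour Γ (fun z => Complex.exp (t * z) * z ^ p) = expCoeff t (-1 - p) := by
  have hR := h0.radius_pos.le
  have h := hasSum_contour_exp hR (g := fun z => z ^ p)
    (fun z hz => (continuousAt_zpow₀ z p (Or.inl (h0.ne hz))).continuousWithinAt) t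
  have e : ∀ m : ℕ, contour Γ (fun z => z ^ m * z ^ p) = if (m : ℤ) + p = -1 then 1 else 0 := by
    intro m
    rw [← contour_zpow h0]
    refine contour_congr hR fun z hz => ?_
    simp only [zpow_add₀ (h0.ne hz), zpow_natCast]
  simp only [e] at h
  refine h.unique ?_
  rcases lt_or_ge (-1 - p) 0 with hp | hp
  · rw [expCoeff_of_neg _ hp]
    convert hasSum_zero using 2 with m
    rw [if_neg (by omega), mul_zero]
  · obtain ⟨k, hk⟩ := Int.eq_ofNat_of_zero_le hp
    rw [hk, expCoeff_natCast]
    convert hasSum_single (α := ℂ) k ?_ using 1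
    · rw [if_pos (by omega), mul_one]
    · intro m hm
      rw [if_neg (by omega), mul_zero]

/-- The polynomial `(X - v_{k+1}) ⋯ (X - v_n)`. -/
def factorPoly (v : ℕ → ℝ) (k n : ℕ) : Polynomial ℂ :=
  ∏ i ∈ Finset.Icc (k + 1) n, (Polynomial.X - Polynomial.C (v i : ℂ))

lemma factorPoly_eval (v : ℕ → ℝ) (k n : ℕ) (z : ℂ) :
    (factorPoly v k n).eval z = factors v (k + 1) n z := by
  simp [factorPoly, factors, Polynomial.eval_prod]

lemma factorPoly_monic (v : ℕ → ℝ) (k n : ℕ) : (factorPoly v k n).Monic :=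
  Polynomial.monic_prod_of_monic _ _ fun _ _ => Polynomial.monic_X_sub_C _

lemma factorPoly_natDegree (v : ℕ → ℝ) (k n : ℕ) : (factorPoly v k n).natDegree = n - k := by
  rw [factorPoly, Polynomial.natDegree_prod_of_monic _ _ fun _ _ => Polynomial.monic_X_sub_C _]
  simp

lemma factors_eq_sum (v : ℕ → ℝ) (k n : ℕ) (z : ℂ) : factors v (k + 1) n z =
    ∑ j ∈ Finset.range (n - k + 1), (factorPoly v k n).coeff j * z ^ j := by
  rw [← factorPoly_eval, Polynomial.eval_eq_sum_range, factorPoly_natDegree]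

/-- For `k ≤ n` the integral defining `Psi` is a Taylor coefficient of an entire function. -/
lemma Psi_eq_sum {v : ℕ → ℝ} {Γ : CircleContour} (h0 : Γ.Inside 0) {n k : ℕ} (hk : k ≤ n)
    (hv : ∀ j ∈ Finset.Icc 1 k, Γ.Inside (v j)) (t : ℝ) (x : ℤ) :
    Psi v Γ t n k x =
      ∑ j ∈ Finset.range (n - k + 1), (factorPoly v k n).coeff j * expCoeff t (x + n - j) := by
  have hR := h0.radius_pos.le
  have e : Set.EqOn (fun z => Complex.exp (t * z) / z ^ (x + n + 1) *
      (factors v 1 n z / factors v 1 k z))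
      (fun z => ∑ j ∈ Finset.range (n - k + 1), (factorPoly v k n).coeff j *
        (Complex.exp (t * z) * z ^ ((j : ℤ) - (x + n + 1)))) Γ.circle := by
    intro z hz
    have hz0 := h0.ne hz
    dsimp only
    rw [← factors_mul v (by omega : 1 ≤ k + 1) hk, mul_div_cancel_left₀ _ (factors_ne_zero hv hz),
      factors_eq_sum, Finset.mul_sum]
    refine Finset.sum_congr rfl fun j _ => ?_
    rw [zpow_sub₀ hz0, zpow_natCast]
    ring
  rw [Psi, contour_congr hR e, contour_sum hR]
  · refine Finset.sum_congr rfl fun j _ => ?_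
    rw [contour_const_mul, contour_exp_mul_zpow h0]
    congr 2
    ring
  · intro j _
    refine continuousOn_const.mul (ContinuousOn.mul (by fun_prop) fun z hz =>
      (continuousAt_zpow₀ z _ (Or.inl (h0.ne hz))).continuousWithinAt)

/-- The generating function `∑ₓ Ψ(x) w ^ (x + n) = exp (t w) (w - v_{k+1}) ⋯ (w - v_n)`, integrated
against `g` along a circle that avoids the origin. -/
lemma hasSum_Psi_mul_contour {v : ℕ → ℝ} {Γ₀ Γ : CircleContour} (h0 : Γ₀.Inside 0) {n k : ℕ}
    (hk : k ≤ n) (hv : ∀ j ∈ Finset.Icc 1 k, Γ₀.Inside (v j)) (t : ℝ) (hR : 0 ≤ Γ.radius)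
    {g : ℂ → ℂ} (hg : ContinuousOn g Γ.circle) :
    HasSum (fun x : ℤ => Psi v Γ₀ t n k x * contour Γ (fun w => w ^ (x + n) * g w))
      (contour Γ (fun w => Complex.exp (t * w) * (factors v (k + 1) n w * g w))) := by
  have h1 : ∀ j : ℕ, HasSum (fun x : ℤ => expCoeff t (x + n - j) *
      contour Γ (fun w => w ^ (x + n) * g w))
      (contour Γ (fun w => Complex.exp (t * w) * (w ^ j * g w))) := by
    intro j
    have h := hasSum_contour_exp hR (g := fun w => w ^ j * g w) (by fun_prop) t
    have hi : Function.Injective fun m : ℕ => (m : ℤ) + j - n := fun a b hab => by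
      simp only at hab; omega
    rw [← hi.hasSum_iff]
    · refine hasSum_of_eq h (fun m => ?_) rfl
      rw [Function.comp_apply]
      rw [show (m : ℤ) + j - n + n - j = m by ring, expCoeff_natCast]
      congr 1
      refine contour_congr hR fun w hw => ?_
      rw [show (m : ℤ) + j - n + n = ((m + j : ℕ) : ℤ) by push_cast; ring, zpow_natCast, pow_add]
      ring
    · intro x hx
      rw [expCoeff_of_neg, zero_mul]
      by_contra hneg
      exact hx ⟨(x + n - j).toNat, by simp only; omega⟩
  have h2 := hasSum_sum (s := Finset.range (n - k + 1))
    fun j _ => (h1 j).mul_left ((factorPoly v k n).coeff j)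
  refine hasSum_of_eq h2 (fun x => ?_) ?_
  · rw [Psi_eq_sum h0 hk hv, Finset.sum_mul]
    exact Finset.sum_congr rfl fun j _ => by ring
  · rw [show (∑ j ∈ Finset.range (n - k + 1), (factorPoly v k n).coeff j *
        contour Γ (fun w => Complex.exp (t * w) * (w ^ j * g w))) =
        ∑ j ∈ Finset.range (n - k + 1), contour Γ (fun w => (factorPoly v k n).coeff j *
          (Complex.exp (t * w) * (w ^ j * g w))) from
      Finset.sum_congr rfl fun j _ => (contour_const_mul _ _ _).symm]
    rw [← contour_sum hR _ fun j _ => by fun_prop]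
    refine contour_congr hR fun w _ => ?_
    rw [factors_eq_sum, Finset.sum_mul, Finset.mul_sum]
    exact Finset.sum_congr rfl fun j _ => by ring

/-- The functions `Psi` at different levels are related by convolution with `phi`. -/
lemma hasSum_phi_mul_Psi {v : ℕ → ℝ} {Γ : CircleContour} {N : ℕ} (h0 : Γ.Inside 0)
    (hv : ∀ j ∈ Finset.Icc 1 N, Γ.Inside (v j)) {n k : ℕ} (hn : n < N) (hk : k ≤ N) (t : ℝ)
    (x : ℤ) : HasSum (fun x' : ℤ => phi v Γ n N x x' * Psi v Γ t N k x') (Psi v Γ t n k x) := by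
  have hR := h0.radius_pos.le
  have hvk : ∀ j ∈ Finset.Icc 1 k, Γ.Inside (v j) := fun j hj =>
    hv j (Finset.Icc_subset_Icc_right hk hj)
  have hvn : ∀ j ∈ Finset.Icc 1 n, Γ.Inside (v j) := fun j hj =>
    hv j (Finset.Icc_subset_Icc_right hn.le hj)
  have hvN : ∀ j ∈ Finset.Icc (n + 1) N, Γ.Inside (v j) := fun j hj =>
    hv j (Finset.Icc_subset_Icc_left (by omega) hj)
  have hg : ContinuousOn (fun w => (w ^ (x + n + 1))⁻¹ * (factors v (n + 1) N w)⁻¹) Γ.circle := by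
    refine ContinuousOn.mul (ContinuousOn.inv₀ (fun z hz => (continuousAt_zpow₀ z _
      (Or.inl (h0.ne hz))).continuousWithinAt) fun z hz => zpow_ne_zero _ (h0.ne hz)) ?_
    exact ContinuousOn.inv₀ (by fun_prop) fun z hz => factors_ne_zero hvN hz
  have h := hasSum_Psi_mul_contour h0 hk hvk t hR hg
  refine hasSum_of_eq h (fun x' => ?_) ?_
  · rw [mul_comm, phi, if_pos hn]
    congr 1
    refine contour_congr hR fun w hw => ?_
    have hw0 := h0.ne hw
    rw [show x' + (N : ℤ) = -(x - x' + 1) + (N - n : ℕ) + (x + n + 1) by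
      rw [Nat.cast_sub hn.le]; ring, zpow_add₀ hw0 _ (x + n + 1), zpow_add₀ hw0 (-(x - x' + 1)), zpow_neg,
      zpow_natCast]
    have := zpow_ne_zero (x + n + 1) hw0
    field_simp
  · rw [Psi]
    refine contour_congr hR fun w hw => ?_
    have h1 := factors_ne_zero hvk hw
    have h2 := factors_ne_zero hvN hw
    have h3 := zpow_ne_zero (x + n + 1) (h0.ne hw)
    have e1 := factors_mul v (by omega : 1 ≤ k + 1) hk w
    have e2 := factors_mul v (by omega : 1 ≤ n + 1) hn.le w
    field_simp
    rw [mul_comm, mul_comm (factors v 1 k w), mul_comm (factors v (k + 1) N w), e1, ← e2, mul_comm]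

lemma Phi_integrand_continuousOn {v : ℕ → ℝ} {Γ : CircleContour} {n : ℕ} (t : ℂ) (l : ℕ)
    (hv : ∀ j ∈ Finset.Icc 1 n, Γ.Inside (v j)) :
    ContinuousOn (fun w => (Complex.exp (t * w))⁻¹ * (factors v 1 l w / factors v 1 n w))
      Γ.circle :=
  ContinuousOn.mul (ContinuousOn.inv₀ (by fun_prop) fun z _ => Complex.exp_ne_zero _)
    (ContinuousOn.div (by fun_prop) (by fun_prop) fun z hz => factors_ne_zero hv hz)

/-- The functions `Psi` and `Phi` of one level are biorthogonal. -/
lemma hasSum_Psi_mul_Phi {v : ℕ → ℝ} {Γ₀ Γ₁ : CircleContour} {n k l : ℕ} (h0 : Γ₀.Inside 0)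
    (hk : k ∈ Finset.Icc 1 n) (hl : l ∈ Finset.Icc 1 n)
    (hv0 : ∀ j ∈ Finset.Icc 1 n, Γ₀.Inside (v j))
    (hv1 : ∀ j ∈ Finset.Icc 1 n, Γ₁.Inside (v j)) (t : ℝ) :
    HasSum (fun x : ℤ => Psi v Γ₀ t n k x * Phi v Γ₁ t n l x) (if k = l then 1 else 0) := by
  have hR : 0 ≤ Γ₁.radius := (hv1 k hk).radius_pos.le
  obtain ⟨hk1, hkn⟩ := Finset.mem_Icc.mp hk
  obtain ⟨hl1, hln⟩ := Finset.mem_Icc.mp hl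
  have hvk : ∀ j ∈ Finset.Icc 1 k, Γ₁.Inside (v j) := fun j hj =>
    hv1 j (Finset.Icc_subset_Icc_right hkn hj)
  have hg := Phi_integrand_continuousOn t (l - 1) hv1
  have h := hasSum_Psi_mul_contour h0 hkn
    (fun j hj => hv0 j (Finset.Icc_subset_Icc_right hkn hj)) t hR hg
  refine hasSum_of_eq h (fun x => ?_) ?_
  · rw [Phi]
    congr 1
    refine contour_congr hR fun w _ => ?_
    simp only [div_eq_mul_inv, mul_assoc]
  have e : Set.EqOn (fun w => Complex.exp (t * w) * (factors v (k + 1) n w *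
      ((Complex.exp (t * w))⁻¹ * (factors v 1 (l - 1) w / factors v 1 n w))))
      (fun w => factors v 1 (l - 1) w / factors v 1 k w) Γ₁.circle := by
    intro w hw
    have h1 := factors_ne_zero hvk hw
    have h2 := factors_ne_zero hv1 hw
    have h3 := Complex.exp_ne_zero (t * w)
    have e1 := factors_mul v (by omega : 1 ≤ k + 1) hkn w
    dsimp only
    rw [← e1] at h2 ⊢
    have h4 := right_ne_zero_of_mul h2
    field_simp
  rw [contour_congr hR e, eq_comm]
  rcases lt_or_ge k l with hkl | hkl
  · rw [if_neg hkl.ne]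
    have e2 : Set.EqOn (fun w => factors v 1 (l - 1) w / factors v 1 k w)
        (factors v (k + 1) (l - 1)) Γ₁.circle := by
      intro w hw
      have h1 := factors_ne_zero hvk hw
      dsimp only
      rw [← factors_mul v (by omega : 1 ≤ k + 1) (by omega : k ≤ l - 1),
        mul_div_cancel_left₀ _ h1]
    rw [contour_congr hR e2, contour_eq_zero hR]
    intro z _
    unfold factors
    fun_prop
  · set s : Multiset ℂ := (Finset.Icc l k).val.map fun j => (v j : ℂ) with hs
    have hsI : ∀ a ∈ s, Γ₁.Inside a := by
      intro a ha
      rw [hs, Multiset.mem_map] at ha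
      obtain ⟨j, hj, rfl⟩ := ha
      exact hvk j (Finset.Icc_subset_Icc_left hl1 hj)
    have e2 : Set.EqOn (fun w => factors v 1 (l - 1) w / factors v 1 k w)
        (fun w => (rootProd s w)⁻¹) Γ₁.circle := by
      intro w hw
      have h1 := factors_ne_zero hvk hw
      have e3 := factors_mul v (by omega : 1 ≤ l - 1 + 1) (by omega : l - 1 ≤ k) w
      rw [show l - 1 + 1 = l by omega] at e3
      simp only [hs, ← factors_eq_rootProd]
      rw [← e3] at h1 ⊢
      have h2 := left_ne_zero_of_mul h1
      have h3 := right_ne_zero_of_mul h1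
      field_simp
    rw [contour_congr hR e2, contour_rootProd_inv hR s hsI]
    have : s.card = k + 1 - l := by simp [hs]
    rw [this]
    by_cases hkl' : k = l
    · rw [if_pos hkl', if_pos (by omega)]
    · rw [if_neg hkl', if_neg (by omega)]

/-- For `l ≤ n` the functions `Phi` at the levels `n` and `n + 1` are related by a first order
difference equation; for `l = n + 1` the right hand side of that equation is `0`. -/
lemma Phi_sub_Phi {v : ℕ → ℝ} {Γ : CircleContour} {n l : ℕ} (hl : l ∈ Finset.Icc 1 (n + 1))
    (h0 : Γ.Outside 0) (hv : ∀ j ∈ Finset.Icc 1 (n + 1), Γ.Inside (v j)) (t : ℝ) (x : ℤ) :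
    Phi v Γ t (n + 1) l x - v (n + 1) * Phi v Γ t (n + 1) l (x - 1) =
      if l ≤ n then Phi v Γ t n l x else 0 := by
  have hR : 0 ≤ Γ.radius := (hv l hl).radius_pos.le
  obtain ⟨hl1, hln⟩ := Finset.mem_Icc.mp hl
  have hvn : ∀ j ∈ Finset.Icc 1 n, Γ.Inside (v j) := fun j hj =>
    hv j (Finset.Icc_subset_Icc_right (by omega) hj)
  have hc : ∀ y : ℤ, ContinuousOn (fun w => w ^ (y + (n + 1 : ℕ)) / Complex.exp (t * w) *
      (factors v 1 (l - 1) w / factors v 1 (n + 1) w)) Γ.circle := by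
    intro y
    refine ((ContinuousOn.mul (f := fun w : ℂ => w ^ (y + (n + 1 : ℕ))) (fun z hz =>
      (continuousAt_zpow₀ z _ (Or.inl (h0.ne hz))).continuousWithinAt)
      (Phi_integrand_continuousOn t (l - 1) hv))).congr fun w _ => ?_
    simp only [div_eq_mul_inv, mul_assoc, Pi.mul_apply]
  have e : Set.EqOn (fun w => w ^ (x + (n + 1 : ℕ)) / Complex.exp (t * w) *
      (factors v 1 (l - 1) w / factors v 1 (n + 1) w) - v (n + 1) *
      (w ^ (x - 1 + (n + 1 : ℕ)) / Complex.exp (t * w) *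
      (factors v 1 (l - 1) w / factors v 1 (n + 1) w)))
      (fun w => w ^ (x + n) / Complex.exp (t * w) *
      (factors v 1 (l - 1) w / factors v 1 n w)) Γ.circle := by
    intro w hw
    have h1 := factors_ne_zero hvn hw
    have h2 : w - v (n + 1) ≠ 0 := sub_ne_zero.mpr ((hv (n + 1) (by simp)).ne hw)
    have h3 := Complex.exp_ne_zero (t * w)
    dsimp only
    rw [factors_succ v (by omega), show x + ((n + 1 : ℕ) : ℤ) = x + n + 1 by push_cast; ring,
      show x - 1 + ((n + 1 : ℕ) : ℤ) = x + n by push_cast; ring, zpow_add_one₀ (h0.ne hw)]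
    field_simp
  rw [Phi, Phi, ← contour_sub_const_mul hR _ (hc x) (hc (x - 1)),
    contour_congr hR e]
  split_ifs with h
  · rfl
  · obtain rfl : l = n + 1 := by omega
    have e2 : Set.EqOn (fun w => w ^ (x + n) / Complex.exp (t * w) *
        (factors v 1 (n + 1 - 1) w / factors v 1 n w))
        (fun w => w ^ (x + n) * (Complex.exp (t * w))⁻¹) Γ.circle := by
      intro w hw
      have h1 := factors_ne_zero hvn hw
      simp only [Nat.add_sub_cancel]
      rw [div_self h1, mul_one, div_eq_mul_inv]
    rw [contour_congr hR e2]
    refine contour_eq_zero hR fun z hz => ?_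
    have hz0 : z ≠ 0 := by rintro rfl; exact h0 hz
    refine DifferentiableAt.mul (differentiableAt_zpow.mpr (Or.inl hz0)) ?_
    exact DifferentiableAt.inv (by fun_prop) (Complex.exp_ne_zero _)

/-- For `l = n` the function `Phi` is a geometric sequence. -/
lemma Phi_self {v : ℕ → ℝ} {Γ : CircleContour} {n : ℕ} (hn : 1 ≤ n) (hv0 : v n ≠ 0)
    (h0 : Γ.Outside 0) (hv : ∀ j ∈ Finset.Icc 1 n, Γ.Inside (v j)) (t : ℝ) (x : ℤ) :
    Phi v Γ t n n x = (v n : ℂ) ^ x * Phi v Γ t n n 0 := by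
  obtain ⟨n, rfl⟩ : ∃ m, n = m + 1 := ⟨n - 1, by omega⟩
  have hv0' : (v (n + 1) : ℂ) ≠ 0 := by exact_mod_cast hv0
  have h : ∀ x, Phi v Γ t (n + 1) (n + 1) x = v (n + 1) * Phi v Γ t (n + 1) (n + 1) (x - 1) := by
    intro x
    have := Phi_sub_Phi (l := n + 1) (by simp) h0 hv t x
    rw [if_neg (by omega), sub_eq_zero] at this
    exact this
  induction x using Int.induction_on with
  | zero => simp
  | succ i ih => rw [h, zpow_add_one₀ hv0', add_sub_cancel_right, ih]; ring
  | pred i ih =>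
    have := h (-(i : ℤ))
    rw [ih] at this
    rw [zpow_sub_one₀ hv0']
    refine mul_left_cancel₀ hv0' ?_
    rw [← this]
    field_simp

/-- In its last level argument, `phi` solves the same difference equation as `Phi`, with a source
at equal levels. -/
lemma phi_sub_phi {v : ℕ → ℝ} {Γ : CircleContour} {n' n : ℕ} (h0 : Γ.Inside 0)
    (hv : ∀ j ∈ Finset.Icc 1 (n + 1), Γ.Inside (v j)) (x' x : ℤ) :
    phi v Γ n' (n + 1) x' x - v (n + 1) * phi v Γ n' (n + 1) x' (x - 1) =
      phi v Γ n' n x' x + if n' = n ∧ x' = x then 1 else 0 := by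
  have hR := h0.radius_pos.le
  rcases lt_or_ge n n' with hn | hn
  · simp [phi, show ¬ n' < n + 1 by omega, show ¬ n' < n by omega, show n' ≠ n by omega]
  have hvn : ∀ j ∈ Finset.Icc (n' + 1) n, Γ.Inside (v j) := fun j hj =>
    hv j (Finset.Icc_subset_Icc (by omega) (by omega) hj)
  have hvn1 : ∀ j ∈ Finset.Icc (n' + 1) (n + 1), Γ.Inside (v j) := fun j hj =>
    hv j (Finset.Icc_subset_Icc (by omega) (by omega) hj)
  have hc : ∀ y : ℤ, ContinuousOn (fun z => 1 / z ^ (x' - y + 1) * (z ^ (n + 1 - n') /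
      factors v (n' + 1) (n + 1) z)) Γ.circle := by
    intro y
    refine ContinuousOn.mul (ContinuousOn.div continuousOn_const (fun z hz =>
      (continuousAt_zpow₀ z _ (Or.inl (h0.ne hz))).continuousWithinAt)
      fun z hz => zpow_ne_zero _ (h0.ne hz)) ?_
    exact ContinuousOn.div (by fun_prop) (by fun_prop) fun z hz => factors_ne_zero hvn1 hz
  have e : Set.EqOn (fun z => 1 / z ^ (x' - x + 1) * (z ^ (n + 1 - n') /
      factors v (n' + 1) (n + 1) z) - v (n + 1) * (1 / z ^ (x' - (x - 1) + 1) * (z ^ (n + 1 - n') /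
      factors v (n' + 1) (n + 1) z)))
      (fun z => 1 / z ^ (x' - x + 1) * (z ^ (n - n') / factors v (n' + 1) n z)) Γ.circle := by
    intro z hz
    have hz0 := h0.ne hz
    have h1 := factors_ne_zero hvn hz
    have h2 : z - v (n + 1) ≠ 0 := sub_ne_zero.mpr ((hv (n + 1) (by simp)).ne hz)
    have h3 := zpow_ne_zero (x' - x + 1) hz0
    dsimp only
    rw [factors_succ v (by omega), show x' - (x - 1) + 1 = x' - x + 1 + 1 by ring,
      zpow_add_one₀ hz0 (x' - x + 1), show n + 1 - n' = n - n' + 1 by omega, pow_succ]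
    generalize z ^ (x' - x + 1) = a at *
    field_simp
  rw [phi, phi, if_pos (by omega), if_pos (by omega),
    ← contour_sub_const_mul hR _ (hc x) (hc (x - 1)), contour_congr hR e, phi]
  rcases hn.lt_or_eq with hn | rfl
  · rw [if_pos hn, if_neg (by omega), add_zero]
  · rw [if_neg (lt_irrefl _), zero_add]
    have e2 : Set.EqOn (fun z => 1 / z ^ (x' - x + 1) * (z ^ (n' - n') / factors v (n' + 1) n' z))
        (fun z => z ^ (-(x' - x + 1))) Γ.circle := by
      intro z _
      dsimp only
      rw [zpow_neg]
      simp [factors]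
    rw [contour_congr hR e2, contour_zpow h0]
    by_cases hx : x' = x
    · rw [if_pos (by omega), if_pos ⟨rfl, hx⟩]
    · rw [if_neg (by omega), if_neg (fun h => hx h.2)]

lemma hasDerivAt_Psi {v : ℕ → ℝ} {Γ : CircleContour} (h0 : Γ.Inside 0) {n k : ℕ} (hk : k ≤ n)
    (hv : ∀ j ∈ Finset.Icc 1 k, Γ.Inside (v j)) (t : ℝ) (x : ℤ) :
    HasDerivAt (fun t => Psi v Γ t n k x) (Psi v Γ t n k (x - 1)) t := by
  simp only [Psi_eq_sum h0 hk hv]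
  refine HasDerivAt.fun_sum fun j _ => ?_
  refine ((hasDerivAt_expCoeff (x + n - j) t).const_mul _).congr_deriv ?_
  rw [show x + (n : ℤ) - j - 1 = x - 1 + n - j by ring]

lemma Psi_eq_zero_of_lt {v : ℕ → ℝ} {Γ : CircleContour} (h0 : Γ.Inside 0) {n k : ℕ} (hk : k ≤ n)
    (hv : ∀ j ∈ Finset.Icc 1 k, Γ.Inside (v j)) (t : ℝ) {x : ℤ} (hx : x < -n) :
    Psi v Γ t n k x = 0 := by
  rw [Psi_eq_sum h0 hk hv]
  exact Finset.sum_eq_zero fun j _ => by rw [expCoeff_of_neg _ (by omega), mul_zero]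

/-- At time `0` the functions `Psi` are the coefficients of monic polynomials. -/
lemma Psi_zero {v : ℕ → ℝ} {Γ : CircleContour} (h0 : Γ.Inside 0) {n k : ℕ} (hk : k ≤ n)
    (hv : ∀ j ∈ Finset.Icc 1 k, Γ.Inside (v j)) (m : ℕ) :
    Psi v Γ 0 n k ((m : ℤ) - n) = (factorPoly v k n).coeff m := by
  rw [Psi_eq_sum h0 hk hv]
  simp only [Complex.ofReal_zero, expCoeff_zero]
  have : ∀ j ∈ Finset.range (n - k + 1), (factorPoly v k n).coeff j *
      (if (m : ℤ) - n + n - j = 0 then 1 else 0) =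
      if m = j then (factorPoly v k n).coeff j else 0 := by
    intro j _
    by_cases h : m = j
    · subst h; simp
    · rw [if_neg (by omega), if_neg h, mul_zero]
  rw [Finset.sum_congr rfl this, Finset.sum_ite_eq]
  split_ifs with h
  · rfl
  · rw [Polynomial.coeff_eq_zero_of_natDegree_lt]
    rw [factorPoly_natDegree]
    simp at h
    omega

/-! ### The linear span of the functions `Phi` -/

open Classical in
/-- The span of the functions `x ↦ u ^ x * x ^ j`, where `u` runs through the elements of the
multiset `s` and `j` is less than the multiplicity of `u`. -/
def powSpan (s : Multiset ℂ) : Submodule ℂ (ℤ → ℂ) :=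
  Submodule.span ℂ {f | ∃ u ∈ s, ∃ j < s.count u, f = fun x : ℤ => u ^ x * (x : ℂ) ^ j}

lemma powSpan_mono {s s' : Multiset ℂ} (h : s ≤ s') : powSpan s ≤ powSpan s' := by
  refine Submodule.span_mono ?_
  rintro f ⟨u, hu, j, hj, rfl⟩
  exact ⟨u, Multiset.mem_of_le h hu, j, hj.trans_le (Multiset.count_le_of_le u h), rfl⟩

lemma continuousOn_zpow_circle {Γ : CircleContour} (h0 : Γ.Outside 0) (x : ℤ) :
    ContinuousOn (fun w : ℂ => w ^ x) Γ.circle := fun z hz =>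
  (continuousAt_zpow₀ z _ (Or.inl (h0.ne hz))).continuousWithinAt

lemma continuousOn_zpow_mul_rootProd_inv {Γ : CircleContour} {s : Multiset ℂ} (h0 : Γ.Outside 0)
    (hs : ∀ a ∈ s, Γ.Inside a) (x : ℤ) :
    ContinuousOn (fun w => w ^ x * (rootProd s w)⁻¹) Γ.circle :=
  (continuousOn_zpow_circle h0 x).mul (continuousOn_rootProd_inv hs)

lemma contour_zpow_eq_zero {Γ : CircleContour} (hR : 0 ≤ Γ.radius) (h0 : Γ.Outside 0) (x : ℤ)
    {h : ℂ → ℂ} (hh : Differentiable ℂ h) : contour Γ (fun w => w ^ x * h w) = 0 := by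
  refine contour_eq_zero hR fun z hz => ?_
  have hz0 : z ≠ 0 := by rintro rfl; exact h0 hz
  exact (differentiableAt_zpow.mpr (Or.inl hz0)).mul (hh z)

/-- Multiplication by `w - a` removes a pole; in terms of `x` it is a difference operator. -/
lemma contour_zpow_mul_rootProd_inv_cons {Γ : CircleContour} (h0 : Γ.Outside 0) {a : ℂ}
    {s : Multiset ℂ} (ha : Γ.Inside a) (hs : ∀ b ∈ s, Γ.Inside b) (x : ℤ) :
    contour Γ (fun w => w ^ (x + 1) * (rootProd (a ::ₘ s) w)⁻¹) -
      a * contour Γ (fun w => w ^ x * (rootProd (a ::ₘ s) w)⁻¹) =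
      contour Γ (fun w => w ^ x * (rootProd s w)⁻¹) := by
  have hR := ha.radius_pos.le
  have has : ∀ b ∈ a ::ₘ s, Γ.Inside b := by
    intro b hb
    rcases Multiset.mem_cons.mp hb with rfl | hb
    exacts [ha, hs b hb]
  rw [← contour_sub_const_mul hR _
    (continuousOn_zpow_mul_rootProd_inv h0 has _) (continuousOn_zpow_mul_rootProd_inv h0 has _)]
  refine contour_congr hR fun w hw => ?_
  have h1 := sub_ne_zero.mpr (ha.ne hw)
  rw [zpow_add_one₀ (h0.ne hw), rootProd_cons, mul_inv]
  field_simp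

lemma descPochhammer_eval_add_one_sub (p : ℕ) (x : ℂ) :
    (descPochhammer ℂ (p + 1)).eval (x + 1) - (descPochhammer ℂ (p + 1)).eval x =
      (p + 1) * (descPochhammer ℂ p).eval x := by
  have h : (descPochhammer ℂ (p + 1)).eval (x + 1) = (x + 1) * (descPochhammer ℂ p).eval x := by
    rw [descPochhammer_succ_left]
    simp
  rw [h, descPochhammer_succ_eval]
  ring

/-- The integral with a single pole of order `p + 1` is given by a binomial coefficient. -/
lemma contour_zpow_mul_rootProd_replicate {Γ : CircleContour} (h0 : Γ.Outside 0) {a : ℂ}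
    (ha : Γ.Inside a) (p : ℕ) (x : ℤ) :
    contour Γ (fun w => w ^ x * (rootProd (Multiset.replicate (p + 1) a) w)⁻¹) =
      a ^ x * (a ^ p * (p.factorial : ℂ))⁻¹ * (descPochhammer ℂ p).eval (x : ℂ) := by
  have hR := ha.radius_pos.le
  have ha0 : a ≠ 0 := by rintro rfl; exact h0 (Metric.ball_subset_closedBall ha)
  have hrep : ∀ p : ℕ, ∀ b ∈ Multiset.replicate p a, Γ.Inside b := fun p b hb => by
    rwa [Multiset.eq_of_mem_replicate hb]
  induction p generalizing x with
  | zero =>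
    have hd : ∀ x : ℤ, contour Γ (fun w => w ^ (x + 1) * (rootProd {a} w)⁻¹) =
        a * contour Γ (fun w => w ^ x * (rootProd {a} w)⁻¹) := fun x => by
      have h1 := contour_zpow_mul_rootProd_inv_cons h0 ha (s := 0) (by simp) x
      have h2 := contour_zpow_eq_zero hR h0 x (differentiable_const (1 : ℂ))
      simp only [rootProd_zero, inv_one] at h1
      rw [h2, sub_eq_zero] at h1
      exact h1
    simp only [zero_add, Multiset.replicate_one, pow_zero, Nat.factorial_zero, Nat.cast_one,
      mul_one, inv_one, descPochhammer_zero, Polynomial.eval_one]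
    induction x using Int.induction_on with
    | zero =>
      have := contour_rootProd_inv hR {a} (by simpa using ha)
      simpa using this
    | succ i ih => rw [hd, ih, zpow_add_one₀ ha0, mul_comm]
    | pred i ih =>
      refine mul_left_cancel₀ ha0 ?_
      rw [← hd, sub_add_cancel, ih, zpow_sub_one₀ ha0]
      field_simp
  | succ p ihp =>
    have hd : ∀ x : ℤ, contour Γ (fun w => w ^ (x + 1) *
        (rootProd (Multiset.replicate (p + 1 + 1) a) w)⁻¹) -
        a * contour Γ (fun w => w ^ x * (rootProd (Multiset.replicate (p + 1 + 1) a) w)⁻¹) =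
        a ^ x * (a ^ p * (p.factorial : ℂ))⁻¹ * (descPochhammer ℂ p).eval (x : ℂ) := fun x => by
      have h1 := contour_zpow_mul_rootProd_inv_cons h0 ha (hrep (p + 1)) x
      rw [ihp, ← Multiset.replicate_succ] at h1
      exact h1
    have he : ∀ x : ℤ, a ^ (x + 1) * (a ^ (p + 1) * ((p + 1).factorial : ℂ))⁻¹ *
        (descPochhammer ℂ (p + 1)).eval ((x + 1 : ℤ) : ℂ) - a * (a ^ x *
        (a ^ (p + 1) * ((p + 1).factorial : ℂ))⁻¹ * (descPochhammer ℂ (p + 1)).eval (x : ℂ)) =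
        a ^ x * (a ^ p * (p.factorial : ℂ))⁻¹ * (descPochhammer ℂ p).eval (x : ℂ) := fun x => by
      have h1 := descPochhammer_eval_add_one_sub p (x : ℂ)
      have h2 := Nat.cast_ne_zero (R := ℂ).mpr (Nat.succ_ne_zero p)
      have h3 := Nat.cast_ne_zero (R := ℂ).mpr (Nat.factorial_ne_zero p)
      rw [zpow_add_one₀ ha0, Nat.factorial_succ]
      push_cast at h2 ⊢
      rw [sub_eq_iff_eq_add] at h1
      rw [h1]
      field_simp
      ring
    induction x using Int.induction_on with
    | zero =>
      have := contour_rootProd_inv hR _ (hrep (p + 1 + 1))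
      rw [if_neg (by simp)] at this
      simp only [zpow_zero, one_mul, Int.cast_zero]
      rw [this, descPochhammer_succ_left]
      simp
    | succ i ih =>
      have h1 := hd i
      have h2 := he i
      rw [ih] at h1
      linear_combination h1 - h2
    | pred i ih =>
      have h1 := hd (-(i : ℤ) - 1)
      have h2 := he (-(i : ℤ) - 1)
      rw [sub_add_cancel] at h1 h2
      rw [ih] at h1
      refine mul_left_cancel₀ ha0 ?_
      linear_combination h2 - h1

lemma zpow_mul_eval_mem_powSpan {a : ℂ} {s : Multiset ℂ} {p : ℕ}
    (hs : Multiset.replicate (p + 1) a ≤ s) (c : ℂ) (q : Polynomial ℂ) (hq : q.natDegree ≤ p) :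
    (fun x : ℤ => a ^ x * c * q.eval (x : ℂ)) ∈ powSpan s := by
  classical
  have e : (fun x : ℤ => a ^ x * c * q.eval (x : ℂ)) =
      ∑ j ∈ Finset.range (q.natDegree + 1), (c * q.coeff j) • fun x : ℤ => a ^ x * (x : ℂ) ^ j := by
    ext x
    rw [Polynomial.eval_eq_sum_range, Finset.mul_sum, Finset.sum_apply]
    refine Finset.sum_congr rfl fun j _ => ?_
    simp only [Pi.smul_apply, smul_eq_mul]
    ring
  rw [e]
  refine Submodule.sum_mem _ fun j hj => Submodule.smul_mem _ _ (Submodule.subset_span ?_)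
  have hc := Multiset.le_count_iff_replicate_le.mpr hs
  refine ⟨a, ?_, j, ?_, rfl⟩
  · exact Multiset.mem_of_le hs (by simp)
  · have := Finset.mem_range.mp hj
    convert (show j < Multiset.count a s by omega)

/-- Several poles are reduced to a single multiple pole by partial fractions. -/
lemma contour_zpow_mul_rootProd_inv_mem {Γ : CircleContour} (hR : 0 ≤ Γ.radius)
    (h0 : Γ.Outside 0) (s : Multiset ℂ) (hs : ∀ a ∈ s, Γ.Inside a) :
    (fun x : ℤ => contour Γ (fun w => w ^ x * (rootProd s w)⁻¹)) ∈ powSpan s := by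
  induction hn : s.card using Nat.strong_induction_on generalizing s with
  | _ n ih =>
    by_cases hs0 : s = 0
    · subst hs0
      have : (fun x : ℤ => contour Γ (fun w => w ^ x * (rootProd 0 w)⁻¹)) = 0 := by
        ext x
        simpa using contour_zpow_eq_zero hR h0 x (differentiable_const (1 : ℂ))
      rw [this]
      exact Submodule.zero_mem _
    rcases multiset_replicate_or s hs0 with ⟨a, k, rfl⟩ | ⟨a, b, s', hab, rfl⟩
    · simp only [contour_zpow_mul_rootProd_replicate h0 (hs a (by simp))]
      exact zpow_mul_eval_mem_powSpan le_rfl _ _ (descPochhammer_natDegree ℂ k).le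
    · have hn' : n = s'.card + 2 := by simpa using hn.symm
      have has : ∀ c ∈ a ::ₘ s', Γ.Inside c := fun c hc => hs c (by
        simp only [Multiset.mem_cons] at hc ⊢; tauto)
      have hbs : ∀ c ∈ b ::ₘ s', Γ.Inside c := fun c hc => hs c (by
        simp only [Multiset.mem_cons] at hc ⊢; tauto)
      have e : (fun x : ℤ => contour Γ (fun w => w ^ x * (rootProd (a ::ₘ b ::ₘ s') w)⁻¹)) =
          (a - b)⁻¹ • ((fun x : ℤ => contour Γ (fun w => w ^ x * (rootProd (a ::ₘ s') w)⁻¹)) -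
            fun x : ℤ => contour Γ (fun w => w ^ x * (rootProd (b ::ₘ s') w)⁻¹)) := by
        ext x
        simp only [Pi.smul_apply, Pi.sub_apply, smul_eq_mul]
        rw [← contour_sub hR
          (continuousOn_zpow_mul_rootProd_inv h0 has _)
          (continuousOn_zpow_mul_rootProd_inv h0 hbs _),
          ← contour_const_mul]
        refine contour_congr hR fun w hw => ?_
        rw [rootProd_inv_partial_fractions s' hab ((hs a (by simp)).ne hw)
          ((hs b (by simp)).ne hw)]
        ring
      rw [e]
      refine Submodule.smul_mem _ _ (Submodule.sub_mem _ ?_ ?_)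
      · refine powSpan_mono ?_ (ih (s'.card + 1) (by omega) (a ::ₘ s') has (by simp))
        exact Multiset.cons_le_cons a (Multiset.le_cons_self s' b)
      · exact powSpan_mono (Multiset.le_cons_self _ a)
          (ih (s'.card + 1) (by omega) (b ::ₘ s') hbs (by simp))

/-- An entire factor `h` is removed by writing `h w = h a + (w - a) * dslope h a w`, which in the
second summand cancels the pole `a`. -/
lemma contour_zpow_mul_entire_mem {Γ : CircleContour} (hR : 0 ≤ Γ.radius)
    (h0 : Γ.Outside 0) (s : Multiset ℂ) (hs : ∀ a ∈ s, Γ.Inside a) {h : ℂ → ℂ}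
    (hh : Differentiable ℂ h) :
    (fun x : ℤ => contour Γ (fun w => w ^ x * (h w * (rootProd s w)⁻¹))) ∈ powSpan s := by
  induction s using Multiset.induction generalizing h with
  | empty =>
    have : (fun x : ℤ => contour Γ (fun w => w ^ x * (h w * (rootProd 0 w)⁻¹))) = 0 := by
      ext x
      simpa using contour_zpow_eq_zero hR h0 x hh
    rw [this]
    exact Submodule.zero_mem _
  | cons a s ih =>
    have hss : ∀ b ∈ s, Γ.Inside b := fun b hb => hs b (Multiset.mem_cons_of_mem hb)
    have hd : Differentiable ℂ (dslope h a) := by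
      rw [← differentiableOn_univ]
      exact (Complex.differentiableOn_dslope Filter.univ_mem).mpr hh.differentiableOn
    have e : (fun x : ℤ => contour Γ (fun w => w ^ x * (h w * (rootProd (a ::ₘ s) w)⁻¹))) =
        h a • (fun x : ℤ => contour Γ (fun w => w ^ x * (rootProd (a ::ₘ s) w)⁻¹)) +
          fun x : ℤ => contour Γ (fun w => w ^ x * (dslope h a w * (rootProd s w)⁻¹)) := by
      ext x
      simp only [Pi.smul_apply, Pi.add_apply, smul_eq_mul]
      rw [← contour_const_mul, ← contour_add hR
        (f := fun z => h a * (z ^ x * (rootProd (a ::ₘ s) z)⁻¹))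
        (g := fun z => z ^ x * (dslope h a z * (rootProd s z)⁻¹))
        (continuousOn_const.mul (continuousOn_zpow_mul_rootProd_inv h0 hs x))
        ((continuousOn_zpow_circle h0 _).mul
          (hd.continuous.continuousOn.mul (continuousOn_rootProd_inv hss)))]
      refine contour_congr hR fun w hw => ?_
      have hwa := (hs a (by simp)).ne hw
      have h1 := sub_ne_zero.mpr hwa
      have h2 := rootProd_ne_zero hss hw
      rw [dslope_of_ne _ hwa, slope_def_field, rootProd_cons]
      field_simp
      ring
    rw [e]
    exact Submodule.add_mem _ (Submodule.smul_mem _ _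
      (contour_zpow_mul_rootProd_inv_mem hR h0 _ hs))
      (powSpan_mono (Multiset.le_cons_self s a) (ih hss hd))

/-- All the factors of the integrand of `Phi` other than `w ^ x` and the poles are entire. -/
lemma Phi_mem_spaceV {v : ℕ → ℝ} {Γ : CircleContour} {n l : ℕ} (hl : l ∈ Finset.Icc 1 n)
    (h0 : Γ.Outside 0) (hv : ∀ j ∈ Finset.Icc 1 n, Γ.Inside (v j)) (t : ℝ) :
    Phi v Γ t n l ∈ spaceV v n := by
  classical
  have hR : 0 ≤ Γ.radius := (hv l hl).radius_pos.le
  set s : Multiset ℂ := (Finset.Icc 1 n).val.map fun j => (v j : ℂ) with hs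
  have hsI : ∀ a ∈ s, Γ.Inside a := by
    intro a ha
    rw [hs, Multiset.mem_map] at ha
    obtain ⟨j, hj, rfl⟩ := ha
    exact hv j hj
  have hd : Differentiable ℂ fun w : ℂ => w ^ n * Complex.exp (-(t * w)) *
      factors v 1 (l - 1) w := by
    unfold factors
    fun_prop
  have e : Phi v Γ t n l = fun x : ℤ => contour Γ (fun w => w ^ x *
      ((w ^ n * Complex.exp (-(t * w)) * factors v 1 (l - 1) w) * (rootProd s w)⁻¹)) := by
    ext x
    refine contour_congr hR fun w hw => ?_
    rw [zpow_add₀ (h0.ne hw), zpow_natCast, Complex.exp_neg, hs, ← factors_eq_rootProd]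
    ring
  rw [e]
  refine Submodule.span_mono ?_ (contour_zpow_mul_entire_mem hR h0 s hsI hd)
  rintro f ⟨u, hu, j, hj, rfl⟩
  rw [hs, Multiset.mem_map] at hu
  obtain ⟨i, hi, rfl⟩ := hu
  refine ⟨i, hi, j, ?_, rfl⟩
  rw [hs, Multiset.count_map] at hj
  convert hj using 1
  rw [Finset.card_def, Finset.filter_val]
  congr 2
  ext i'
  rw [Complex.ofReal_inj, eq_comm]

lemma finrank_spaceV_le (v : ℕ → ℝ) (n : ℕ) :
    Module.Finite ℂ (spaceV v n) ∧ Module.finrank ℂ (spaceV v n) ≤ n := by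
  classical
  set F : Finset (ℤ → ℂ) := ((Finset.Icc 1 n).image v).biUnion fun u =>
    (Finset.range ((Finset.Icc 1 n).filter fun i' => v i' = u).card).image
      fun j => fun x : ℤ => (u : ℂ) ^ x * (x : ℂ) ^ j with hF
  have hspan : spaceV v n = Submodule.span ℂ (F : Set (ℤ → ℂ)) := by
    unfold spaceV
    congr 1
    ext f
    simp only [hF, Set.mem_ofPred_eq, Finset.coe_biUnion, Finset.coe_image, Set.mem_iUnion,
      Set.mem_image, Finset.mem_coe, Finset.mem_range, exists_prop]
    constructor
    · rintro ⟨i, hi, j, hj, rfl⟩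
      refine ⟨v i, ⟨i, hi, rfl⟩, j, ?_, rfl⟩
      convert hj
    · rintro ⟨u, ⟨i, hi, rfl⟩, j, hj, rfl⟩
      refine ⟨i, hi, j, ?_, rfl⟩
      convert hj
  have hcard : F.card ≤ n := by
    calc F.card ≤ ∑ u ∈ (Finset.Icc 1 n).image v,
          ((Finset.Icc 1 n).filter fun i' => v i' = u).card :=
        Finset.card_biUnion_le.trans (Finset.sum_le_sum fun u _ =>
          Finset.card_image_le.trans (Finset.card_range _).le)
      _ = n := by
        rw [← Finset.card_eq_sum_card_image]
        simp
  rw [hspan]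
  exact ⟨Module.Finite.span_finset ℂ F, (finrank_span_finset_le_card F).trans hcard⟩

/-- The functions `Phi` are linearly independent by biorthogonality, and the space that contains
them has dimension at most `n`. -/
theorem span_Phi_eq_spaceV {v : ℕ → ℝ} {Γ₀ Γ₁ : CircleContour} {n : ℕ} (h0 : Γ₀.Inside 0)
    (hv0 : ∀ j ∈ Finset.Icc 1 n, Γ₀.Inside (v j)) (h1 : Γ₁.Outside 0)
    (hv1 : ∀ j ∈ Finset.Icc 1 n, Γ₁.Inside (v j)) (t : ℝ) :
    Submodule.span ℂ {f | ∃ l ∈ Finset.Icc 1 n, f = Phi v Γ₁ t n l} = spaceV v n := by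
  set b : Finset.Icc 1 n → ℤ → ℂ := fun l => Phi v Γ₁ t n l with hb
  have hset : {f | ∃ l ∈ Finset.Icc 1 n, f = Phi v Γ₁ t n l} = Set.range b := by
    ext f
    simp only [Set.mem_ofPred_eq, Set.mem_range, hb, Subtype.exists]
    constructor
    · rintro ⟨l, hl, rfl⟩; exact ⟨l, hl, rfl⟩
    · rintro ⟨l, hl, rfl⟩; exact ⟨l, hl, rfl⟩
  rw [hset]
  obtain ⟨hfin, hle⟩ := finrank_spaceV_le v n
  have hli : LinearIndependent ℂ b := by
    rw [Fintype.linearIndependent_iff]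
    intro c hc k
    have hsum := hasSum_sum (s := Finset.univ) fun (l : Finset.Icc 1 n) _ =>
      (hasSum_Psi_mul_Phi h0 k.2 l.2 hv0 hv1 t).mul_left (c l)
    have hz : (fun x : ℤ => ∑ l : Finset.Icc 1 n,
        c l * (Psi v Γ₀ t n k x * Phi v Γ₁ t n l x)) = fun _ => 0 := by
      ext x
      have := congrFun hc x
      simp only [Finset.sum_apply, Pi.smul_apply, smul_eq_mul, Pi.zero_apply, hb] at this
      calc _ = Psi v Γ₀ t n k x * ∑ l : Finset.Icc 1 n, c l * Phi v Γ₁ t n l x := by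
            rw [Finset.mul_sum]
            exact Finset.sum_congr rfl fun l _ => by ring
        _ = 0 := by rw [this, mul_zero]
    rw [hz] at hsum
    have := hsum.unique hasSum_zero
    rw [Finset.sum_eq_single k] at this
    · simpa using this
    · intro l _ hlk
      rw [if_neg (fun h => hlk (Subtype.ext h.symm)), mul_zero]
    · simp
  refine Submodule.eq_of_le_of_finrank_le ?_ ?_
  · rw [Submodule.span_le]
    rintro _ ⟨l, rfl⟩
    exact Phi_mem_spaceV l.2 h1 hv1 t
  · rw [finrank_span_eq_card hli]
    simpa using hle

/-! ### Sums of determinants -/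

open Classical in
/-- The Cauchy–Binet formula, for functions on a finite set of integers. -/
theorem sum_strictMono_det_mul_det {n : ℕ} (S : Finset ℤ) (f h : Fin n → ℤ → ℂ) :
    ∑ b ∈ (Fintype.piFinset fun _ : Fin n => S).filter StrictMono,
      (Matrix.of fun i j => f i (b j)).det * (Matrix.of fun i j => h i (b j)).det =
    (Matrix.of fun i k => ∑ x ∈ S, f i x * h k x).det := by
  have e1 : (Matrix.of fun i k => ∑ x ∈ S, f i x * h k x).det =
      ∑ c ∈ Fintype.piFinset fun _ : Fin n => S,
        (∏ k, h k (c k)) * (Matrix.of fun i j => f i (c j)).det := by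
    rw [← Matrix.det_transpose]
    have : (Matrix.of fun i k => ∑ x ∈ S, f i x * h k x).transpose =
        fun k => ∑ x ∈ S, h k x • fun i => f i x := by
      ext k i
      simp only [Matrix.transpose_apply, Matrix.of_apply, Finset.sum_apply, Pi.smul_apply,
        smul_eq_mul]
      exact Finset.sum_congr rfl fun x _ => mul_comm _ _
    rw [this]
    have h2 := (Matrix.detRowAlternating (R := ℂ) (n := Fin n)).toMultilinearMap.map_sum_finset
      (fun k (x : ℤ) => h k x • fun i => f i x) (fun _ => S)
    refine h2.trans (Finset.sum_congr rfl fun c _ => ?_)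
    rw [MultilinearMap.map_smul_univ, smul_eq_mul, ← Matrix.det_transpose]
    rfl
  have e2 : ∑ c ∈ Fintype.piFinset fun _ : Fin n => S,
        (∏ k, h k (c k)) * (Matrix.of fun i j => f i (c j)).det =
      ∑ c ∈ (Fintype.piFinset fun _ : Fin n => S).filter Function.Injective,
        (∏ k, h k (c k)) * (Matrix.of fun i j => f i (c j)).det := by
    symm
    refine Finset.sum_subset (Finset.filter_subset _ _) fun c hc hni => ?_
    have hni : ¬ Function.Injective c := fun hi => hni (Finset.mem_filter.mpr ⟨hc, hi⟩)
    simp only [Function.Injective, not_forall] at hni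
    obtain ⟨i, j, hij, hne⟩ := hni
    rw [Matrix.det_zero_of_column_eq hne fun k => by simp [hij], mul_zero]
  have e3 : ∀ b : Fin n → ℤ, (Matrix.of fun i j => f i (b j)).det *
      (Matrix.of fun i j => h i (b j)).det = ∑ σ : Equiv.Perm (Fin n),
        (∏ k, h k (b (σ k))) * (Matrix.of fun i j => f i (b (σ j))).det := by
    intro b
    rw [← Matrix.det_transpose (Matrix.of fun i j => h i (b j)), Matrix.det_apply'
      (Matrix.of fun i j => h i (b j)).transpose, Finset.mul_sum]
    refine Finset.sum_congr rfl fun σ _ => ?_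
    have : (Matrix.of fun i j => f i (b (σ j))) = (Matrix.of fun i j => f i (b j)).submatrix id σ :=
      rfl
    rw [this, Matrix.det_permute']
    simp only [Matrix.transpose_apply, Matrix.of_apply]
    ring
  rw [e1, e2, Finset.sum_congr rfl fun b _ => e3 b, ← Finset.sum_product']
  refine Finset.sum_bij (fun p _ => p.1 ∘ p.2) ?_ ?_ ?_ ?_
  · rintro ⟨b, σ⟩ hp
    simp only [Finset.mem_product, Finset.mem_filter, Fintype.mem_piFinset, Finset.mem_univ,
      and_true] at hp ⊢
    exact ⟨fun i => hp.1 _, hp.2.injective.comp σ.injective⟩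
  · rintro ⟨b, σ⟩ hp ⟨b', σ'⟩ hp' heq
    simp only [Finset.mem_product, Finset.mem_filter, Finset.mem_univ, and_true] at hp hp' heq
    have hb : b = b' := by
      rw [← hp.2.range_inj hp'.2]
      rw [← σ.surjective.range_comp b, ← σ'.surjective.range_comp b', heq]
    subst hb
    have : σ = σ' := Equiv.ext fun i => hp.2.injective (congrFun heq i)
    rw [this]
  · intro c hc
    simp only [Finset.mem_filter, Fintype.mem_piFinset] at hc
    refine ⟨(c ∘ Tuple.sort c, (Tuple.sort c).symm), ?_, ?_⟩
    · simp only [Finset.mem_product, Finset.mem_filter, Fintype.mem_piFinset, Finset.mem_univ,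
        and_true]
      exact ⟨fun i => hc.1 _, (Tuple.monotone_sort c).strictMono_of_injective
        (hc.2.comp (Tuple.sort c).injective)⟩
    · ext i
      simp
  · rintro ⟨b, σ⟩ _
    rfl

lemma sum_Ioc_sub (H : ℤ → ℂ) {p q : ℤ} (h : p ≤ q) :
    ∑ a ∈ Finset.Ioc p q, (H a - H (a - 1)) = H q - H p := by
  induction q, h using Int.leInduction with
  | base => simp
  | succ q hq ih =>
    have : Finset.Ioc p (q + 1) = insert (q + 1) (Finset.Ioc p q) := by
      ext a; simp only [Finset.mem_Ioc, Finset.mem_insert]; omega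
    rw [this, Finset.sum_insert (by simp), ih, add_sub_cancel_right]
    ring

/-- Summing a determinant over interlacing sequences. The interlacing sequences form a product of
intervals, over which every column is summed separately; the result is a matrix of
differences of adjacent columns, which is bordered by a constant row. -/
lemma sum_interlacing_det {n : ℕ} (H : Fin (n + 1) → ℤ → ℂ) (c : ℂ)
    (hc : ∀ x, H (Fin.last n) x = c) {b : Fin (n + 1) → ℤ} (hb : Monotone b) :
    (∑ a ∈ Fintype.piFinset fun j : Fin n => Finset.Ioc (b j.castSucc) (b j.succ),
      (Matrix.of fun i j : Fin n => H i.castSucc (a j) - H i.castSucc (a j - 1)).det) * c =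
    (-1) ^ n * (Matrix.of fun i j => H i (b j)).det := by
  have e1 : ∑ a ∈ Fintype.piFinset fun j : Fin n => Finset.Ioc (b j.castSucc) (b j.succ),
      (Matrix.of fun i j : Fin n => H i.castSucc (a j) - H i.castSucc (a j - 1)).det =
      (Matrix.of fun i j : Fin n => H i.castSucc (b j.succ) - H i.castSucc (b j.castSucc)).det := by
    rw [← Matrix.det_transpose]
    have : (Matrix.of fun i j : Fin n => H i.castSucc (b j.succ) -
        H i.castSucc (b j.castSucc)).transpose =
        fun j => ∑ a ∈ Finset.Ioc (b j.castSucc) (b j.succ),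
          fun i : Fin n => H i.castSucc a - H i.castSucc (a - 1) := by
      ext j i
      simp only [Matrix.transpose_apply, Matrix.of_apply, Finset.sum_apply]
      rw [sum_Ioc_sub _ (hb (Fin.castSucc_lt_succ).le)]
    rw [this]
    have h2 := (Matrix.detRowAlternating (R := ℂ) (n := Fin n)).toMultilinearMap.map_sum_finset
      (fun (j : Fin n) (a : ℤ) => fun i : Fin n => H i.castSucc a - H i.castSucc (a - 1))
      (fun j => Finset.Ioc (b j.castSucc) (b j.succ))
    refine Eq.trans ?_ h2.symm
    refine Finset.sum_congr rfl fun a _ => ?_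
    rw [← Matrix.det_transpose]
    rfl
  set B : Matrix (Fin (n + 1)) (Fin (n + 1)) ℂ := Matrix.of fun i j =>
    Fin.cases (H i (b 0)) (fun j : Fin n => H i (b j.succ) - H i (b j.castSucc)) j with hB
  have e2 : (Matrix.of fun i j => H i (b j)).det = B.det := by
    refine Matrix.det_eq_of_forall_col_eq_smul_add_pred (fun _ => 1) (fun i => ?_) (fun i j => ?_)
    · simp [hB]
    · simp [hB]
  have e3 : B.det = (-1) ^ n * c *
      (Matrix.of fun i j : Fin n => H i.castSucc (b j.succ) - H i.castSucc (b j.castSucc)).det := by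
    rw [Matrix.det_succ_row B (Fin.last n), Finset.sum_eq_single 0]
    · congr 1
      · simp [hB, hc]
      · congr 1
        ext i j
        simp [hB]
    · intro j _ hj
      obtain ⟨j, rfl⟩ := Fin.exists_succ_eq.mpr hj
      simp [hB, hc]
    · simp
  rw [e1, e2, e3]
  have : ((-1 : ℂ) ^ n) * (-1) ^ n = 1 := by rw [← mul_pow]; simp
  linear_combination (-(Matrix.of fun i j : Fin n => H i.castSucc (b j.succ) -
    H i.castSucc (b j.castSucc)).det * c) * this

/-! ### Summation over Gelfand–Tsetlin patterns -/

lemma mem_indexSet {N : ℕ} {p : ℕ × ℕ} :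
    p ∈ indexSet N ↔ 1 ≤ p.2 ∧ p.2 ≤ p.1 ∧ p.1 ≤ N := by
  simp only [indexSet, Finset.mem_filter, Finset.mem_product, Finset.mem_Icc]
  omega

/-- The particle `(n, k)`. -/
def mkP {N : ℕ} (n k : ℕ) (h : 1 ≤ k ∧ k ≤ n ∧ n ≤ N) : Particle N := ⟨(n, k), mem_indexSet.mpr h⟩

@[simp] lemma mkP_level {N : ℕ} (n k : ℕ) (h : 1 ≤ k ∧ k ≤ n ∧ n ≤ N) : (mkP n k h).level = n := rfl

@[simp] lemma mkP_label {N : ℕ} (n k : ℕ) (h : 1 ≤ k ∧ k ≤ n ∧ n ≤ N) : (mkP n k h).label = k := rfl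

lemma Particle.bounds {N : ℕ} (p : Particle N) :
    1 ≤ p.label ∧ p.label ≤ p.level ∧ p.level ≤ N := mem_indexSet.mp p.2

lemma Particle.ext' {N : ℕ} {p q : Particle N} (h1 : p.level = q.level) (h2 : p.label = q.label) :
    p = q := Subtype.ext (Prod.ext h1 h2)

/-- The `j`-th particle (from `0`) of the top level. -/
def topP (N : ℕ) (j : Fin N) : Particle N := mkP N (j + 1) (by omega)

/-- A particle of the system with `N` levels, considered in the system with `N + 1` levels. -/
def castP {N : ℕ} (p : Particle N) : Particle (N + 1) :=
  mkP p.level p.label (by have := p.bounds; omega)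

@[simp] lemma castP_level {N : ℕ} (p : Particle N) : (castP p).level = p.level := rfl
@[simp] lemma castP_label {N : ℕ} (p : Particle N) : (castP p).label = p.label := rfl
@[simp] lemma topP_level {N : ℕ} (j : Fin N) : (topP N j).level = N := rfl
@[simp] lemma topP_label {N : ℕ} (j : Fin N) : (topP N j).label = j + 1 := rfl

/-- The positions of the particles of the top level. -/
def topRow {N : ℕ} (x : Config N) (j : Fin N) : ℤ := x (topP N j)

/-- The particles of the system with `N + 1` levels: those of the first `N` levels, and those of
the top level. -/
def particleEquiv (N : ℕ) : Particle N ⊕ Fin (N + 1) ≃ Particle (N + 1) :=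
  Equiv.ofBijective (Sum.elim castP (topP (N + 1))) <| by
    constructor
    · rintro (p | j) (q | j') h
      · have h1 := congrArg Particle.level h
        have h2 := congrArg Particle.label h
        exact congrArg Sum.inl (Particle.ext' h1 h2)
      · have h1 := congrArg Particle.level h
        have := p.bounds
        simp at h1
        omega
      · have h1 := congrArg Particle.level h
        have := q.bounds
        simp at h1
        omega
      · have h2 := congrArg Particle.label h
        simp only [Sum.elim_inr, topP_label] at h2
        exact congrArg Sum.inr (Fin.ext (by omega))
    · intro p
      have hp := p.bounds
      by_cases h : p.level ≤ N
      · exact ⟨Sum.inl (mkP p.level p.label (by omega)), Particle.ext' rfl rfl⟩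
      · refine ⟨Sum.inr ⟨p.label - 1, by omega⟩, Particle.ext' ?_ ?_⟩
        · simp only [Sum.elim_inr, topP_level]; omega
        · simp only [Sum.elim_inr, topP_label]; omega

/-- A configuration consists of its first `N` levels and its top level. -/
def configEquiv (N : ℕ) : Config (N + 1) ≃ Config N × (Fin (N + 1) → ℤ) :=
  ((particleEquiv N).symm.arrowCongr (Equiv.refl ℤ)).trans (Equiv.sumArrowEquivProdArrow _ _ _)

lemma configEquiv_apply {N : ℕ} (x : Config (N + 1)) :
    configEquiv N x = (x ∘ castP, topRow x) := rfl

/-- The configuration with the given first `N` levels and the given top level. -/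
def glue {N : ℕ} (x : Config N) (b : Fin (N + 1) → ℤ) : Config (N + 1) := (configEquiv N).symm (x, b)

@[simp] lemma glue_comp_castP {N : ℕ} (x : Config N) (b : Fin (N + 1) → ℤ) :
    glue x b ∘ castP = x :=
  congrArg Prod.fst ((configEquiv_apply (glue x b)).symm.trans
    ((configEquiv N).apply_symm_apply (x, b)))

@[simp] lemma glue_castP {N : ℕ} (x : Config N) (b : Fin (N + 1) → ℤ) (p : Particle N) :
    glue x b (castP p) = x p := congrFun (glue_comp_castP x b) p

@[simp] lemma topRow_glue {N : ℕ} (x : Config N) (b : Fin (N + 1) → ℤ) :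
    topRow (glue x b) = b :=
  congrArg Prod.snd ((configEquiv_apply (glue x b)).symm.trans
    ((configEquiv N).apply_symm_apply (x, b)))

@[simp] lemma glue_topP {N : ℕ} (x : Config N) (b : Fin (N + 1) → ℤ) (j : Fin (N + 1)) :
    glue x b (topP (N + 1) j) = b j := congrFun (topRow_glue x b) j

lemma glue_self {N : ℕ} (x : Config (N + 1)) : glue (x ∘ castP) (topRow x) = x :=
  (configEquiv N).symm_apply_apply x

lemma prod_particle_succ {N : ℕ} {M : Type*} [CommMonoid M] (f : Particle (N + 1) → M) :
    ∏ p, f p = (∏ p : Particle N, f (castP p)) * ∏ j : Fin (N + 1), f (topP (N + 1) j) := by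
  rw [← (particleEquiv N).prod_comp, Fintype.prod_sum_type]
  rfl

lemma forall_particle_succ {N : ℕ} {Q : Particle (N + 1) → Prop} :
    (∀ p, Q p) ↔ (∀ p : Particle N, Q (castP p)) ∧ ∀ j : Fin (N + 1), Q (topP (N + 1) j) := by
  constructor
  · exact fun h => ⟨fun p => h _, fun j => h _⟩
  · intro h p
    obtain ⟨(q | j), rfl⟩ := (particleEquiv N).surjective p
    exacts [h.1 q, h.2 j]

/-- The rows `a` and `b` interlace. -/
def Interlace {N : ℕ} (a : Fin N → ℤ) (b : Fin (N + 1) → ℤ) : Prop :=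
  ∀ j : Fin N, b j.castSucc < a j ∧ a j ≤ b j.succ

lemma glue_mem_pattern {N : ℕ} (x : Config N) (b : Fin (N + 1) → ℤ) :
    glue x b ∈ pattern (N + 1) ↔ x ∈ pattern N ∧ Interlace (topRow x) b := by
  constructor
  · intro h
    refine ⟨fun p q hpq => ?_, fun j => ?_⟩
    · have := h (castP p) (castP q) hpq
      simpa using this
    · constructor
      · have := (h (castP (topP N j)) (topP (N + 1) j.castSucc) rfl).1 rfl
        rwa [glue_castP, glue_topP] at this
      · have := (h (castP (topP N j)) (topP (N + 1) j.succ) rfl).2 rfl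
        rwa [glue_castP, glue_topP] at this
  · rintro ⟨h1, h2⟩
    unfold pattern
    rw [Set.mem_ofPred_eq, forall_particle_succ]
    refine ⟨fun p => forall_particle_succ.mpr ⟨fun q hpq => ?_, fun j hpj => ?_⟩,
      fun i => forall_particle_succ.mpr ⟨fun q hpq => ?_, fun j hpj => ?_⟩⟩
    · simpa using h1 p q hpq
    · have hp := p.bounds
      simp only [topP_level, castP_level, Nat.add_right_cancel_iff] at hpj
      obtain ⟨i, rfl⟩ : ∃ i : Fin N, p = topP N i :=
        ⟨⟨p.label - 1, by omega⟩, Particle.ext' (by simp; omega) (by simp; omega)⟩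
      simp only [topP_label, castP_label, glue_topP, glue_castP]
      constructor
      · intro hj
        have : j = i.castSucc := Fin.ext (by simpa using hj)
        rw [this]
        exact (h2 i).1
      · intro hj
        have : j = i.succ := Fin.ext (by simpa using hj)
        rw [this]
        exact (h2 i).2
    · have := q.bounds
      simp at hpq
      omega
    · simp at hpj

lemma Interlace.strictMono {N : ℕ} {a : Fin N → ℤ} {b : Fin (N + 1) → ℤ} (h : Interlace a b) :
    StrictMono b :=
  Fin.strictMono_iff_lt_succ.mpr fun j => (h j).1.trans_le (h j).2

lemma strictMono_of_mem_Ioc {N : ℕ} {a : Fin N → ℤ} {b : Fin (N + 1) → ℤ} (h : Interlace a b) :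
    StrictMono a := by
  intro i j hij
  calc a i ≤ b i.succ := (h i).2
    _ ≤ b j.castSucc := h.strictMono.monotone (Fin.succ_le_castSucc_iff.mpr hij)
    _ < a j := (h j).1

lemma topRow_strictMono {N : ℕ} {x : Config N} (hx : x ∈ pattern N) : StrictMono (topRow x) := by
  cases N with
  | zero => exact fun i => i.elim0
  | succ N =>
    rw [← glue_self x, glue_mem_pattern] at hx
    exact hx.2.strictMono

/-- The weight `∏ₙ v_n ^ (|x^n| - |x^{n-1}|)` of a pattern, where `|x^n|` is the sum of the
positions of the particles of level `n`; written as a product over the particles. -/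
def weight (v : ℕ → ℝ) {N : ℕ} (x : Config N) : ℂ :=
  ∏ p : Particle N, (v p.level : ℂ) ^ x p *
    if p.level < N then (v (p.level + 1) : ℂ) ^ (-x p) else 1

lemma Particle.level_eq_iff {N : ℕ} (p : Particle N) : ¬ p.level < N ↔ p.level = N := by
  have := p.bounds
  omega

lemma prod_ite_level {N : ℕ} (f : Particle N → ℂ) :
    (∏ p : Particle N, if p.level < N then 1 else f p) = ∏ j : Fin N, f (topP N j) := by
  cases N with
  | zero =>
    have : IsEmpty (Particle 0) := ⟨fun p => by have := p.bounds; omega⟩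
    simp
  | succ N =>
    rw [prod_particle_succ]
    have : ∀ p : Particle N, p.level < N + 1 := fun p => by have := p.bounds; omega
    simp [this]

lemma weight_glue (v : ℕ → ℝ) {N : ℕ} (x : Config N) (b : Fin (N + 1) → ℤ) :
    weight v (glue x b) = weight v x * (∏ j, (v (N + 1) : ℂ) ^ (-topRow x j)) *
      ∏ j, (v (N + 1) : ℂ) ^ b j := by
  rw [weight, prod_particle_succ, weight]
  refine congrArg₂ (· * ·) ?_ ?_
  · have := prod_ite_level (N := N) fun p => (v (N + 1) : ℂ) ^ (-x p)
    simp only [topRow]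
    rw [← this, ← Finset.prod_mul_distrib]
    refine Finset.prod_congr rfl fun p _ => ?_
    have hp : p.level < N + 1 := by have := p.bounds; omega
    simp only [castP_level, glue_castP, if_pos hp]
    by_cases h : p.level < N
    · simp [h]
    · have h' := p.level_eq_iff.mp h
      simp [h']
  · simp

open Classical in
/-- The patterns all of whose positions lie in the window `[lo, hi]`. -/
def windowPatterns (N : ℕ) (lo hi : ℤ) : Finset (Config N) :=
  (Fintype.piFinset fun _ => Finset.Icc lo hi).filter (· ∈ pattern N)

lemma mem_windowPatterns {N : ℕ} {lo hi : ℤ} {x : Config N} :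
    x ∈ windowPatterns N lo hi ↔ (∀ p, lo ≤ x p ∧ x p ≤ hi) ∧ x ∈ pattern N := by
  classical
  simp [windowPatterns, Fintype.mem_piFinset]

open Classical in
/-- The sum over the patterns with a given top row, of the weight multiplied by one factor
`G n y` for every particle at position `y` of a level `n` below the top. -/
def patternSum (v : ℕ → ℝ) (G : ℕ → ℤ → ℂ) (N : ℕ) (lo hi : ℤ) (b : Fin N → ℤ) : ℂ :=
  ∑ x ∈ (windowPatterns N lo hi).filter (fun x => topRow x = b),
    weight v x * ∏ p : Particle N, if p.level < N then G p.level (x p) else 1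

/-- Splitting off the top row: the row below it runs through the interlacing sequences. -/
lemma patternSum_succ (v : ℕ → ℝ) (G : ℕ → ℤ → ℂ) (N : ℕ) (lo hi : ℤ) {b : Fin (N + 1) → ℤ}
    (hw : ∀ j, lo ≤ b j ∧ b j ≤ hi) :
    patternSum v G (N + 1) lo hi b =
      (∑ a ∈ Fintype.piFinset fun j : Fin N => Finset.Ioc (b j.castSucc) (b j.succ),
        patternSum v G N lo hi a * ∏ j, ((v (N + 1) : ℂ) ^ (-a j) * G N (a j))) *
      ∏ j, (v (N + 1) : ℂ) ^ b j := by
  classical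
  have hI : ∀ a : Fin N → ℤ, a ∈ (Fintype.piFinset fun j : Fin N =>
      Finset.Ioc (b j.castSucc) (b j.succ)) ↔ Interlace a b := fun a => by
    simp [Fintype.mem_piFinset, Interlace]
  have e1 : patternSum v G (N + 1) lo hi b =
      ∑ x ∈ (windowPatterns N lo hi).filter (fun x => Interlace (topRow x) b),
        (weight v x * ∏ p : Particle N, if p.level < N then G p.level (x p) else 1) *
        (∏ j, ((v (N + 1) : ℂ) ^ (-topRow x j) * G N (topRow x j))) *
        ∏ j, (v (N + 1) : ℂ) ^ b j := by
    unfold patternSum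
    refine Finset.sum_nbij' (fun x => x ∘ castP) (fun x => glue x b) ?_ ?_ ?_ ?_ ?_
    · intro x hx
      simp only [Finset.mem_filter, mem_windowPatterns] at hx ⊢
      obtain ⟨⟨h1, h2⟩, h3⟩ := hx
      rw [← glue_self x, glue_mem_pattern, h3] at h2
      exact ⟨⟨fun p => h1 _, h2.1⟩, h2.2⟩
    · intro x hx
      simp only [Finset.mem_filter, mem_windowPatterns] at hx ⊢
      obtain ⟨⟨h1, h2⟩, h3⟩ := hx
      refine ⟨⟨forall_particle_succ.mpr ⟨fun p => ?_, fun j => ?_⟩,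
        (glue_mem_pattern x b).mpr ⟨h2, h3⟩⟩, topRow_glue x b⟩
      · simpa using h1 p
      · simpa using hw j
    · intro x hx
      simp only [Finset.mem_filter] at hx
      rw [← hx.2]
      exact glue_self x
    · intro x _
      exact glue_comp_castP x b
    · intro x hx
      simp only [Finset.mem_filter] at hx
      have hx2 := hx.2
      obtain ⟨y, rfl⟩ : ∃ y, x = glue y b := ⟨x ∘ castP, by rw [← hx2]; exact (glue_self x).symm⟩
      rw [weight_glue, prod_particle_succ, glue_comp_castP]
      have h1 : (∏ j : Fin (N + 1), if (topP (N + 1) j).level < N + 1 then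
          G (topP (N + 1) j).level (glue y b (topP (N + 1) j)) else 1) = 1 := by simp
      have h2 : (∏ p : Particle N, if (castP p).level < N + 1 then
          G (castP p).level (glue y b (castP p)) else 1) =
          (∏ p : Particle N, if p.level < N then G p.level (y p) else 1) *
            ∏ j, G N (topRow y j) := by
        have := prod_ite_level (N := N) fun p => G N (y p)
        simp only [topRow]
        rw [← this, ← Finset.prod_mul_distrib]
        refine Finset.prod_congr rfl fun p _ => ?_
        have hp : p.level < N + 1 := by have := p.bounds; omega
        simp only [castP_level, glue_castP, if_pos hp]
        by_cases h : p.level < N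
        · simp [h]
        · have h' := p.level_eq_iff.mp h
          simp [h']
      rw [h1, h2, Finset.prod_mul_distrib]
      ring
  rw [e1, ← Finset.sum_mul]
  refine congrArg (· * ∏ j, (v (N + 1) : ℂ) ^ b j) ?_
  rw [← Finset.sum_fiberwise_of_maps_to (t := Fintype.piFinset fun j : Fin N =>
    Finset.Ioc (b j.castSucc) (b j.succ)) (g := topRow)
    (fun x hx => (hI _).mpr (Finset.mem_filter.mp hx).2)]
  refine Finset.sum_congr rfl fun a ha => ?_
  rw [patternSum, Finset.sum_mul]
  have hset : ((windowPatterns N lo hi).filter (fun x => Interlace (topRow x) b)).filter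
      (fun x => topRow x = a) = (windowPatterns N lo hi).filter (fun x => topRow x = a) := by
    ext x
    simp only [Finset.mem_filter]
    constructor
    · rintro ⟨⟨h1, _⟩, h2⟩; exact ⟨h1, h2⟩
    · rintro ⟨h1, h2⟩; exact ⟨⟨h1, by rw [h2]; exact (hI a).mp ha⟩, h2⟩
  rw [hset]
  refine Finset.sum_congr rfl fun x hx => ?_
  rw [(Finset.mem_filter.mp hx).2]

/-- The constant by which a sum over patterns differs from a determinant. -/
def patternConst (c : ℕ → ℂ) (N : ℕ) : ℂ := ∏ n ∈ Finset.range N, ((-1) ^ n * (c (n + 1))⁻¹)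

/-- The sum over the patterns with a given top row is a determinant of functions `R N k` that
solve a first order difference equation in the level. -/
lemma patternSum_eq_det {v : ℕ → ℝ} {G : ℕ → ℤ → ℂ} {R : ℕ → ℕ → ℤ → ℂ} {c : ℕ → ℂ} {lo hi : ℤ}
    (N : ℕ) (hv : ∀ n ∈ Finset.Icc 1 N, v n ≠ 0) (hc : ∀ n ∈ Finset.Icc 1 N, c n ≠ 0)
    (hR : ∀ n < N, ∀ k ∈ Finset.Icc 1 n, ∀ x,
      R (n + 1) k x - v (n + 1) * R (n + 1) k (x - 1) = R n k x * G n x)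
    (hRd : ∀ n ∈ Finset.Icc 1 N, ∀ x, R n n x = (v n : ℂ) ^ x * c n)
    {b : Fin N → ℤ} (hb : StrictMono b) (hw : ∀ j, lo ≤ b j ∧ b j ≤ hi) :
    patternSum v G N lo hi b =
      patternConst c N * (Matrix.of fun i j : Fin N => R N (i + 1) (b j)).det := by
  classical
  induction N with
  | zero =>
    have : IsEmpty (Particle 0) := ⟨fun p => by have := p.bounds; omega⟩
    have hall : ∀ x : Config 0, x ∈ (windowPatterns 0 lo hi).filter (fun x => topRow x = b) := by
      intro x
      simp only [Finset.mem_filter, mem_windowPatterns]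
      exact ⟨⟨fun p => isEmptyElim p, fun p => isEmptyElim p⟩, Subsingleton.elim _ _⟩
    rw [patternSum, show (windowPatterns 0 lo hi).filter (fun x => topRow x = b) =
      {isEmptyElim} from Finset.eq_singleton_iff_unique_mem.mpr
        ⟨hall _, fun x _ => Subsingleton.elim _ _⟩]
    simp [weight, patternConst]
  | succ N ih =>
    have hv0 : (v (N + 1) : ℂ) ≠ 0 := by exact_mod_cast hv (N + 1) (by simp)
    have hc0 := hc (N + 1) (by simp)
    have sub : ∀ n ∈ Finset.Icc 1 N, n ∈ Finset.Icc 1 (N + 1) := fun n hn =>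
      Finset.Icc_subset_Icc_right (Nat.le_succ N) hn
    rw [patternSum_succ v G N lo hi hw]
    set H : Fin (N + 1) → ℤ → ℂ := fun i a => R (N + 1) (i + 1) a * (v (N + 1) : ℂ) ^ (-a) with hH
    have hlast : ∀ x, H (Fin.last N) x = c (N + 1) := fun x => by
      simp only [hH, Fin.val_last]
      rw [hRd (N + 1) (by simp), zpow_neg]
      field_simp
    have e1 : ∀ a ∈ Fintype.piFinset fun j : Fin N => Finset.Ioc (b j.castSucc) (b j.succ),
        patternSum v G N lo hi a * ∏ j, ((v (N + 1) : ℂ) ^ (-a j) * G N (a j)) =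
        patternConst c N *
          (Matrix.of fun i j : Fin N => H i.castSucc (a j) - H i.castSucc (a j - 1)).det := by
      intro a ha
      have hI : Interlace a b := fun j => by
        have := Fintype.mem_piFinset.mp ha j
        simpa using this
      rw [ih (fun n hn => hv n (sub n hn)) (fun n hn => hc n (sub n hn))
        (fun n hn => hR n (by omega)) (fun n hn => hRd n (sub n hn)) (strictMono_of_mem_Ioc hI)
        (fun j => ⟨(hw _).1.trans (hI j).1.le, (hI j).2.trans (hw _).2⟩), mul_assoc]
      refine congrArg (patternConst c N * ·) ?_
      rw [mul_comm, ← Matrix.det_mul_row]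
      refine congrArg Matrix.det (Matrix.ext fun i j => ?_)
      simp only [Matrix.of_apply, hH, Fin.val_castSucc]
      have := hR N (by omega) (i + 1) (by simp) (a j)
      rw [show -(a j - 1) = -a j + 1 by ring, zpow_add_one₀ hv0]
      linear_combination (-(v (N + 1) : ℂ) ^ (-a j)) * this
    rw [Finset.sum_congr rfl e1, ← Finset.mul_sum]
    have e2 := sum_interlacing_det H (c (N + 1)) hlast hb.monotone
    have e3 : (Matrix.of fun i j => H i (b j)).det * ∏ j, (v (N + 1) : ℂ) ^ b j =
        (Matrix.of fun i j : Fin (N + 1) => R (N + 1) (i + 1) (b j)).det := by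
      rw [mul_comm, ← Matrix.det_mul_row]
      refine congrArg Matrix.det (Matrix.ext fun i j => ?_)
      simp only [Matrix.of_apply, hH, zpow_neg]
      field_simp
    have e4 : patternConst c (N + 1) = patternConst c N * ((-1) ^ N * (c (N + 1))⁻¹) :=
      Finset.prod_range_succ _ _
    rw [e4, ← e3]
    rw [← eq_mul_inv_iff_mul_eq₀ hc0] at e2
    rw [e2]
    ring

/-- The sum over all patterns in a window, with an additional determinant in the top row. -/
lemma sum_windowPatterns {v : ℕ → ℝ} {G : ℕ → ℤ → ℂ} {R : ℕ → ℕ → ℤ → ℂ} {c : ℕ → ℂ} (lo hi : ℤ)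
    (N : ℕ) (hv : ∀ n ∈ Finset.Icc 1 N, v n ≠ 0) (hc : ∀ n ∈ Finset.Icc 1 N, c n ≠ 0)
    (hR : ∀ n < N, ∀ k ∈ Finset.Icc 1 n, ∀ x,
      R (n + 1) k x - v (n + 1) * R (n + 1) k (x - 1) = R n k x * G n x)
    (hRd : ∀ n ∈ Finset.Icc 1 N, ∀ x, R n n x = (v n : ℂ) ^ x * c n) (ψ : Fin N → ℤ → ℂ) :
    ∑ x ∈ windowPatterns N lo hi, weight v x * (∏ p : Particle N, G p.level (x p)) *
      (Matrix.of fun i j => ψ i (topRow x j)).det =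
    patternConst c N * (Matrix.of fun i k : Fin N =>
      ∑ y ∈ Finset.Icc lo hi, R N (i + 1) y * G N y * ψ k y).det := by
  classical
  rw [← sum_strictMono_det_mul_det (Finset.Icc lo hi) (fun i y => R N (i + 1) y * G N y) ψ,
    Finset.mul_sum, ← Finset.sum_fiberwise_of_maps_to (g := topRow)
      (t := (Fintype.piFinset fun _ : Fin N => Finset.Icc lo hi).filter StrictMono)]
  · refine Finset.sum_congr rfl fun b hb => ?_
    simp only [Finset.mem_filter, Fintype.mem_piFinset, Finset.mem_Icc] at hb
    have h1 := patternSum_eq_det (G := G) N hv hc hR hRd hb.2 hb.1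
    have h2 : (Matrix.of fun i j : Fin N => R N (i + 1) (b j) * G N (b j)).det =
        (∏ j, G N (b j)) * (Matrix.of fun i j : Fin N => R N (i + 1) (b j)).det := by
      rw [← Matrix.det_mul_row]
      refine congrArg Matrix.det (Matrix.ext fun i j => ?_)
      simp only [Matrix.of_apply]
      ring
    rw [h2, show ∀ p q r s : ℂ, p * (q * r * s) = p * r * (q * s) from fun p q r s => by ring, ← h1,
      patternSum, Finset.sum_mul]
    refine Finset.sum_congr rfl fun x hx => ?_
    obtain rfl := (Finset.mem_filter.mp hx).2
    have h3 : (∏ p : Particle N, G p.level (x p)) =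
        (∏ p : Particle N, if p.level < N then G p.level (x p) else 1) *
          ∏ j, G N (topRow x j) := by
      have := prod_ite_level (N := N) fun p => G N (x p)
      simp only [topRow]
      rw [← this, ← Finset.prod_mul_distrib]
      refine Finset.prod_congr rfl fun p _ => ?_
      by_cases h : p.level < N
      · simp [h]
      · have h' := p.level_eq_iff.mp h
        simp [h']
    rw [h3]
    ring
  · intro x hx
    rw [mem_windowPatterns] at hx
    simp only [Finset.mem_filter, Fintype.mem_piFinset, Finset.mem_Icc]
    exact ⟨fun j => hx.1 _, topRow_strictMono hx.2⟩

/-! ### The generating functional of the point process -/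

lemma sum_Icc_one {M : Type*} [AddCommMonoid M] (N : ℕ) (f : ℕ → M) :
    ∑ k ∈ Finset.Icc 1 N, f k = ∑ i : Fin N, f (i + 1) := by
  rw [← Finset.sum_range (fun i => f (i + 1)), Finset.range_eq_Ico, Finset.sum_Ico_add' f 0 N 1]
  rfl

section GeneratingFunctional

variable {N : ℕ} (v : ℕ → ℝ) (Γ₀ Γ₁ : CircleContour) (t : ℝ) {m : ℕ} (y : Fin m → ℤ × ℕ)
  (g : Fin m → ℂ)

/-- The factor `1 + ∑ₐ gₐ 1[(x, n) = yₐ]` contributed by a particle at `(x, n)`. -/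
def siteFactor (n : ℕ) (x : ℤ) : ℂ := 1 + ∑ a, if y a = (x, n) then g a else 0

/-- The matrix of the values of `phi` at the sites. -/
def phiMatrix : Matrix (Fin m) (Fin m) ℂ :=
  Matrix.of fun a b => phi v Γ₀ (y a).2 (y b).2 (y a).1 (y b).1

/-- The values of `Phi` at the sites. -/
def PhiRow (k : ℕ) : Fin m → ℂ := fun a =>
  if k ≤ (y a).2 then Phi v Γ₁ t (y a).2 k (y a).1 else 0

/-- The values at the sites of the functions `deformedPhi`. -/
def deformedRow (k : ℕ) : Fin m → ℂ :=
  Matrix.vecMul (PhiRow v Γ₁ t y k) (1 - Matrix.diagonal g * phiMatrix v Γ₀ y)⁻¹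

/-- The deformation of `Phi` that accounts for the factors `siteFactor` at the sites of lower
levels. -/
def deformedPhi (n k : ℕ) (x : ℤ) : ℂ :=
  Phi v Γ₁ t n k x +
    ∑ a, deformedRow v Γ₀ Γ₁ t y g k a * g a * phi v Γ₀ (y a).2 n (y a).1 x

/-- The matrix `1 - g φ` is unipotent, because `phi` vanishes unless the level increases. -/
lemma det_one_sub_phiMatrix : (1 - Matrix.diagonal g * phiMatrix v Γ₀ y).det = 1 := by
  have hz : ∀ a b, (y b).2 ≤ (y a).2 → phiMatrix v Γ₀ y a b = 0 := fun a b h => by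
    simp [phiMatrix, phi, not_lt.mpr h]
  have hB : Matrix.BlockTriangular (1 - Matrix.diagonal g * phiMatrix v Γ₀ y) fun a => (y a).2 := by
    intro a b hab
    have hne : a ≠ b := by rintro rfl; exact lt_irrefl _ hab
    rw [Matrix.sub_apply, Matrix.one_apply_ne hne, Matrix.diagonal_mul, hz a b hab.le]
    simp
  rw [hB.det]
  refine Finset.prod_eq_one fun k _ => ?_
  have : (1 - Matrix.diagonal g * phiMatrix v Γ₀ y).toSquareBlock (fun a => (y a).2) k = 1 := by
    ext a b
    rw [Matrix.toSquareBlock_def, Matrix.of_apply, Matrix.sub_apply, Matrix.diagonal_mul,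
      hz a b (by rw [a.2, b.2]), mul_zero, sub_zero, Matrix.one_apply, Matrix.one_apply]
    simp [Subtype.ext_iff]
  rw [this, Matrix.det_one]

/-- The Neumann recursion for the inverse of `1 - g φ`. -/
lemma deformedRow_eq (k : ℕ) (a : Fin m) : deformedRow v Γ₀ Γ₁ t y g k a = PhiRow v Γ₁ t y k a +
    ∑ b, deformedRow v Γ₀ Γ₁ t y g k b * g b * phi v Γ₀ (y b).2 (y a).2 (y b).1 (y a).1 := by
  have h : Matrix.vecMul (deformedRow v Γ₀ Γ₁ t y g k)
      (1 - Matrix.diagonal g * phiMatrix v Γ₀ y) = PhiRow v Γ₁ t y k := by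
    rw [deformedRow, Matrix.vecMul_vecMul, Matrix.nonsing_inv_mul _ (by
      rw [det_one_sub_phiMatrix]; exact isUnit_one), Matrix.vecMul_one]
  rw [Matrix.vecMul_sub, Matrix.vecMul_one] at h
  have h2 := congrFun h a
  rw [Pi.sub_apply, sub_eq_iff_eq_add] at h2
  rw [h2]
  congr 1
  simp only [Matrix.vecMul, dotProduct, Matrix.diagonal_mul, phiMatrix, Matrix.of_apply]
  exact Finset.sum_congr rfl fun b _ => by ring

/-- Sites of a level below `k` do not contribute to the deformation of the `k`-th function. -/
lemma deformedRow_eq_zero {k : ℕ} {a : Fin m} (h : (y a).2 < k) :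
    deformedRow v Γ₀ Γ₁ t y g k a = 0 := by
  induction hn : (y a).2 using Nat.strong_induction_on generalizing a with
  | _ n ih =>
    rw [deformedRow_eq, PhiRow, if_neg (by omega), zero_add]
    refine Finset.sum_eq_zero fun b _ => ?_
    by_cases hb : (y b).2 < (y a).2
    · rw [ih _ (hn ▸ hb) (hb.trans h) rfl]; simp
    · simp [phi, hb]

lemma deformedRow_eq_deformedPhi {k : ℕ} {a : Fin m} (h : k ≤ (y a).2) :
    deformedRow v Γ₀ Γ₁ t y g k a = deformedPhi v Γ₀ Γ₁ t y g (y a).2 k (y a).1 := by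
  rw [deformedRow_eq, deformedPhi, PhiRow, if_pos h]

/-- The factor `siteFactor` adds the sites of level `n` itself to those of lower levels. -/
lemma deformedPhi_mul_siteFactor {n k : ℕ} (hk : k ≤ n) (x : ℤ) :
    deformedPhi v Γ₀ Γ₁ t y g n k x * siteFactor y g n x = Phi v Γ₁ t n k x +
      ∑ a, deformedRow v Γ₀ Γ₁ t y g k a * g a * (phi v Γ₀ (y a).2 n (y a).1 x +
        if (y a).2 = n ∧ (y a).1 = x then 1 else 0) := by
  have h1 : deformedPhi v Γ₀ Γ₁ t y g n k x * ∑ a, (if y a = (x, n) then g a else 0) =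
      ∑ a, deformedRow v Γ₀ Γ₁ t y g k a * g a *
        if (y a).2 = n ∧ (y a).1 = x then 1 else 0 := by
    rw [Finset.mul_sum]
    refine Finset.sum_congr rfl fun a _ => ?_
    by_cases h : y a = (x, n)
    · rw [if_pos h, if_pos (by rw [h]; exact ⟨rfl, rfl⟩),
        deformedRow_eq_deformedPhi _ _ _ _ _ _ (by rw [h]; exact hk), h, mul_one]
    · rw [if_neg h, if_neg (fun h' => h (Prod.ext h'.2 h'.1)), mul_zero, mul_zero]
  rw [siteFactor, mul_add, mul_one, h1, deformedPhi, add_assoc, ← Finset.sum_add_distrib]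
  congr 1
  exact Finset.sum_congr rfl fun a _ => by ring

variable {v Γ₀ Γ₁}

/-- The difference equation of `Phi` in the level, in the presence of the factors `siteFactor`. -/
lemma deformedPhi_sub {n k : ℕ} (hk : k ∈ Finset.Icc 1 n) (h0 : Γ₀.Inside 0)
    (hv0 : ∀ j ∈ Finset.Icc 1 (n + 1), Γ₀.Inside (v j)) (h1 : Γ₁.Outside 0)
    (hv1 : ∀ j ∈ Finset.Icc 1 (n + 1), Γ₁.Inside (v j)) (x : ℤ) :
    deformedPhi v Γ₀ Γ₁ t y g (n + 1) k x -
      v (n + 1) * deformedPhi v Γ₀ Γ₁ t y g (n + 1) k (x - 1) =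
      deformedPhi v Γ₀ Γ₁ t y g n k x * siteFactor y g n x := by
  have hkn := (Finset.mem_Icc.mp hk).2
  have e1 := Phi_sub_Phi (l := k) (Finset.Icc_subset_Icc_right (Nat.le_succ n) hk) h1 hv1 t x
  rw [if_pos hkn] at e1
  have e2 : (∑ a, deformedRow v Γ₀ Γ₁ t y g k a * g a * phi v Γ₀ (y a).2 (n + 1) (y a).1 x) -
      v (n + 1) * ∑ a, deformedRow v Γ₀ Γ₁ t y g k a * g a *
        phi v Γ₀ (y a).2 (n + 1) (y a).1 (x - 1) =
      ∑ a, deformedRow v Γ₀ Γ₁ t y g k a * g a * (phi v Γ₀ (y a).2 n (y a).1 x +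
        if (y a).2 = n ∧ (y a).1 = x then 1 else 0) := by
    rw [Finset.mul_sum, ← Finset.sum_sub_distrib]
    refine Finset.sum_congr rfl fun a _ => ?_
    rw [← phi_sub_phi h0 hv0]
    ring
  rw [deformedPhi_mul_siteFactor _ _ _ _ _ _ hkn, ← e1, ← e2, deformedPhi, deformedPhi]
  ring

lemma deformedPhi_self {n : ℕ} (hn : 1 ≤ n) (hv0 : v n ≠ 0)
    (h1 : Γ₁.Outside 0) (hv1 : ∀ j ∈ Finset.Icc 1 n, Γ₁.Inside (v j)) (x : ℤ) :
    deformedPhi v Γ₀ Γ₁ t y g n n x = (v n : ℂ) ^ x * Phi v Γ₁ t n n 0 := by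
  rw [deformedPhi, Finset.sum_eq_zero, add_zero, Phi_self hn hv0 h1 hv1]
  intro a _
  by_cases ha : (y a).2 < n
  · rw [deformedRow_eq_zero _ _ _ _ _ _ ha]; simp
  · simp [phi, ha]

/-- Otherwise `Phi v Γ₁ t n n` would vanish identically, contrary to biorthogonality. -/
lemma Phi_self_ne_zero {n : ℕ} (hn : 1 ≤ n) (hv : v n ≠ 0) (h0 : Γ₀.Inside 0)
    (hv0 : ∀ j ∈ Finset.Icc 1 n, Γ₀.Inside (v j)) (h1 : Γ₁.Outside 0)
    (hv1 : ∀ j ∈ Finset.Icc 1 n, Γ₁.Inside (v j)) : Phi v Γ₁ t n n 0 ≠ 0 := by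
  intro h
  have hs := hasSum_Psi_mul_Phi h0 (k := n) (l := n) (by simpa using hn) (by simpa using hn)
    hv0 hv1 t
  have hz : (fun x : ℤ => Psi v Γ₀ t n n x * Phi v Γ₁ t n n x) = fun _ => 0 := by
    ext x
    rw [Phi_self hn hv h1 hv1, h, mul_zero, mul_zero]
  rw [hz, if_pos rfl] at hs
  exact zero_ne_one (hasSum_zero.unique hs)

/-- The matrix of the kernel at the sites. -/
def kernelMatrix (v : ℕ → ℝ) (Γ₀ Γ₁ : CircleContour) (t : ℝ) {m : ℕ} (y : Fin m → ℤ × ℕ) :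
    Matrix (Fin m) (Fin m) ℂ := Matrix.of fun i j => kernel v Γ₀ Γ₁ t (y i) (y j)

/-- Summation against `Psi` is the identity matrix plus a perturbation supported by the sites. -/
lemma hasSum_deformedPhi_mul_Psi (h0 : Γ₀.Inside 0)
    (hv0 : ∀ j ∈ Finset.Icc 1 N, Γ₀.Inside (v j))
    (hv1 : ∀ j ∈ Finset.Icc 1 N, Γ₁.Inside (v j)) (hy : ∀ a, (y a).2 ∈ Finset.Icc 1 N) {k l : ℕ}
    (hk : k ∈ Finset.Icc 1 N) (hl : l ∈ Finset.Icc 1 N) :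
    HasSum (fun x : ℤ => deformedPhi v Γ₀ Γ₁ t y g N k x * siteFactor y g N x * Psi v Γ₀ t N l x)
      ((if k = l then 1 else 0) +
        ∑ a, deformedRow v Γ₀ Γ₁ t y g k a * g a * Psi v Γ₀ t (y a).2 l (y a).1) := by
  have h2 : ∀ a, HasSum (fun x : ℤ => (phi v Γ₀ (y a).2 N (y a).1 x +
      if (y a).2 = N ∧ (y a).1 = x then 1 else 0) * Psi v Γ₀ t N l x)
      (Psi v Γ₀ t (y a).2 l (y a).1) := by
    intro a
    rcases (Finset.mem_Icc.mp (hy a)).2.lt_or_eq with h | h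
    · refine hasSum_of_eq (hasSum_phi_mul_Psi h0 hv0 h (Finset.mem_Icc.mp hl).2 t (y a).1)
        (fun x => ?_) rfl
      rw [if_neg (fun h' => h.ne h'.1), add_zero]
    · have := hasSum_single (f := fun x : ℤ => (phi v Γ₀ (y a).2 N (y a).1 x +
        if (y a).2 = N ∧ (y a).1 = x then 1 else 0) * Psi v Γ₀ t N l x) (y a).1 (fun x hx => by
          rw [if_neg (fun h' => hx h'.2.symm)]
          simp [phi, h])
      refine hasSum_of_eq this (fun x => rfl) ?_
      rw [if_pos ⟨h, rfl⟩, h]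
      simp [phi]
  have h1 := hasSum_Psi_mul_Phi h0 hl hk hv0 hv1 t
  have h3 := h1.add (hasSum_sum (s := Finset.univ) fun a _ =>
    (h2 a).mul_left (deformedRow v Γ₀ Γ₁ t y g k a * g a))
  refine hasSum_of_eq h3 (fun x => ?_) ?_
  · rw [deformedPhi_mul_siteFactor _ _ _ _ _ _ (Finset.mem_Icc.mp hk).2, add_mul, Finset.sum_mul,
      mul_comm (Phi _ _ _ _ _ _)]
    congr 1
    exact Finset.sum_congr rfl fun a _ => by ring
  · simp only [eq_comm (a := k)]

/-- The `N × N` determinant is turned into one over the sites by `det (1 + A B) = det (1 + B A)`;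
there the inverse of the unipotent matrix `1 - g φ` produces the summand `-φ` of the kernel. -/
lemma det_one_add_deformedRow (hy : ∀ a, (y a).2 ∈ Finset.Icc 1 N) :
    (Matrix.of fun i k : Fin N => (if (i : ℕ) + 1 = k + 1 then (1 : ℂ) else 0) +
      ∑ a, deformedRow v Γ₀ Γ₁ t y g (i + 1) a * g a * Psi v Γ₀ t (y a).2 (k + 1) (y a).1).det =
    (1 + Matrix.diagonal g * kernelMatrix v Γ₀ Γ₁ t y).det := by
  set A := 1 - Matrix.diagonal g * phiMatrix v Γ₀ y with hA
  have hAdet : A.det = 1 := det_one_sub_phiMatrix v Γ₀ y g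
  set Φm : Matrix (Fin N) (Fin m) ℂ := Matrix.of fun i a => PhiRow v Γ₁ t y (i + 1) a with hΦ
  set Ψm : Matrix (Fin m) (Fin N) ℂ := Matrix.of fun a k =>
    Psi v Γ₀ t (y a).2 (k + 1) (y a).1 with hΨ
  have e1 : (Matrix.of fun i k : Fin N => (if (i : ℕ) + 1 = k + 1 then (1 : ℂ) else 0) +
      ∑ a, deformedRow v Γ₀ Γ₁ t y g (i + 1) a * g a * Psi v Γ₀ t (y a).2 (k + 1) (y a).1) =
      1 + (Φm * A⁻¹) * (Matrix.diagonal g * Ψm) := by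
    ext i k
    rw [Matrix.add_apply, Matrix.of_apply, Matrix.mul_apply, Matrix.one_apply]
    congr 1
    · simp [Fin.ext_iff]
    · refine Finset.sum_congr rfl fun a _ => ?_
      rw [Matrix.diagonal_mul, mul_assoc]
      rfl
  have e2 : kernelMatrix v Γ₀ Γ₁ t y = -phiMatrix v Γ₀ y + Ψm * Φm := by
    ext a b
    simp only [kernelMatrix, kernel, Matrix.of_apply, Matrix.add_apply, Matrix.neg_apply, phiMatrix,
      Matrix.mul_apply, hΨ, hΦ, PhiRow]
    congr 1
    obtain ⟨hb1, hbN⟩ := Finset.mem_Icc.mp (hy b)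
    have h1 : ∑ k ∈ Finset.Icc 1 (y b).2, Psi v Γ₀ t (y a).2 k (y a).1 *
        Phi v Γ₁ t (y b).2 k (y b).1 = ∑ k ∈ Finset.Icc 1 N, Psi v Γ₀ t (y a).2 k (y a).1 *
        (if k ≤ (y b).2 then Phi v Γ₁ t (y b).2 k (y b).1 else 0) := by
      rw [← Finset.sum_subset (Finset.Icc_subset_Icc_right hbN)]
      · exact Finset.sum_congr rfl fun k hk => by rw [if_pos (Finset.mem_Icc.mp hk).2]
      · intro k hk hk'
        rw [if_neg, mul_zero]
        intro h
        exact hk' (Finset.mem_Icc.mpr ⟨(Finset.mem_Icc.mp hk).1, h⟩)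
    rw [h1, sum_Icc_one]
  have e3 : (1 + Matrix.diagonal g * Ψm * (Φm * A⁻¹)).det =
      (1 + Matrix.diagonal g * kernelMatrix v Γ₀ Γ₁ t y).det := by
    have hu : IsUnit A.det := by rw [hAdet]; exact isUnit_one
    have : 1 + Matrix.diagonal g * Ψm * (Φm * A⁻¹) =
        (1 + Matrix.diagonal g * kernelMatrix v Γ₀ Γ₁ t y) * A⁻¹ := by
      have h : (1 + Matrix.diagonal g * kernelMatrix v Γ₀ Γ₁ t y) =
          A + Matrix.diagonal g * Ψm * Φm := by
        rw [e2, hA, mul_add, mul_neg, Matrix.mul_assoc]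
        abel
      rw [h, add_mul, Matrix.mul_nonsing_inv _ hu]
      simp only [Matrix.mul_assoc]
    rw [this, Matrix.det_mul, Matrix.det_nonsing_inv, hAdet]
    simp
  rw [e1, Matrix.det_one_add_mul_comm, e3]

/-- A series over the integers is the limit of its sums over symmetric windows. -/
lemma tendsto_sum_window {f : ℤ → ℂ} {a : ℂ} (h : HasSum f a) :
    Tendsto (fun L : ℕ => ∑ x ∈ Finset.Icc (-(L : ℤ)) L, f x) atTop (𝓝 a) := by
  have h1 : Tendsto (fun L : ℕ => Finset.Icc (-(L : ℤ)) L) atTop atTop := by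
    refine tendsto_atTop_finset_of_monotone (fun L L' hL => Finset.Icc_subset_Icc (by omega)
      (by omega)) fun x => ⟨x.natAbs, ?_⟩
    rw [Finset.mem_Icc]
    omega
  exact h.comp h1

/-- The weighted sum over the patterns in a growing window converges to a determinant of the
kernel. -/
theorem tendsto_sum_windowPatterns (hvpos : ∀ n ∈ Finset.Icc 1 N, v n ≠ 0) (h0 : Γ₀.Inside 0)
    (hv0 : ∀ j ∈ Finset.Icc 1 N, Γ₀.Inside (v j)) (h1 : Γ₁.Outside 0)
    (hv1 : ∀ j ∈ Finset.Icc 1 N, Γ₁.Inside (v j)) (hy : ∀ a, (y a).2 ∈ Finset.Icc 1 N) :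
    Tendsto (fun L : ℕ => ∑ x ∈ windowPatterns N (-(L : ℤ)) L, weight v x *
      (∏ p : Particle N, siteFactor y g p.level (x p)) *
      (Matrix.of fun i j : Fin N => Psi v Γ₀ t N (i + 1) (topRow x j)).det) atTop
      (𝓝 (patternConst (fun n => Phi v Γ₁ t n n 0) N *
        (1 + Matrix.diagonal g * kernelMatrix v Γ₀ Γ₁ t y).det)) := by
  have hsub : ∀ n ≤ N, ∀ j ∈ Finset.Icc 1 n, j ∈ Finset.Icc 1 N := fun n hn j hj =>
    Finset.Icc_subset_Icc_right hn hj
  have e : ∀ L : ℕ, ∑ x ∈ windowPatterns N (-(L : ℤ)) L, weight v x *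
      (∏ p : Particle N, siteFactor y g p.level (x p)) *
      (Matrix.of fun i j : Fin N => Psi v Γ₀ t N (i + 1) (topRow x j)).det =
      patternConst (fun n => Phi v Γ₁ t n n 0) N * (Matrix.of fun i k : Fin N =>
        ∑ x ∈ Finset.Icc (-(L : ℤ)) L, deformedPhi v Γ₀ Γ₁ t y g N (i + 1) x *
          siteFactor y g N x * Psi v Γ₀ t N (k + 1) x).det := fun L =>
    sum_windowPatterns (G := siteFactor y g) (R := deformedPhi v Γ₀ Γ₁ t y g)
      (c := fun n => Phi v Γ₁ t n n 0) (-(L : ℤ)) L N hvpos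
      (fun n hn => Phi_self_ne_zero t (Finset.mem_Icc.mp hn).1 (hvpos n hn) h0
        (fun j hj => hv0 j (hsub n (Finset.mem_Icc.mp hn).2 j hj)) h1
        (fun j hj => hv1 j (hsub n (Finset.mem_Icc.mp hn).2 j hj)))
      (fun n hn k hk x => deformedPhi_sub t y g hk h0 (fun j hj => hv0 j (hsub _ hn j hj)) h1
        (fun j hj => hv1 j (hsub _ hn j hj)) x)
      (fun n hn x => deformedPhi_self t y g (Finset.mem_Icc.mp hn).1 (hvpos n hn) h1
        (fun j hj => hv1 j (hsub n (Finset.mem_Icc.mp hn).2 j hj)) x)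
      (fun k x => Psi v Γ₀ t N (k + 1) x)
  simp only [e]
  refine Tendsto.const_mul _ ?_
  rw [← det_one_add_deformedRow t y g hy]
  refine (Continuous.matrix_det continuous_id).tendsto _ |>.comp ?_
  refine tendsto_pi_nhds.mpr fun i => tendsto_pi_nhds.mpr fun k => ?_
  exact tendsto_sum_window (hasSum_deformedPhi_mul_Psi t y g h0 hv0 hv1 hy (by simp) (by simp))

end GeneratingFunctional

/-! ### Correlation functions -/

/-- The positions within a level are strictly increasing. -/
lemma pattern_row_lt {N : ℕ} {x : Config N} (hx : x ∈ pattern N) {p q : Particle N}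
    (h : p.level = q.level) (hl : p.label < q.label) : x p < x q := by
  obtain ⟨d, hd⟩ : ∃ d, q.label = p.label + d + 1 := ⟨q.label - p.label - 1, by omega⟩
  induction d generalizing q with
  | zero =>
    have hp := p.bounds
    have hq := q.bounds
    exact ((hx (mkP (p.level - 1) p.label (by omega)) p (by simp; omega)).1 (by simp)).trans_le
      ((hx (mkP (p.level - 1) p.label (by omega)) q (by simp; omega)).2 (by simp; omega))
  | succ d ih =>
    have hp := p.bounds
    have hq := q.bounds
    have h1 := ih (q := mkP q.level (q.label - 1) (by omega)) (by simpa using h)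
      (by simp; omega) (by simp; omega)
    exact h1.trans (((hx (mkP (q.level - 1) (q.label - 1) (by omega)) (mkP q.level (q.label - 1)
      (by omega)) (by simp; omega)).1 (by simp)).trans_le
      ((hx (mkP (q.level - 1) (q.label - 1) (by omega)) q (by simp; omega)).2 (by simp; omega)))

lemma pattern_row_inj {N : ℕ} {x : Config N} (hx : x ∈ pattern N) {p q : Particle N}
    (h : p.level = q.level) (hpq : x p = x q) : p = q := by
  refine Particle.ext' h ?_
  rcases lt_trichotomy p.label q.label with hl | hl | hl
  · exact absurd hpq (pattern_row_lt hx h hl).ne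
  · exact hl
  · exact absurd hpq (pattern_row_lt hx h.symm hl).ne'

open Classical in
/-- `1` if no particle of the configuration sits at the site, and `0` otherwise. -/
def emptySite {N : ℕ} (x : Config N) (s : ℤ × ℕ) : ℂ :=
  if ∃ p : Particle N, x p = s.1 ∧ p.level = s.2 then 0 else 1

open Classical in
/-- In a pattern every site carries at most one particle, so the number of ways to choose
particles at distinct sites is either `0` or `1`. -/
lemma ncard_eq_prod {N : ℕ} {x : Config N} (hx : x ∈ pattern N) {m : ℕ} {y : Fin m → ℤ × ℕ}
    (hy : Function.Injective y) :
    ((Set.ncard {p : Fin m ↪ Particle N | ∀ i, x (p i) = (y i).1 ∧ (p i).level = (y i).2} : ℕ) : ℂ)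
      = ∏ i, (1 - emptySite x (y i)) := by
  by_cases h : ∀ i, ∃ p : Particle N, x p = (y i).1 ∧ p.level = (y i).2
  · have h1 : ∏ i, (1 - emptySite x (y i)) = 1 :=
      Finset.prod_eq_one fun i _ => by simp [emptySite, h i]
    rw [h1]
    choose p hp using h
    have hinj : Function.Injective p := fun i j hij => hy <| Prod.ext
      (by rw [← (hp i).1, ← (hp j).1, hij]) (by rw [← (hp i).2, ← (hp j).2, hij])
    have : {p : Fin m ↪ Particle N | ∀ i, x (p i) = (y i).1 ∧ (p i).level = (y i).2} =
        {⟨p, hinj⟩} := by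
      ext q
      simp only [Set.mem_ofPred_eq, Set.mem_singleton_iff]
      constructor
      · intro hq
        ext1 i
        exact pattern_row_inj hx ((hq i).2.trans (hp i).2.symm) ((hq i).1.trans (hp i).1.symm)
      · rintro rfl
        exact hp
    rw [this, Set.ncard_singleton, Nat.cast_one]
  · push Not at h
    obtain ⟨i, hi⟩ := h
    have h1 : ∏ i, (1 - emptySite x (y i)) = 0 := by
      refine Finset.prod_eq_zero (Finset.mem_univ i) ?_
      rw [emptySite, if_neg, sub_self]
      rintro ⟨p, hp⟩
      exact hi p hp.1 hp.2
    have : {p : Fin m ↪ Particle N | ∀ i, x (p i) = (y i).1 ∧ (p i).level = (y i).2} = ∅ := by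
      ext q
      simp only [Set.mem_ofPred_eq, Set.mem_empty_iff_false, iff_false]
      intro hq
      exact hi (q i) (hq i).1 (hq i).2
    rw [h1, this, Set.ncard_empty, Nat.cast_zero]

/-- With `gₐ = -1` for the sites of a set `s` and `gₐ = 0` for the others, the generating
functional counts the configurations that leave all the sites of `s` empty. -/
lemma prod_siteFactor {N : ℕ} (x : Config N) {m : ℕ} {y : Fin m → ℤ × ℕ}
    (hy : Function.Injective y) (s : Finset (Fin m)) :
    ∏ p : Particle N, siteFactor y (fun a => if a ∈ s then -1 else 0) p.level (x p) =
      ∏ i ∈ s, emptySite x (y i) := by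
  classical
  by_cases h : ∃ i ∈ s, ∃ p : Particle N, x p = (y i).1 ∧ p.level = (y i).2
  · obtain ⟨i, hi, p, hp⟩ := h
    rw [Finset.prod_eq_zero (Finset.mem_univ p), Finset.prod_eq_zero hi]
    · rw [emptySite, if_pos ⟨p, hp⟩]
    · rw [siteFactor, Finset.sum_eq_single i]
      · rw [if_pos (Prod.ext hp.1.symm hp.2.symm), if_pos hi]
        ring
      · intro j _ hj
        rw [if_neg]
        intro h'
        exact hj (hy (h'.trans (Prod.ext hp.1 hp.2)))
      · simp
  · push Not at h
    rw [Finset.prod_eq_one, Finset.prod_eq_one]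
    · intro i hi
      rw [emptySite, if_neg]
      rintro ⟨p, hp⟩
      exact h i hi p hp.1 hp.2
    · intro p _
      rw [siteFactor, Finset.sum_eq_zero, add_zero]
      intro i _
      split_ifs with h1 h2
      · exact absurd (by rw [h1]) (h i h2 p (by rw [h1]))
      · rfl
      · rfl

/-- Inclusion–exclusion for determinants. -/
lemma sum_det_one_sub {m : ℕ} (K : Matrix (Fin m) (Fin m) ℂ) :
    ∑ s : Finset (Fin m), (-1) ^ s.card *
      (1 + Matrix.diagonal (fun a => if a ∈ s then (-1 : ℂ) else 0) * K).det = K.det := by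
  have h := (Matrix.detRowAlternating (R := ℂ) (n := Fin m)).toMultilinearMap.map_add_univ
    (fun i => K i - (1 : Matrix (Fin m) (Fin m) ℂ) i) (fun i => (1 : Matrix (Fin m) (Fin m) ℂ) i)
  have e : (fun i => K i - (1 : Matrix (Fin m) (Fin m) ℂ) i) +
      (fun i => (1 : Matrix (Fin m) (Fin m) ℂ) i) = K := by
    ext i j; simp
  rw [e] at h
  refine Eq.trans ?_ h.symm
  refine Finset.sum_congr rfl fun s _ => ?_
  have e2 : (s.piecewise (fun i => K i - (1 : Matrix (Fin m) (Fin m) ℂ) i)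
      (fun i => (1 : Matrix (Fin m) (Fin m) ℂ) i) : Matrix (Fin m) (Fin m) ℂ) =
      Matrix.of fun i j => (if i ∈ s then (-1 : ℂ) else 1) *
        (1 + Matrix.diagonal (fun a => if a ∈ s then (-1 : ℂ) else 0) * K) i j := by
    ext i j
    by_cases hi : i ∈ s
    · rw [Finset.piecewise_eq_of_mem _ _ _ hi, Matrix.of_apply, if_pos hi, Matrix.add_apply,
        Matrix.diagonal_mul, if_pos hi, Pi.sub_apply]
      ring
    · simp [hi, Matrix.diagonal_mul]
  have e3 : (∏ i : Fin m, if i ∈ s then (-1 : ℂ) else 1) = (-1) ^ s.card := by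
    rw [Finset.prod_ite]
    simp
  change _ = Matrix.det _
  rw [e2, Matrix.det_mul_column, e3]

section Law

variable {N : ℕ} {v : ℕ → ℝ} {Γ₀ Γ₁ : CircleContour} {t : ℝ} {Ω : Type*} [MeasurableSpace Ω]
  {P : Measure Ω} [IsProbabilityMeasure P] {Y : Ω → Config N} {κ : ℂ}

/-- On the pattern, the law of `Y` is the product of `weight`, of a determinant in the top row, and
of a normalizing constant `κ`. -/
def HasPatternLaw (v : ℕ → ℝ) (Γ₀ : CircleContour) (t : ℝ) (P : Measure Ω) (Y : Ω → Config N)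
    (κ : ℂ) : Prop :=
  ∀ x ∈ pattern N, (P.real (Y ⁻¹' {x}) : ℂ) = κ * (weight v x *
    (Matrix.of fun i j : Fin N => Psi v Γ₀ t N (i + 1) (topRow x j)).det)

/-- Expectations of bounded functions are limits of sums over the patterns in growing windows. -/
lemma integral_eq_lim (hY : Measurable Y) (hpat : ∀ᵐ ω ∂P, Y ω ∈ pattern N) (F : Config N → ℂ)
    {B : ℝ} (hB : ∀ x, ‖F x‖ ≤ B) :
    Tendsto (fun L : ℕ => ∑ x ∈ windowPatterns N (-(L : ℤ)) L, (P.real (Y ⁻¹' {x}) : ℂ) * F x) atTop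
      (𝓝 (∫ ω, F (Y ω) ∂P)) := by
  classical
  have hFm : ∀ F : Config N → ℂ, Measurable fun ω => F (Y ω) := fun F =>
    (Measurable.of_discrete (f := F)).comp hY
  have e : ∀ L : ℕ, ∑ x ∈ windowPatterns N (-(L : ℤ)) L, (P.real (Y ⁻¹' {x}) : ℂ) * F x =
      ∫ ω, (if Y ω ∈ windowPatterns N (-(L : ℤ)) L then F (Y ω) else 0) ∂P := by
    intro L
    have h1 : ∀ ω, (if Y ω ∈ windowPatterns N (-(L : ℤ)) L then F (Y ω) else 0) =
        ∑ x ∈ windowPatterns N (-(L : ℤ)) L, (Y ⁻¹' {x}).indicator (fun _ => F x) ω := by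
      intro ω
      simp only [Set.indicator_apply, Set.mem_preimage, Set.mem_singleton_iff]
      rw [Finset.sum_ite_eq]
    have hm : ∀ x : Config N, MeasurableSet (Y ⁻¹' {x}) := fun x => hY (measurableSet_singleton x)
    simp only [h1]
    rw [integral_finsetSum]
    · refine Finset.sum_congr rfl fun x _ => ?_
      rw [integral_indicator_const _ (hm x)]
      simp
    · intro x _
      exact (integrable_const (F x)).indicator (hm x)
  simp only [e]
  refine tendsto_integral_of_dominated_convergence (fun _ => B) ?_ (integrable_const B) ?_ ?_
  · intro L
    exact (hFm fun x => if x ∈ windowPatterns N (-(L : ℤ)) L then F x else 0).aestronglyMeasurable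
  · intro L
    refine ae_of_all _ fun ω => ?_
    split_ifs
    · exact hB _
    · simpa using (norm_nonneg _).trans (hB (Y ω))
  · filter_upwards [hpat] with ω hω
    refine tendsto_const_nhds.congr' ?_
    filter_upwards [eventually_ge_atTop (∑ p, (Y ω p).natAbs)] with L hL
    rw [if_pos]
    rw [mem_windowPatterns]
    refine ⟨fun p => ?_, hω⟩
    have := Finset.single_le_sum (f := fun p => (Y ω p).natAbs) (fun _ _ => Nat.zero_le _)
      (Finset.mem_univ p)
    omega

/-- The generating functional of a process with a pattern law is a determinant of the kernel.
Taking all `gₐ = 0` shows that the normalizing constants cancel. -/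
lemma integral_prod_siteFactor (hvpos : ∀ n ∈ Finset.Icc 1 N, v n ≠ 0) (h0 : Γ₀.Inside 0)
    (hv0 : ∀ j ∈ Finset.Icc 1 N, Γ₀.Inside (v j)) (h1 : Γ₁.Outside 0)
    (hv1 : ∀ j ∈ Finset.Icc 1 N, Γ₁.Inside (v j)) (hY : Measurable Y)
    (hpat : ∀ᵐ ω ∂P, Y ω ∈ pattern N) (hlaw : HasPatternLaw v Γ₀ t P Y κ) {m : ℕ}
    {y : Fin m → ℤ × ℕ} (hy : ∀ a, (y a).2 ∈ Finset.Icc 1 N) (g : Fin m → ℂ) :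
    ∫ ω, ∏ p : Particle N, siteFactor y g p.level (Y ω p) ∂P =
      (1 + Matrix.diagonal g * kernelMatrix v Γ₀ Γ₁ t y).det := by
  have key : ∀ g : Fin m → ℂ, ∫ ω, ∏ p : Particle N, siteFactor y g p.level (Y ω p) ∂P =
      κ * (patternConst (fun n => Phi v Γ₁ t n n 0) N *
        (1 + Matrix.diagonal g * kernelMatrix v Γ₀ Γ₁ t y).det) := by
    intro g
    have hB : ∀ x : Config N, ‖∏ p : Particle N, siteFactor y g p.level (x p)‖ ≤
        ∏ _p : Particle N, (1 + ∑ a, ‖g a‖) := by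
      intro x
      rw [norm_prod]
      refine Finset.prod_le_prod (fun _ _ => norm_nonneg _) fun p _ => ?_
      refine (norm_add_le _ _).trans ?_
      rw [norm_one]
      gcongr
      refine (norm_sum_le _ _).trans (Finset.sum_le_sum fun a _ => ?_)
      split_ifs
      · exact le_rfl
      · simp
    have hl := integral_eq_lim hY hpat (fun x => ∏ p : Particle N, siteFactor y g p.level (x p)) hB
    refine tendsto_nhds_unique hl ?_
    have h2 := (tendsto_sum_windowPatterns t y g hvpos h0 hv0 h1 hv1 hy).const_mul κ
    refine h2.congr fun L => ?_
    rw [Finset.mul_sum]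
    refine Finset.sum_congr rfl fun x hx => ?_
    rw [hlaw x (mem_windowPatterns.mp hx).2]
    ring
  have hone := key 0
  have e1 : ∀ ω, ∏ p : Particle N, siteFactor y 0 p.level (Y ω p) = 1 := fun ω =>
    Finset.prod_eq_one fun p _ => by simp [siteFactor]
  simp only [e1, integral_const, probReal_univ, one_smul] at hone
  have e2 : (Matrix.diagonal (0 : Fin m → ℂ)) = 0 := Matrix.diagonal_zero
  rw [e2, zero_mul, add_zero, Matrix.det_one, mul_one] at hone
  rw [key, ← mul_assoc, ← hone, one_mul]

/-- A process with a pattern law is determinantal. -/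
theorem correlation_eq_det (hvpos : ∀ n ∈ Finset.Icc 1 N, v n ≠ 0) (h0 : Γ₀.Inside 0)
    (hv0 : ∀ j ∈ Finset.Icc 1 N, Γ₀.Inside (v j)) (h1 : Γ₁.Outside 0)
    (hv1 : ∀ j ∈ Finset.Icc 1 N, Γ₁.Inside (v j)) (hY : Measurable Y)
    (hpat : ∀ᵐ ω ∂P, Y ω ∈ pattern N) (hlaw : HasPatternLaw v Γ₀ t P Y κ) {m : ℕ}
    {y : Fin m → ℤ × ℕ} (hy : ∀ a, (y a).2 ∈ Finset.Icc 1 N) :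
    (correlation P Y y : ℂ) = (kernelMatrix v Γ₀ Γ₁ t y).det := by
  classical
  rw [correlation, ← integral_complex_ofReal]
  by_cases hinj : Function.Injective y
  · have e1 : ∀ᵐ ω ∂P, (((Set.ncard {p : Fin m ↪ Particle N |
        ∀ i, Y ω (p i) = (y i).1 ∧ (p i).level = (y i).2} : ℕ) : ℝ) : ℂ) =
        ∑ s : Finset (Fin m), (-1) ^ s.card * ∏ p : Particle N,
          siteFactor y (fun a => if a ∈ s then -1 else 0) p.level (Y ω p) := by
      filter_upwards [hpat] with ω hω
      rw [Complex.ofReal_natCast, ncard_eq_prod hω hinj]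
      simp only [sub_eq_add_neg]
      rw [Finset.prod_one_add, Finset.powerset_univ]
      refine Finset.sum_congr rfl fun s _ => ?_
      rw [prod_siteFactor _ hinj, Finset.prod_neg]
    rw [integral_congr_ae e1, integral_finsetSum]
    · rw [← sum_det_one_sub]
      refine Finset.sum_congr rfl fun s _ => ?_
      rw [integral_const_mul, integral_prod_siteFactor hvpos h0 hv0 h1 hv1 hY hpat hlaw hy]
    · intro s _
      refine Integrable.const_mul ?_ _
      have hm : Measurable fun ω => ∏ p : Particle N,
          siteFactor y (fun a => if a ∈ s then -1 else 0) p.level (Y ω p) :=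
        (Measurable.of_discrete (f := fun x : Config N => ∏ p : Particle N,
          siteFactor y (fun a => if a ∈ s then -1 else 0) p.level (x p))).comp hY
      refine Integrable.of_bound hm.aestronglyMeasurable 1 (ae_of_all _ fun ω => ?_)
      rw [prod_siteFactor _ hinj, norm_prod]
      refine Finset.prod_le_one (fun _ _ => norm_nonneg _) fun i _ => ?_
      rw [emptySite]
      split_ifs <;> simp
  · simp only [Function.Injective, not_forall] at hinj
    obtain ⟨i, j, hij, hne⟩ := hinj
    have hdet : (kernelMatrix v Γ₀ Γ₁ t y).det = 0 := by
      refine Matrix.det_zero_of_row_eq hne ?_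
      ext k
      simp [kernelMatrix, hij]
    rw [hdet]
    have e1 : ∀ᵐ ω ∂P, (((Set.ncard {p : Fin m ↪ Particle N |
        ∀ i, Y ω (p i) = (y i).1 ∧ (p i).level = (y i).2} : ℕ) : ℝ) : ℂ) = 0 := by
      filter_upwards [hpat] with ω hω
      have : {p : Fin m ↪ Particle N |
          ∀ i, Y ω (p i) = (y i).1 ∧ (p i).level = (y i).2} = ∅ := by
        ext q
        simp only [Set.mem_ofPred_eq, Set.mem_empty_iff_false, iff_false]
        intro hq
        refine hne (q.injective (pattern_row_inj hω ?_ ?_))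
        · rw [(hq i).2, (hq j).2, hij]
        · rw [(hq i).1, (hq j).1, hij]
      simp [this]
    rw [integral_congr_ae e1, integral_zero]

end Law

/-! ### Jumps inside the pattern -/

section Jumps

variable {N : ℕ} {x y : Config N}

/-- Positions are weakly increasing along the diagonals `level - label = const`. -/
lemma pattern_diag (hx : x ∈ pattern N) {p q : Particle N} (hl : p.level ≤ q.level)
    (hd : q.level + p.label = p.level + q.label) : x p ≤ x q := by
  obtain ⟨l, hl⟩ := Nat.exists_eq_add_of_le hl
  induction l generalizing q with
  | zero => exact (congrArg x (Particle.ext' (by omega) (by omega))).le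
  | succ l ih =>
    have hp := p.bounds
    have hq := q.bounds
    have h := @ih (mkP (q.level - 1) (q.label - 1) (by omega)) (by simp; omega) (by simp; omega)
      (by simp; omega)
    exact h.trans ((hx _ q (by simp; omega)).2 (by simp; omega))

/-- Inside the pattern a string is determined by its ends, since positions increase along
diagonals. -/
lemma inString_iff (hy : y ∈ pattern N) {p q : Particle N} :
    InString y p q ↔
      p.level ≤ q.level ∧ q.level + p.label = p.level + q.label ∧ y q = y p := by
  constructor
  · rintro ⟨l, h1, h2, h3⟩
    exact ⟨by omega, by omega, h3 l le_rfl q h1 h2⟩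
  · rintro ⟨h1, h2, h3⟩
    refine ⟨q.level - p.level, by omega, by omega, fun j hj r hr1 hr2 => ?_⟩
    have := pattern_diag hy (p := p) (q := r) (by omega) (by omega)
    have := pattern_diag hy (p := r) (q := q) (by omega) (by omega)
    omega

lemma jump_of_not_blocked {p : Particle N} (h : ¬ Blocked y p) (q : Particle N) :
    (InString y p q → jump p y q = y q + 1) ∧ (¬ InString y p q → jump p y q = y q) := by
  simp only [jump, if_neg h]
  exact ⟨fun h => if_pos h, fun h => if_neg h⟩

lemma inString_self (p : Particle N) : InString y p p :=
  ⟨0, rfl, rfl, fun j hj r h1 h2 => congrArg y (Particle.ext' (by omega) (by omega))⟩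

lemma jump_eq_self_iff {p : Particle N} : jump p x = x ↔ Blocked x p := by
  refine ⟨fun h => ?_, fun h => if_pos h⟩
  by_contra hb
  have := (jump_of_not_blocked hb p).1 (inString_self p)
  rw [h] at this
  omega

lemma jump_apply_eq_or (p q : Particle N) : jump p y q = y q ∨ jump p y q = y q + 1 := by
  by_cases h : Blocked y p
  · exact Or.inl (by rw [jump_eq_self_iff.mpr h])
  · by_cases hs : InString y p q
    · exact Or.inr ((jump_of_not_blocked h q).1 hs)
    · exact Or.inl ((jump_of_not_blocked h q).2 hs)

/-- Pushing keeps `x_k^n ≤ x_{k+1}^{n+1}`. The strict inequalities survive since the particle that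
restricts the first pushed particle restricts the others even less. -/
lemma jump_mem_pattern (hy : y ∈ pattern N) (p : Particle N) : jump p y ∈ pattern N := by
  by_cases hb : Blocked y p
  · rwa [jump_eq_self_iff.mpr hb]
  intro r q hrq
  have hr := jump_of_not_blocked hb r
  have hq := jump_of_not_blocked hb q
  have hyrq := hy r q hrq
  have bp := p.bounds
  have br := r.bounds
  constructor
  · intro hl
    have h1 := hyrq.1 hl
    by_cases hsq : InString y p q
    · have hq' := hq.1 hsq
      rw [inString_iff hy] at hsq
      -- `p` is not blocked, and `r` lies on the diagonal of the particle that could block `p`.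
      have h2 : y p < y (mkP (p.level - 1) p.label (by omega)) - 1 := by
        by_contra hcon
        exact hb ⟨mkP (p.level - 1) p.label (by omega), by simp; omega, rfl, hcon⟩
      have h3 := pattern_diag hy (p := mkP (p.level - 1) p.label (by omega)) (q := r)
        (by simp; omega) (by simp; omega)
      rcases jump_apply_eq_or (y := y) p r with h | h <;> omega
    · rw [hq.2 hsq]
      rcases jump_apply_eq_or (y := y) p r with h | h <;> omega
  · intro hl
    have h1 := hyrq.2 hl
    by_cases hsr : InString y p r
    · rw [hr.1 hsr]
      by_cases hsq : InString y p q
      · rw [hq.1 hsq]; omega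
      · rw [hq.2 hsq]
        rw [inString_iff hy] at hsr hsq
        by_contra hcon
        exact hsq ⟨by omega, by omega, by omega⟩
    · rw [hr.2 hsr]
      rcases jump_apply_eq_or (y := y) p q with h | h <;> omega

/-- `r` lies on the diagonal of `q`, in a level which is at most that of `q`, and at the position
of `q`. -/
def InBlock (x : Config N) (q r : Particle N) : Prop :=
  r.level ≤ q.level ∧ q.level + r.label = r.level + q.label ∧ x r = x q

open Classical in
/-- The configuration from which a jump of the block ending in `q` leads to `x`. -/
def lower (x : Config N) (q : Particle N) : Config N :=
  fun r => if InBlock x q r then x r - 1 else x r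

lemma inBlock_self (q : Particle N) : InBlock x q q := ⟨le_rfl, by omega, rfl⟩

lemma lower_of_inBlock {q r : Particle N} (h : InBlock x q r) : lower x q r = x r - 1 := if_pos h

lemma lower_of_not_inBlock {q r : Particle N} (h : ¬ InBlock x q r) : lower x q r = x r := if_neg h

/-- The lowered configuration is a pattern if and only if `q` has room to its left. The condition
concerns the left neighbour of `q` in its level, and the particle of the next level with the label
of `q`; both lie on the neighbouring diagonal, so that for `q` below the top level the second one is
decisive. -/
lemma lower_mem_pattern_iff (hx : x ∈ pattern N) (q : Particle N) :
    lower x q ∈ pattern N ↔ ∀ r : Particle N, r.label + q.level + 1 = r.level + q.label →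
      q.level ≤ r.level → r.level ≤ q.level + 1 → x r < x q - 1 := by
  constructor
  · intro h r h1 h2 h3
    rw [← lower_of_inBlock (inBlock_self (x := x) q), ← lower_of_not_inBlock (x := x) (q := q)
      (r := r) (by rintro ⟨_, h, _⟩; omega)]
    rcases h2.eq_or_lt with h4 | h4
    · exact pattern_row_lt h h4.symm (by omega)
    · exact (h q r (by omega)).1 (by omega)
  · intro h a b hab
    have hxab := hx a b hab
    have ba := a.bounds
    have bb := b.bounds
    have bq := q.bounds
    constructor
    · intro hl
      have h1 := hxab.1 hl
      by_cases ha : InBlock x q a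
      · have hb : ¬ InBlock x q b := by
          rintro ⟨_, h, _⟩
          have := ha.2.1
          omega
        rw [lower_of_inBlock ha, lower_of_not_inBlock hb]
        obtain ⟨ha1, ha2, ha3⟩ := ha
        rw [ha3]
        -- `b` and `r` lie on the same diagonal, with `r` further up.
        by_cases hN : q.level < N
        · have h2 := h (mkP (q.level + 1) q.label (by omega)) (by simp; omega) (by simp) (by simp)
          have h3 := pattern_diag hx (p := b) (q := mkP (q.level + 1) q.label (by omega))
            (by simp; omega) (by simp; omega)
          omega
        · have h2 := h (mkP q.level (q.label - 1) (by omega)) (by simp; omega) (by simp) (by simp)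
          have h3 := pattern_diag hx (p := b) (q := mkP q.level (q.label - 1) (by omega))
            (by simp; omega) (by simp; omega)
          omega
      · rw [lower_of_not_inBlock ha]
        by_cases hb : InBlock x q b
        · rw [lower_of_inBlock hb]; omega
        · rwa [lower_of_not_inBlock hb]
    · intro hl
      have h1 := hxab.2 hl
      by_cases hb : InBlock x q b
      · rw [lower_of_inBlock hb]
        by_cases ha : InBlock x q a
        · rw [lower_of_inBlock ha]; omega
        · rw [lower_of_not_inBlock ha]
          by_contra hcon
          obtain ⟨hb1, hb2, hb3⟩ := hb
          exact ha ⟨by omega, by omega, by omega⟩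
      · rw [lower_of_not_inBlock hb]
        by_cases ha : InBlock x q a
        · rw [lower_of_inBlock ha]; omega
        · rwa [lower_of_not_inBlock ha]

/-- Below the top level, `lower x q` is a pattern if and only if `q` does not block the particle `p`
of the next level with the same label. -/
lemma lower_mem_pattern_iff_not_blocked (hx : x ∈ pattern N) {p q : Particle N}
    (h1 : q.level + 1 = p.level) (h2 : q.label = p.label) :
    lower x q ∈ pattern N ↔ ¬ Blocked x p := by
  rw [lower_mem_pattern_iff hx]
  constructor
  · rintro h ⟨q', h3, h4, h5⟩
    obtain rfl : q' = q := Particle.ext' (by omega) (by omega)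
    exact h5 (h p (by omega) (by omega) (by omega))
  · intro h r h3 h4 h5
    have h6 := pattern_diag hx (p := r) (q := p) (by omega) (by omega)
    have h7 : x p < x q - 1 := by
      by_contra hcon
      exact h ⟨q, h1, h2, hcon⟩
    omega

lemma exists_bottom (x : Config N) (q : Particle N) :
    ∃ p, InBlock x q p ∧ ∀ r, InBlock x q r → p.level ≤ r.level := by
  classical
  obtain ⟨p, hp, h⟩ := Finset.exists_min_image (Finset.univ.filter (InBlock x q)) Particle.level
    ⟨q, by simp [inBlock_self]⟩
  simp only [Finset.mem_filter, Finset.mem_univ, true_and] at hp h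
  exact ⟨p, hp, h⟩

/-- The lowest particle of the block of `q`: the one whose clock makes the block jump. -/
def bottom (x : Config N) (q : Particle N) : Particle N := (exists_bottom x q).choose

lemma bottom_inBlock (x : Config N) (q : Particle N) : InBlock x q (bottom x q) :=
  (exists_bottom x q).choose_spec.1

lemma bottom_level_le {q r : Particle N} (h : InBlock x q r) : (bottom x q).level ≤ r.level :=
  (exists_bottom x q).choose_spec.2 r h

/-- Inside the pattern a block is a full interval of a diagonal. -/
lemma inBlock_iff (hx : x ∈ pattern N) {q r : Particle N} :
    InBlock x q r ↔ (bottom x q).level ≤ r.level ∧ r.level ≤ q.level ∧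
      q.level + r.label = r.level + q.label := by
  have hb := bottom_inBlock x q
  constructor
  · exact fun h => ⟨bottom_level_le h, h.1, h.2.1⟩
  · rintro ⟨h1, h2, h3⟩
    obtain ⟨hb1, hb2, hb3⟩ := hb
    have h4 := pattern_diag hx (p := bottom x q) (q := r) h1 (by omega)
    have h5 := pattern_diag hx (p := r) (q := q) h2 (by omega)
    exact ⟨h2, h3, by omega⟩

/-- The block is exactly the string that moves with its lowest particle. -/
lemma inString_lower_iff (hx : x ∈ pattern N) {q r : Particle N} (h : lower x q ∈ pattern N) :
    InString (lower x q) (bottom x q) r ↔ InBlock x q r := by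
  have hb := bottom_inBlock x q
  rw [inString_iff h, lower_of_inBlock hb]
  constructor
  · rintro ⟨h1, h2, h3⟩
    by_contra hr
    rw [lower_of_not_inBlock hr] at h3
    obtain ⟨hb1, hb2, hb3⟩ := hb
    have h4 := pattern_diag hx (p := bottom x q) (q := r) h1 (by omega)
    omega
  · intro hr
    rw [lower_of_inBlock hr]
    have h4 := (inBlock_iff hx).mp hr
    obtain ⟨hb1, hb2, hb3⟩ := hb
    obtain ⟨hr1, hr2, hr3⟩ := hr
    exact ⟨h4.1, by omega, by omega⟩

lemma jump_lower (hx : x ∈ pattern N) {q : Particle N} (h : lower x q ∈ pattern N) :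
    jump (bottom x q) (lower x q) = x := by
  have hb := bottom_inBlock x q
  have hnb : ¬ Blocked (lower x q) (bottom x q) := by
    rintro ⟨r, h1, h2, h3⟩
    have hr : ¬ InBlock x q r := by
      rintro ⟨_, h, _⟩
      have := hb.2.1
      omega
    rw [lower_of_inBlock hb, lower_of_not_inBlock hr] at h3
    have := (hx r _ h1.symm).1 h2.symm
    omega
  funext r
  have hj := jump_of_not_blocked hnb r
  by_cases hr : InBlock x q r
  · rw [hj.1 ((inString_lower_iff hx h).mpr hr), lower_of_inBlock hr]
    ring
  · rw [hj.2 (fun hs => hr ((inString_lower_iff hx h).mp hs)), lower_of_not_inBlock hr]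

/-- A block is the set of the particles that are lowered, and determines its last particle. -/
lemma lower_injective {q q' : Particle N} (h : lower x q = lower x q') : q = q' := by
  have key : ∀ r, InBlock x q r ↔ InBlock x q' r := by
    intro r
    have := congrFun h r
    by_cases h1 : InBlock x q r <;> by_cases h2 : InBlock x q' r <;>
      simp_all [lower_of_inBlock, lower_of_not_inBlock]
    omega
  have h1 := (key q).mp (inBlock_self q)
  have h2 := (key q').mpr (inBlock_self q')
  have h3 := h1.2.1
  have h4 := h1.1
  have h5 := h2.1
  exact Particle.ext' (by omega) (by omega)

/-- Every transition into `x` within the pattern is the jump of a block. -/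
lemma exists_lower_of_jump (hy : y ∈ pattern N) {p : Particle N} (hne : y ≠ x)
    (hj : jump p y = x) : ∃ q, bottom x q = p ∧ lower x q = y := by
  classical
  have hx : x ∈ pattern N := hj ▸ jump_mem_pattern hy p
  have hnb : ¬ Blocked y p := fun h => hne (hj ▸ (jump_eq_self_iff.mpr h).symm)
  obtain ⟨q, hq, h⟩ := Finset.exists_max_image (Finset.univ.filter (InString y p)) Particle.level
    ⟨p, by simp [inString_self]⟩
  simp only [Finset.mem_filter, Finset.mem_univ, true_and] at hq h
  have hxs : ∀ r, InString y p r → x r = y r + 1 := fun r hr => by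
    rw [← hj, (jump_of_not_blocked hnb r).1 hr]
  have hxn : ∀ r, ¬ InString y p r → x r = y r := fun r hr => by
    rw [← hj, (jump_of_not_blocked hnb r).2 hr]
  have hq' := (inString_iff hy).mp hq
  have key : ∀ r, InBlock x q r ↔ InString y p r := by
    intro r
    constructor
    · rintro ⟨h1, h2, h3⟩
      by_contra hr
      have h4 := hxn r hr
      have h5 := hxs q hq
      rw [inString_iff hy] at hr
      by_cases h6 : p.level ≤ r.level
      · have h7 := pattern_diag hy (p := p) (q := r) h6 (by omega)
        have h8 := pattern_diag hy (p := r) (q := q) h1 (by omega)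
        omega
      · have h7 := pattern_diag hy (p := r) (q := p) (by omega) (by omega)
        omega
    · intro hr
      have h4 := hxs r hr
      have h5 := hxs q hq
      have h6 := h r hr
      rw [inString_iff hy] at hr
      exact ⟨h6, by omega, by omega⟩
  refine ⟨q, ?_, ?_⟩
  · have h1 := (inString_iff hy).mp ((key _).mp (bottom_inBlock x q))
    have h2 := bottom_level_le ((key p).mpr (inString_self p))
    exact Particle.ext' (by omega) (by omega)
  · funext r
    by_cases hr : InBlock x q r
    · rw [lower_of_inBlock hr, hxs r ((key r).mp hr)]
      ring
    · rw [lower_of_not_inBlock hr, hxn r (fun hs => hr ((key r).mpr hs))]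

end Jumps

/-! ### The forward equation -/

section Forward

variable {N : ℕ} {v : ℕ → ℝ} {x y : Config N}

/-- The rates, extended by `1` above the top level. With this convention, lowering a particle of any
level `n` multiplies `weight` by `rate v N (n + 1) / rate v N n`. -/
def rate (v : ℕ → ℝ) (N n : ℕ) : ℂ := if n ≤ N then (v n : ℂ) else 1

lemma prod_inBlock (hx : x ∈ pattern N) (q : Particle N) (f : ℕ → ℂ) [DecidablePred (InBlock x q)] :
    ∏ r ∈ Finset.univ.filter (InBlock x q), f r.level =
      ∏ n ∈ Finset.Ico (bottom x q).level (q.level + 1), f n := by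
  have hb := bottom_inBlock x q
  have hbb := (bottom x q).bounds
  have hqq := q.bounds
  obtain ⟨hb1, hb2, hb3⟩ := hb
  refine Finset.prod_bij (fun r _ => r.level) ?_ ?_ ?_ ?_
  · intro r hr
    simp only [Finset.mem_filter, Finset.mem_univ, true_and, inBlock_iff hx] at hr
    simp only [Finset.mem_Ico]
    omega
  · intro r hr r' hr' hrr
    simp only [Finset.mem_filter, Finset.mem_univ, true_and, inBlock_iff hx] at hr hr'
    exact Particle.ext' hrr (by omega)
  · intro n hn
    simp only [Finset.mem_Ico] at hn
    refine ⟨mkP n (q.label + n - q.level) (by omega), ?_, rfl⟩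
    simp only [Finset.mem_filter, Finset.mem_univ, true_and, inBlock_iff hx, mkP_level, mkP_label]
    omega
  · intros; rfl

/-- The change of `weight` telescopes along the block, and the rate of the jump cancels the lower
end. -/
lemma weight_lower (hv : ∀ n ∈ Finset.Icc 1 N, v n ≠ 0) (hx : x ∈ pattern N) (q : Particle N) :
    (v (bottom x q).level : ℂ) * weight v (lower x q) = rate v N (q.level + 1) * weight v x := by
  classical
  have hv' : ∀ n, 1 ≤ n → rate v N n ≠ 0 := fun n hn => by
    unfold rate
    split_ifs with h
    · exact_mod_cast hv n (Finset.mem_Icc.mpr ⟨hn, h⟩)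
    · exact one_ne_zero
  have e1 : weight v (lower x q) = weight v x *
      ∏ r ∈ Finset.univ.filter (InBlock x q), rate v N (r.level + 1) / rate v N r.level := by
    rw [Finset.prod_filter, weight, weight, ← Finset.prod_mul_distrib]
    refine Finset.prod_congr rfl fun r _ => ?_
    by_cases hr : InBlock x q r
    · rw [if_pos hr, lower_of_inBlock hr]
      have hb := r.bounds
      have h1 := hv' r.level (by omega)
      have h2 := hv' (r.level + 1) (by omega)
      have e0 : rate v N r.level = v r.level := if_pos hb.2.2
      rw [e0] at h1 ⊢
      by_cases hN : r.level < N
      · have e1 : rate v N (r.level + 1) = v (r.level + 1) := if_pos hN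
        rw [e1] at h2 ⊢
        rw [if_pos hN, if_pos hN, show -(x r - 1) = -x r + 1 by ring, zpow_sub_one₀ h1,
          zpow_add_one₀ h2]
        field_simp
      · have e1 : rate v N (r.level + 1) = 1 := if_neg (by omega)
        rw [e1, if_neg hN, if_neg hN, zpow_sub_one₀ h1]
        field_simp
    · rw [if_neg hr, lower_of_not_inBlock hr, mul_one]
  have e2 : ∀ a b, 1 ≤ a → a ≤ b → rate v N a *
      ∏ n ∈ Finset.Ico a b, rate v N (n + 1) / rate v N n = rate v N b := by
    intro a b ha hab
    induction b, hab using Nat.le_induction with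
    | base => simp
    | succ b hb ih =>
      rw [Finset.prod_Ico_succ_top hb, ← mul_assoc, ih, mul_div_cancel₀ _ (hv' b (by omega))]
  have hbb := (bottom x q).bounds
  have hb := (bottom_inBlock x q).1
  rw [e1, prod_inBlock hx q fun n => rate v N (n + 1) / rate v N n,
    ← e2 (bottom x q).level (q.level + 1) (by omega) (by omega)]
  rw [show (v (bottom x q).level : ℂ) = rate v N (bottom x q).level from (if_pos hbb.2.2).symm]
  ring

open Classical in
/-- The configurations from which `x` may be reached in at most one jump. -/
def sources (x : Config N) : Finset (Config N) := Fintype.piFinset fun q => {x q, x q - 1}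

lemma mem_sources_of_jump {p : Particle N} (h : jump p y = x) : y ∈ sources x := by
  classical
  simp only [sources, Fintype.mem_piFinset, Finset.mem_insert, Finset.mem_singleton]
  intro q
  rcases jump_apply_eq_or (y := y) p q with h1 | h1 <;> rw [h] at h1 <;> omega

open Classical in
/-- A `weight` times a function of the top row, restricted to the pattern. -/
def patternFun (v : ℕ → ℝ) {N : ℕ} (D : (Fin N → ℤ) → ℂ) (x : Config N) : ℂ :=
  if x ∈ pattern N then weight v x * D (topRow x) else 0

lemma patternFun_of_mem (D : (Fin N → ℤ) → ℂ) (hx : x ∈ pattern N) :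
    patternFun v D x = weight v x * D (topRow x) := if_pos hx

lemma patternFun_of_not_mem (D : (Fin N → ℤ) → ℂ) (hx : x ∉ pattern N) :
    patternFun v D x = 0 := if_neg hx

lemma topRow_lower_of_lt {q : Particle N} (h : q.level < N) : topRow (lower x q) = topRow x := by
  funext j
  refine lower_of_not_inBlock ?_
  rintro ⟨h1, _, _⟩
  simp at h1
  omega

lemma topRow_lower_topP (j : Fin N) :
    topRow (lower x (topP N j)) = Function.update (topRow x) j (topRow x j - 1) := by
  funext i
  by_cases h : i = j
  · subst h
    rw [Function.update_self]
    exact lower_of_inBlock (inBlock_self _)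
  · rw [Function.update_of_ne h]
    refine lower_of_not_inBlock ?_
    rintro ⟨_, h2, _⟩
    simp only [topP_level, topP_label] at h2
    exact h (Fin.ext (by omega))

lemma sum_particle_label_eq (f : ℕ → ℂ) :
    ∑ p : Particle N with p.label = p.level, f p.level = ∑ n ∈ Finset.Icc 1 N, f n := by
  refine Finset.sum_bij (fun p _ => p.level) ?_ ?_ ?_ ?_
  · intro p _
    have := p.bounds
    simp only [Finset.mem_Icc]
    omega
  · intro p hp q hq h
    simp only [Finset.mem_filter, Finset.mem_univ, true_and] at hp hq
    exact Particle.ext' h (by omega)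
  · intro n hn
    rw [Finset.mem_Icc] at hn
    exact ⟨mkP n n (by omega), by simp, rfl⟩
  · intros; rfl

open Classical in
/-- The total rate of the particles which are not blocked. -/
lemma sum_not_blocked (hx : x ∈ pattern N) (f : ℕ → ℂ) :
    ∑ p : Particle N with ¬ Blocked x p, f p.level = (∑ n ∈ Finset.Icc 1 N, f n) +
      ∑ q : Particle N with lower x q ∈ pattern N ∧ q.level < N, f (q.level + 1) := by
  rw [← sum_particle_label_eq f, ← Finset.sum_filter_add_sum_filter_not _
    fun p : Particle N => p.label = p.level]
  congr 1
  · refine Finset.sum_congr ?_ fun _ _ => rfl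
    ext p
    simp only [Finset.mem_filter, Finset.mem_univ, true_and, and_iff_right_iff_imp]
    rintro h1 ⟨q, h2, h3, _⟩
    have := q.bounds
    omega
  · symm
    refine Finset.sum_bij (fun q hq => mkP (q.level + 1) q.label
      (by have h := (Finset.mem_filter.mp hq).2.2; have := q.bounds; omega)) ?_ ?_ ?_ ?_
    · intro q hq
      simp only [Finset.mem_filter, Finset.mem_univ, true_and] at hq ⊢
      have := q.bounds
      exact ⟨(lower_mem_pattern_iff_not_blocked hx (by simp) (by simp)).mp hq.1, by simp; omega⟩
    · intro q _ q' _ h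
      have h1 := congrArg Particle.level h
      have h2 := congrArg Particle.label h
      simp only [mkP_level, mkP_label] at h1 h2
      exact Particle.ext' (by omega) h2
    · intro p hp
      simp only [Finset.mem_filter, Finset.mem_univ, true_and] at hp
      have hb := p.bounds
      refine ⟨mkP (p.level - 1) p.label (by omega), ?_, Particle.ext' (by simp; omega) rfl⟩
      simp only [Finset.mem_filter, Finset.mem_univ, true_and]
      exact ⟨(lower_mem_pattern_iff_not_blocked hx (by simp; omega) (by simp)).mpr hp.1,
        by simp; omega⟩
    · intros; rfl

open Classical in
/-- The total inflow into `x` from other configurations. -/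
lemma sum_inflow (hv : ∀ n ∈ Finset.Icc 1 N, v n ≠ 0) (D : (Fin N → ℤ) → ℂ)
    (hx : x ∈ pattern N) :
    ∑ p : Particle N, (v p.level : ℂ) *
      ∑ y ∈ sources x with jump p y = x ∧ y ≠ x, patternFun v D y =
    ∑ q : Particle N with lower x q ∈ pattern N,
      rate v N (q.level + 1) * weight v x * D (topRow (lower x q)) := by
  have e1 : ∀ p : Particle N, (v p.level : ℂ) *
      ∑ y ∈ sources x with jump p y = x ∧ y ≠ x, patternFun v D y =
      ∑ y ∈ sources x with jump p y = x ∧ y ≠ x ∧ y ∈ pattern N,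
        (v p.level : ℂ) * patternFun v D y := by
    intro p
    rw [Finset.mul_sum]
    symm
    refine Finset.sum_subset (fun y hy => ?_) (fun y hy hy' => ?_)
    · simp only [Finset.mem_filter] at hy ⊢
      tauto
    · rw [patternFun_of_not_mem, mul_zero]
      intro h
      simp only [Finset.mem_filter] at hy hy'
      tauto
  rw [Finset.sum_congr rfl fun p _ => e1 p, Finset.sum_sigma']
  symm
  refine Finset.sum_bij (fun q _ => ⟨bottom x q, lower x q⟩) ?_ ?_ ?_ ?_
  · intro q hq
    simp only [Finset.mem_filter, Finset.mem_univ, true_and, Finset.mem_sigma] at hq ⊢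
    refine ⟨mem_sources_of_jump (jump_lower hx hq), jump_lower hx hq, fun h => ?_, hq⟩
    have := lower_of_inBlock (inBlock_self (x := x) q)
    rw [h] at this
    omega
  · intro q _ q' _ h
    exact lower_injective (eq_of_heq (Sigma.mk.inj h).2)
  · rintro ⟨p, y⟩ hy
    simp only [Finset.mem_filter, Finset.mem_univ, true_and, Finset.mem_sigma] at hy
    obtain ⟨q, h1, h2⟩ := exists_lower_of_jump hy.2.2.2 hy.2.2.1 hy.2.1
    exact ⟨q, by simp [h2, hy.2.2.2], by simp [h1, h2]⟩
  · intro q hq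
    simp only [Finset.mem_filter, Finset.mem_univ, true_and] at hq
    rw [patternFun_of_mem D hq, ← mul_assoc, weight_lower hv hx]

open Classical in
/-- The forward equation of the dynamics, for a `weight` times a function of the top row which
vanishes if two particles coincide: the right-hand side only involves independent jumps of the
particles of the top row. -/
lemma generator_patternFun (hv : ∀ n ∈ Finset.Icc 1 N, v n ≠ 0) (D : (Fin N → ℤ) → ℂ)
    (hD : ∀ b, ¬ Function.Injective b → D b = 0) (hx : x ∈ pattern N) :
    ∑ p : Particle N, (v p.level : ℂ) *
      ((∑ y ∈ sources x with jump p y = x, patternFun v D y) - patternFun v D x) =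
    weight v x * (∑ j, D (Function.update (topRow x) j (topRow x j - 1))) -
      (∑ n ∈ Finset.Icc 1 N, (v n : ℂ)) * patternFun v D x := by
  have e1 : ∀ p : Particle N, (v p.level : ℂ) *
      ((∑ y ∈ sources x with jump p y = x, patternFun v D y) - patternFun v D x) =
      (v p.level : ℂ) * (∑ y ∈ sources x with jump p y = x ∧ y ≠ x, patternFun v D y) -
      (if ¬ Blocked x p then (v p.level : ℂ) else 0) * patternFun v D x := by
    intro p
    have h1 : ∑ y ∈ sources x with jump p y = x, patternFun v D y =
        (∑ y ∈ sources x with jump p y = x ∧ y ≠ x, patternFun v D y) +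
          if Blocked x p then patternFun v D x else 0 := by
      rw [← Finset.filter_filter]
      by_cases hb : Blocked x p
      · have hxm : x ∈ (sources x).filter (fun y => jump p y = x) :=
          Finset.mem_filter.mpr ⟨mem_sources_of_jump (jump_eq_self_iff.mpr hb),
            jump_eq_self_iff.mpr hb⟩
        rw [if_pos hb, Finset.filter_ne', Finset.sum_erase_add _ _ hxm]
      · have hxm : x ∉ (sources x).filter (fun y => jump p y = x) := fun h =>
          hb (jump_eq_self_iff.mp (Finset.mem_filter.mp h).2)
        rw [if_neg hb, Finset.filter_ne', Finset.erase_eq_of_notMem hxm, add_zero]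
    rw [h1]
    by_cases hb : Blocked x p
    · simp [hb]
    · simp only [hb, if_false, not_false_eq_true, if_true]
      ring
  rw [Finset.sum_congr rfl fun p _ => e1 p, Finset.sum_sub_distrib, sum_inflow hv D hx,
    ← Finset.sum_mul, ← Finset.sum_filter, sum_not_blocked hx fun n => (v n : ℂ),
    ← Finset.sum_filter_add_sum_filter_not _ (fun q : Particle N => q.level < N),
    Finset.filter_filter, Finset.filter_filter]
  have e2 : ∑ q : Particle N with lower x q ∈ pattern N ∧ q.level < N,
      rate v N (q.level + 1) * weight v x * D (topRow (lower x q)) =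
      (∑ q : Particle N with lower x q ∈ pattern N ∧ q.level < N, (v (q.level + 1) : ℂ)) *
        patternFun v D x := by
    rw [Finset.sum_mul]
    refine Finset.sum_congr rfl fun q hq => ?_
    have hq' := (Finset.mem_filter.mp hq).2.2
    rw [topRow_lower_of_lt hq', patternFun_of_mem D hx, rate, if_pos (by omega)]
    ring
  have e3 : ∑ q : Particle N with lower x q ∈ pattern N ∧ ¬ q.level < N,
      rate v N (q.level + 1) * weight v x * D (topRow (lower x q)) =
      weight v x * ∑ j, D (Function.update (topRow x) j (topRow x j - 1)) := by
    have h1 : ∑ j : Fin N, D (Function.update (topRow x) j (topRow x j - 1)) =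
        ∑ j : Fin N with lower x (topP N j) ∈ pattern N, D (topRow (lower x (topP N j))) := by
      rw [Finset.sum_filter]
      refine Finset.sum_congr rfl fun j _ => ?_
      rw [← topRow_lower_topP]
      split_ifs with h
      · rfl
      · -- The only obstruction is a left neighbour at distance one, which then would be hit.
        refine hD _ fun hinj => h ?_
        rw [lower_mem_pattern_iff hx]
        intro r h1 h2 h3
        have hb := r.bounds
        have hrl : r.level = N := by simp at h2; omega
        have hr : r = topP N ⟨r.label - 1, by omega⟩ :=
          Particle.ext' (by simp; omega) (by simp; omega)
        simp only [topP_level, topP_label] at h1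
        have h4 := pattern_row_lt hx (p := r) (q := topP N j) (by simp; omega) (by simp; omega)
        by_contra hcon
        have h5 := @hinj j ⟨r.label - 1, by omega⟩ (by
          rw [topRow_lower_topP, Function.update_self, Function.update_of_ne
            (fun h => by have := congrArg Fin.val h; simp at this; omega)]
          change x (topP N j) - 1 = x (topP N ⟨r.label - 1, _⟩)
          rw [← hr]
          omega)
        have h6 := congrArg Fin.val h5
        simp at h6
        omega
    rw [h1, Finset.mul_sum]
    symm
    refine Finset.sum_bij (fun j _ => topP N j) ?_ ?_ ?_ ?_
    · intro j hj
      simpa using hj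
    · intro j _ j' _ h
      have := congrArg Particle.label h
      simp only [topP_label] at this
      exact Fin.ext (by omega)
    · intro q hq
      simp only [Finset.mem_filter, Finset.mem_univ, true_and] at hq
      have hb := q.bounds
      have : topP N ⟨q.label - 1, by omega⟩ = q := Particle.ext' (by simp; omega) (by simp; omega)
      exact ⟨_, by simpa [this] using hq.1, this⟩
    · intro j _
      rw [rate, if_neg (by simp), one_mul]
  rw [e2, e3]
  ring

end Forward

section TopDet

variable {N : ℕ} {v : ℕ → ℝ} {Γ : CircleContour} {x : Config N}

/-- The determinant of the functions `Psi` of the top level. -/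
def topDet (v : ℕ → ℝ) (Γ : CircleContour) {N : ℕ} (t : ℝ) (b : Fin N → ℤ) : ℂ :=
  (Matrix.of fun i j : Fin N => Psi v Γ t N (i + 1) (b j)).det

lemma topDet_of_not_injective (t : ℝ) {b : Fin N → ℤ} (hb : ¬ Function.Injective b) :
    topDet v Γ t b = 0 := by
  simp only [Function.Injective, not_forall] at hb
  obtain ⟨i, j, h1, h2⟩ := hb
  exact Matrix.det_zero_of_column_eq h2 fun k => by simp only [Matrix.of_apply, h1]

lemma inside_of_le (hv : ∀ j ∈ Finset.Icc 1 N, Γ.Inside (v j)) {k : ℕ} (hk : k ≤ N) :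
    ∀ j ∈ Finset.Icc 1 k, Γ.Inside (v j) :=
  fun j hj => hv j (Finset.Icc_subset_Icc_right hk hj)

/-- Differentiating a column shifts its argument, by `hasDerivAt_Psi`. -/
lemma hasDerivAt_topDet (h0 : Γ.Inside 0) (hv : ∀ j ∈ Finset.Icc 1 N, Γ.Inside (v j)) (t : ℝ)
    (b : Fin N → ℤ) :
    HasDerivAt (fun t => topDet v Γ t b) (∑ j, topDet v Γ t (Function.update b j (b j - 1))) t := by
  simp only [topDet, Matrix.det_apply', Matrix.of_apply]
  rw [Finset.sum_comm]
  refine HasDerivAt.fun_sum fun σ _ => ?_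
  have h := HasDerivAt.fun_finsetProd (u := Finset.univ) (x := t) fun (j : Fin N) _ =>
    hasDerivAt_Psi (v := v) h0 (n := N) (k := σ j + 1) (by omega) (inside_of_le hv (by omega)) t (b j)
  refine (h.const_mul _).congr_deriv ?_
  rw [Finset.mul_sum]
  refine Finset.sum_congr rfl fun j _ => ?_
  rw [← Finset.mul_prod_erase Finset.univ _ (Finset.mem_univ j), Function.update_self, smul_eq_mul,
    mul_comm (∏ _ ∈ _, _)]
  refine congrArg₂ (· * ·) rfl (congrArg₂ (· * ·) rfl ?_)
  refine Finset.prod_congr rfl fun i hi => ?_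
  rw [Function.update_of_ne (Finset.ne_of_mem_erase hi)]

lemma topDet_eq_zero_of_lt (h0 : Γ.Inside 0) (hv : ∀ j ∈ Finset.Icc 1 N, Γ.Inside (v j)) (t : ℝ)
    {b : Fin N → ℤ} {j : Fin N} (hj : b j < -N) : topDet v Γ t b = 0 :=
  Matrix.det_eq_zero_of_column_eq_zero j fun i => by
    rw [Matrix.of_apply, Psi_eq_zero_of_lt h0 (by omega) (inside_of_le hv (by omega)) t hj]

/-- At time `0` a column is zero if it is beyond the degrees of all the polynomials. -/
lemma topDet_zero_eq_zero_of_nonneg (h0 : Γ.Inside 0) (hv : ∀ j ∈ Finset.Icc 1 N, Γ.Inside (v j))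
    {b : Fin N → ℤ} {j : Fin N} (hj : 0 ≤ b j) : topDet v Γ 0 b = 0 :=
  Matrix.det_eq_zero_of_column_eq_zero j fun i => by
    have := Psi_zero h0 (n := N) (k := i + 1) (by omega) (inside_of_le hv (by omega)) (b j + N).toNat
    rw [show (((b j + N).toNat : ℕ) : ℤ) - N = b j by omega] at this
    rw [Matrix.of_apply, this]
    refine Polynomial.coeff_eq_zero_of_natDegree_lt ?_
    rw [factorPoly_natDegree]
    omega

/-- For the packed configuration the matrix has zeros below the antidiagonal, on which it has
entries `1`. -/
lemma topDet_zero_packed (h0 : Γ.Inside 0) (hv : ∀ j ∈ Finset.Icc 1 N, Γ.Inside (v j)) :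
    topDet v Γ 0 (topRow (packed N)) ≠ 0 := by
  have e : ∀ i j : Fin N, Psi v Γ 0 N (i + 1) (topRow (packed N) j) =
      (factorPoly v (i + 1) N).coeff j := by
    intro i j
    rw [← Psi_zero h0 (by omega) (inside_of_le hv (by omega))]
    refine congrArg _ ?_
    simp only [topRow, packed, topP_label, topP_level]
    push_cast
    ring
  -- Reversing the columns makes the matrix upper triangular.
  have h := Matrix.det_permute' (Fin.revPerm : Equiv.Perm (Fin N))
    (Matrix.of fun i j : Fin N => Psi v Γ 0 N (i + 1) (topRow (packed N) j))
  rw [Matrix.det_of_isUpperTriangular] at h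
  · intro h'
    unfold topDet at h'
    rw [h', mul_zero] at h
    refine absurd h (Finset.prod_ne_zero_iff.mpr fun i _ => ?_)
    rw [Matrix.submatrix_apply, Matrix.of_apply, e]
    have h1 := (factorPoly_monic v (i + 1) N).coeff_natDegree
    rw [factorPoly_natDegree] at h1
    have h2 : ((Fin.revPerm i : Fin N) : ℕ) = N - (i + 1) := by simp [Fin.val_rev]
    rw [h2]
    change (factorPoly v (i + 1) N).coeff (N - (i + 1)) ≠ 0
    rw [h1]
    exact one_ne_zero
  · intro i j hij
    rw [Matrix.submatrix_apply, Matrix.of_apply, e]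
    refine Polynomial.coeff_eq_zero_of_natDegree_lt ?_
    rw [factorPoly_natDegree]
    have hij' : j < i := hij
    have h2 : ((Fin.revPerm j : Fin N) : ℕ) = N - (j + 1) := by simp [Fin.val_rev]
    rw [h2]
    have : (id i : Fin N) = i := rfl
    rw [this]
    omega

lemma strictMono_add_le {b : Fin N → ℤ} (hb : StrictMono b) {i j : Fin N} (hij : i ≤ j) :
    b i + ((j : ℤ) - i) ≤ b j := by
  obtain ⟨d, hd⟩ := Nat.exists_eq_add_of_le (Fin.le_def.mp hij)
  induction d generalizing j with
  | zero =>
    obtain rfl : j = i := Fin.ext (by omega)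
    omega
  | succ d ih =>
    have h1 := @ih ⟨i + d, by omega⟩ (Fin.le_def.mpr (by simp)) rfl
    have h2 : b ⟨i + d, by omega⟩ < b j := hb (Fin.lt_def.mpr (by simp; omega))
    simp only at h1
    omega

lemma pattern_add_le (hx : x ∈ pattern N) {p q : Particle N} (hl : p.label = q.label)
    (h : p.level ≤ q.level) : x q + ((q.level : ℤ) - p.level) ≤ x p := by
  obtain ⟨d, hd⟩ := Nat.exists_eq_add_of_le h
  induction d generalizing p with
  | zero =>
    obtain rfl : q = p := Particle.ext' (by omega) (by omega)
    omega
  | succ d ih =>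
    have hp := p.bounds
    have hq := q.bounds
    have h1 := @ih (mkP (p.level + 1) p.label (by omega)) (by simpa) (by simp; omega) (by simp; omega)
    have h2 := (hx p (mkP (p.level + 1) p.label (by omega)) (by simp)).1 (by simp)
    simp only [mkP_level] at h1
    omega

/-- A pattern whose top row starts at `-N` or to the right of it lies above the packed one. -/
lemma packed_le (hx : x ∈ pattern N) (hb : ∀ j, -(N : ℤ) ≤ topRow x j) (p : Particle N) :
    packed N p ≤ x p := by
  have hp := p.bounds
  have h1 := pattern_add_le hx (p := p) (q := topP N ⟨p.label - 1, by omega⟩) (by simp; omega)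
    (by simp; omega)
  have h2 := strictMono_add_le (topRow_strictMono hx) (i := ⟨0, by omega⟩)
    (j := ⟨p.label - 1, by omega⟩) (Fin.le_def.mpr (by simp))
  have h3 := hb ⟨0, by omega⟩
  simp only [topRow, topP_level] at h1 h2 h3
  rw [packed]
  push_cast [hp.1] at h2
  omega

lemma eq_packed (hx : x ∈ pattern N) (hb : ∀ j, -(N : ℤ) ≤ topRow x j) (hb' : ∀ j, topRow x j < 0) :
    x = packed N := by
  funext p
  refine le_antisymm ?_ (packed_le hx hb p)
  have hp := p.bounds
  have h1 := pattern_diag hx (p := p) (q := topP N ⟨N - p.level + p.label - 1, by omega⟩)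
    (by simp; omega) (by simp; omega)
  have h2 := strictMono_add_le (topRow_strictMono hx) (i := ⟨N - p.level + p.label - 1, by omega⟩)
    (j := ⟨N - 1, by omega⟩) (Fin.le_def.mpr (by simp; omega))
  have h3 := hb' ⟨N - 1, by omega⟩
  simp only [topRow] at h2 h3
  rw [packed]
  omega

lemma packed_mem_pattern (N : ℕ) : packed N ∈ pattern N := by
  intro p q h
  simp only [packed]
  omega

lemma weight_ne_zero (hv : ∀ n ∈ Finset.Icc 1 N, v n ≠ 0) (x : Config N) : weight v x ≠ 0 := by
  have hv' : ∀ n, 1 ≤ n → n ≤ N → (v n : ℂ) ≠ 0 := fun n h1 h2 => by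
    exact_mod_cast hv n (Finset.mem_Icc.mpr ⟨h1, h2⟩)
  refine Finset.prod_ne_zero_iff.mpr fun p _ => ?_
  have hp := p.bounds
  refine mul_ne_zero (zpow_ne_zero _ (hv' _ (by omega) hp.2.2)) ?_
  split_ifs with h
  · exact zpow_ne_zero _ (hv' _ (by omega) h)
  · exact one_ne_zero

/-- Up to a factor that depends only on `t`, the probability that the system started from the
packed configuration is found in `x` at time `t`. -/
def density (v : ℕ → ℝ) (Γ : CircleContour) {N : ℕ} (t : ℝ) (x : Config N) : ℂ :=
  patternFun v (topDet v Γ t) x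

open Classical in
/-- The product of `density` with `exp (-(v_1 + ⋯ + v_N) t)` solves the forward equation. -/
lemma hasDerivAt_density (hv : ∀ n ∈ Finset.Icc 1 N, v n ≠ 0) (h0 : Γ.Inside 0)
    (hv0 : ∀ j ∈ Finset.Icc 1 N, Γ.Inside (v j)) (hx : x ∈ pattern N) (t : ℝ) :
    HasDerivAt (fun t => density v Γ t x)
      ((∑ p : Particle N, (v p.level : ℂ) *
        ((∑ y ∈ sources x with jump p y = x, density v Γ t y) - density v Γ t x)) +
        (∑ n ∈ Finset.Icc 1 N, (v n : ℂ)) * density v Γ t x) t := by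
  simp only [density]
  rw [generator_patternFun hv _ (fun b => topDet_of_not_injective t) hx, sub_add_cancel]
  simp only [patternFun_of_mem _ hx]
  exact (hasDerivAt_topDet h0 hv0 t (topRow x)).const_mul _

lemma density_of_not_mem (t : ℝ) (hx : x ∉ pattern N) : density v Γ t x = 0 :=
  patternFun_of_not_mem _ hx

lemma density_eq_zero_of_lt (h0 : Γ.Inside 0) (hv0 : ∀ j ∈ Finset.Icc 1 N, Γ.Inside (v j)) (t : ℝ)
    {p : Particle N} (hp : x p < packed N p) : density v Γ t x = 0 := by
  by_cases hx : x ∈ pattern N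
  · have : ∃ j, topRow x j < -N := by
      by_contra h
      push Not at h
      exact hp.not_ge (packed_le hx h p)
    obtain ⟨j, hj⟩ := this
    rw [density, patternFun_of_mem _ hx, topDet_eq_zero_of_lt h0 hv0 t hj, mul_zero]
  · exact density_of_not_mem t hx

lemma density_zero_eq_zero (h0 : Γ.Inside 0) (hv0 : ∀ j ∈ Finset.Icc 1 N, Γ.Inside (v j))
    (hx : x ≠ packed N) : density v Γ 0 x = 0 := by
  by_cases hxp : x ∈ pattern N
  · rw [density, patternFun_of_mem _ hxp]
    by_cases h1 : ∃ j, topRow x j < -N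
    · obtain ⟨j, hj⟩ := h1
      rw [topDet_eq_zero_of_lt h0 hv0 0 hj, mul_zero]
    · by_cases h2 : ∃ j, 0 ≤ topRow x j
      · obtain ⟨j, hj⟩ := h2
        rw [topDet_zero_eq_zero_of_nonneg h0 hv0 hj, mul_zero]
      · push Not at h1 h2
        exact absurd (eq_packed hxp h1 h2) hx
  · exact density_of_not_mem 0 hxp

lemma density_zero_packed_ne_zero (hv : ∀ n ∈ Finset.Icc 1 N, v n ≠ 0) (h0 : Γ.Inside 0)
    (hv0 : ∀ j ∈ Finset.Icc 1 N, Γ.Inside (v j)) : density v Γ 0 (packed N) ≠ 0 := by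
  rw [density, patternFun_of_mem _ (packed_mem_pattern N)]
  exact mul_ne_zero (weight_ne_zero hv _) (topDet_zero_packed h0 hv0)

end TopDet

/-! ### The clocks -/

section Clocks

variable {N : ℕ} {Ω : Type*} [MeasurableSpace Ω] {v : ℕ → ℝ} {C : Particle N → ℝ≥0 → Ω → ℕ}
  {X : ℝ≥0 → Ω → Config N} {P : Measure Ω}

/-- The numbers of rings of the clocks between the times `s` and `t`. -/
def rings (C : Particle N → ℝ≥0 → Ω → ℕ) (s t : ℝ≥0) (ω : Ω) : Particle N → ℕ :=
  fun p => C p t ω - C p s ω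

/-- The numbers of rings in the case of at most one ring: `none` stands for no ring, and `some p` for
a single ring of the clock of `p`. -/
def ringVector : Option (Particle N) → Particle N → ℕ
  | none => 0
  | some p => Pi.single p 1

lemma ringVector_injective : Function.Injective (ringVector (N := N)) := by
  rintro (_ | p) (_ | q) h
  · rfl
  · have := congrFun h q
    simp [ringVector] at this
  · have := congrFun h p
    simp [ringVector] at this
  · have := congrFun h p
    simp only [ringVector, Pi.single_eq_same, Pi.single_apply] at this
    by_cases hpq : p = q
    · rw [hpq]
    · simp [hpq] at this

/-- The effect of at most one ring. -/
def jumpOption : Option (Particle N) → Config N → Config N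
  | none => id
  | some p => jump p

open Classical in
/-- The configuration after the given numbers of rings, if there is at most one ring. -/
def ringStep (c : Particle N → ℕ) (x : Config N) : Config N :=
  if h : ∃ o, c = ringVector o then jumpOption h.choose x else x

lemma ringStep_ringVector (o : Option (Particle N)) (x : Config N) :
    ringStep (ringVector o) x = jumpOption o x := by
  have h : ∃ o', ringVector o = ringVector (N := N) o' := ⟨o, rfl⟩
  rw [ringStep, dif_pos h, ← ringVector_injective h.choose_spec]

lemma measurable_natSub {α : Type*} [MeasurableSpace α] {f g : α → ℕ} (hf : Measurable f)
    (hg : Measurable g) : Measurable fun a => f a - g a :=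
  (Measurable.of_discrete (f := fun z : ℕ × ℕ => z.1 - z.2)).comp (hf.prodMk hg)

lemma measurable_rings (hX : IsParticleSystem v C X P) (s t : ℝ≥0) : Measurable (rings C s t) := by
  refine measurable_pi_lambda _ fun p => ?_
  exact measurable_natSub ((hX.clocks p).measurable t) ((hX.clocks p).measurable s)

lemma iIndepFun_rings (hX : IsParticleSystem v C X P) (s t : ℝ≥0) :
    iIndepFun (fun p ω => rings C s t ω p) P := by
  exact hX.clocks_indep.comp (fun _ c => c t - c s) fun p =>
    measurable_natSub (measurable_pi_apply t) (measurable_pi_apply s)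

/-- All the increments of all the clocks along a sequence of times are independent. -/
lemma iIndepFun_rings_nat (hX : IsParticleSystem v C X P) {τ : ℕ → ℝ≥0} (hτ : Monotone τ) :
    iIndepFun (fun (i : Particle N × ℕ) ω => rings C (τ i.2) (τ (i.2 + 1)) ω i.1) P := by
  refine iIndepFun_uncurry' (X := fun p i ω => rings C (τ i) (τ (i + 1)) ω p) ?_ ?_ ?_
  · exact fun p i => (measurable_pi_apply p).comp (measurable_rings hX _ _)
  · refine hX.clocks_indep.comp (fun _ c i => c (τ (i + 1)) - c (τ i)) fun p => ?_
    refine measurable_pi_lambda _ fun i => ?_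
    exact measurable_natSub (measurable_pi_apply _) (measurable_pi_apply _)
  · exact fun p => (hX.clocks p).indep.nat hτ

/-- Along the path, at most one ring has the effect of `jumpOption`. -/
lemma ae_ringStep (hX : IsParticleSystem v C X P) :
    ∀ᵐ ω ∂P, ∀ s t : ℝ≥0, s ≤ t → ∀ o, rings C s t ω = ringVector o →
      X t ω = jumpOption o (X s ω) := by
  have hm : ∀ᵐ ω ∂P, ∀ p, Monotone (fun t => C p t ω) :=
    ae_all_iff.mpr fun p => (hX.clocks p).path.mono fun ω h => h.1
  filter_upwards [hX.evolution, hm] with ω h hm s t hst o ho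
  have hp : ∀ p, C p t ω = C p s ω + ringVector o p := fun p => by
    have h1 := congrFun ho p
    have h2 := hm p hst
    simp only [rings] at h1 h2
    omega
  cases o with
  | none => exact (h s t hst).1 fun p => by simpa [ringVector] using hp p
  | some p =>
    refine (h s t hst).2 p (by simpa [ringVector] using hp p) fun q hq => ?_
    simpa [ringVector, hq] using hp q

/-- The total rate of the clocks. -/
def totalRate (v : ℕ → ℝ) (N : ℕ) : ℝ := ∑ p : Particle N, v p.level

/-- The probability of the rings `ringVector o` in a time `h`, divided by that of no ring. -/
def optionRate (v : ℕ → ℝ) (h : ℝ) : Option (Particle N) → ℝ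
  | none => 1
  | some p => v p.level * h

lemma v_level_pos (hv : ∀ n ∈ Finset.Icc 1 N, 0 < v n) (p : Particle N) : 0 < v p.level := by
  have := p.bounds
  exact hv _ (Finset.mem_Icc.mpr (by omega))

lemma totalRate_nonneg (hv : ∀ n ∈ Finset.Icc 1 N, 0 < v n) : 0 ≤ totalRate v N :=
  Finset.sum_nonneg fun p _ => (v_level_pos hv p).le

lemma prob_rings_eq (hv : ∀ n ∈ Finset.Icc 1 N, 0 < v n) (hX : IsParticleSystem v C X P)
    {s t : ℝ≥0} (hst : s ≤ t) (p : Particle N) (k : ℕ) :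
    P.real {ω | rings C s t ω p = k} =
      Real.exp (-(v p.level * (t - s))) * (v p.level * (t - s)) ^ k / (k.factorial : ℝ) := by
  have h := ((hX.clocks p).law s t hst).measureReal_eq (p := (· = k)) (measurableSet_singleton k)
  have e : (((v p.level).toNNReal * (t - s) : ℝ≥0) : ℝ) = v p.level * (t - s) := by
    rw [NNReal.coe_mul, NNReal.coe_sub hst, Real.coe_toNNReal _ (v_level_pos hv p).le]
  change P.real {ω | C p t ω - C p s ω = k} = _
  rw [← e, ← poissonMeasure_real_singleton, ← Set.ofPred_eq_eq_singleton]
  exact h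

lemma prob_ringVector [IsProbabilityMeasure P] (hv : ∀ n ∈ Finset.Icc 1 N, 0 < v n)
    (hX : IsParticleSystem v C X P) {s t : ℝ≥0} (hst : s ≤ t) (o : Option (Particle N)) :
    P.real {ω | rings C s t ω = ringVector o} =
      optionRate v (t - s) o * Real.exp (-(totalRate v N * (t - s))) := by
  have h1 : {ω | rings C s t ω = ringVector o} =
      ⋂ p ∈ (Finset.univ : Finset (Particle N)), (fun ω => rings C s t ω p) ⁻¹' {ringVector o p} := by
    ext ω
    simp [funext_iff]
  have h2 := (iIndepFun_rings hX s t).measure_inter_preimage_eq_mul Finset.univ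
    (sets := fun p => {ringVector o p}) fun p _ => measurableSet_singleton _
  have h3 : ∀ p, P.real ((fun ω => rings C s t ω p) ⁻¹' {ringVector o p}) =
      Real.exp (-(v p.level * (t - s))) *
        ((v p.level * (t - s)) ^ ringVector o p / ((ringVector o p).factorial : ℝ)) := by
    intro p
    rw [← mul_div_assoc, ← prob_rings_eq hv hX hst]
    rfl
  rw [h1, measureReal_def, h2, ENNReal.toReal_prod]
  simp only [← measureReal_def, h3]
  rw [Finset.prod_mul_distrib, ← Real.exp_sum, Finset.sum_neg_distrib, ← Finset.sum_mul, mul_comm,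
    ← totalRate]
  congr 1
  cases o with
  | none => simp [ringVector, optionRate]
  | some p =>
    rw [Finset.prod_eq_single p]
    · simp [ringVector, optionRate]
    · intro q _ hq
      simp [ringVector, hq]
    · simp

lemma sum_prob_ringVector [IsProbabilityMeasure P] (hv : ∀ n ∈ Finset.Icc 1 N, 0 < v n)
    (hX : IsParticleSystem v C X P) {s t : ℝ≥0} (hst : s ≤ t) :
    ∑ o : Option (Particle N), P.real {ω | rings C s t ω = ringVector o} =
      (1 + totalRate v N * (t - s)) * Real.exp (-(totalRate v N * (t - s))) := by
  simp only [prob_ringVector hv hX hst]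
  rw [← Finset.sum_mul, Fintype.sum_option]
  simp only [optionRate]
  rw [← Finset.sum_mul, ← totalRate]

/-- It is unlikely that there are two rings in a short time. -/
lemma prob_not_ringVector_le [IsProbabilityMeasure P] (hv : ∀ n ∈ Finset.Icc 1 N, 0 < v n)
    (hX : IsParticleSystem v C X P) {s t : ℝ≥0} (hst : s ≤ t) :
    P.real {ω | ∀ o, rings C s t ω ≠ ringVector o} ≤ (totalRate v N * (t - s)) ^ 2 := by
  have h1 : {ω | ∀ o, rings C s t ω ≠ ringVector o} =
      (⋃ o ∈ (Finset.univ : Finset (Option (Particle N))), {ω | rings C s t ω = ringVector o})ᶜ := by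
    ext ω
    simp
  have hm : ∀ o : Option (Particle N), MeasurableSet {ω | rings C s t ω = ringVector o} :=
    fun o => measurable_rings hX s t (measurableSet_singleton (ringVector o))
  rw [h1, probReal_compl_eq_one_sub (Finset.measurableSet_biUnion _ fun o _ => hm o),
    measureReal_biUnion_finset, sum_prob_ringVector hv hX hst]
  · have h2 := Real.one_sub_le_exp_neg (totalRate v N * (t - s))
    have h3 : 0 ≤ totalRate v N * ((t : ℝ) - s) :=
      mul_nonneg (totalRate_nonneg hv) (sub_nonneg.mpr (by exact_mod_cast hst))
    nlinarith
  · intro o _ o' _ hne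
    refine Set.disjoint_left.mpr fun ω (h : _ = _) (h' : _ = _) => hne ?_
    exact ringVector_injective (h.symm.trans h')
  · exact fun o _ => hm o

/-- Two events which agree up to a third one. -/
lemma abs_measureReal_sub_le [IsFiniteMeasure P] {A B D : Set Ω}
    (h : ∀ᵐ ω ∂P, ω ∉ D → (ω ∈ A ↔ ω ∈ B)) : |P.real A - P.real B| ≤ P.real D := by
  have key : ∀ A B : Set Ω, (∀ᵐ ω ∂P, ω ∉ D → (ω ∈ A ↔ ω ∈ B)) → P.real A ≤ P.real B + P.real D := by
    intro A B h
    refine le_trans ?_ (measureReal_union_le B D)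
    refine ENNReal.toReal_mono (measure_ne_top _ _) (measure_mono_ae ?_)
    filter_upwards [h] with ω hω hA
    by_cases hD : ω ∈ D
    · exact Or.inr hD
    · exact Or.inl ((hω hD).mp hA)
  have h1 := key A B h
  have h2 := key B A (h.mono fun ω hω hD => (hω hD).symm)
  rw [abs_le]
  constructor <;> linarith

/-! ### Approximation by a Markov chain in discrete time -/

/-- The configurations reached from the packed one by the successive steps with the given rings. -/
def chain (c : ℕ → Particle N → ℕ) : ℕ → Config N
  | 0 => packed N
  | i + 1 => ringStep (c i) (chain c i)

lemma chain_congr {c c' : ℕ → Particle N → ℕ} (M : ℕ) (h : ∀ i < M, c i = c' i) :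
    chain c M = chain c' M := by
  induction M with
  | zero => rfl
  | succ M ih =>
    rw [chain, chain, ih fun i hi => h i (by omega), h M (by omega)]

lemma chain_invariant {Q : Config N → Prop} (h0 : Q (packed N)) (h : ∀ p x, Q x → Q (jump p x))
    (c : ℕ → Particle N → ℕ) (M : ℕ) : Q (chain c M) := by
  induction M with
  | zero => exact h0
  | succ M ih =>
    rw [chain, ringStep]
    split_ifs with hc
    · cases hc.choose with
      | none => exact ih
      | some p => exact h p _ ih
    · exact ih

/-- Equidistant times up to `s`, followed by the time `t`. -/
def gridTime (s t : ℝ≥0) (M i : ℕ) : ℝ≥0 := if i ≤ M then s * i / M else t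

lemma gridTime_mono {s t : ℝ≥0} (hst : s ≤ t) {M : ℕ} (hM : M ≠ 0) : Monotone (gridTime s t M) := by
  refine monotone_nat_of_le_succ fun i => ?_
  unfold gridTime
  have hM' : (0 : ℝ≥0) < M := by exact_mod_cast Nat.pos_of_ne_zero hM
  split_ifs with h1 h2
  · gcongr; omega
  · refine le_trans ?_ hst
    rw [div_le_iff₀ hM']
    gcongr
  · omega
  · rfl

lemma gridTime_self {s t : ℝ≥0} {M : ℕ} (hM : M ≠ 0) : gridTime s t M M = s := by
  have hM' : (M : ℝ≥0) ≠ 0 := by exact_mod_cast hM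
  rw [gridTime, if_pos le_rfl, mul_div_cancel_right₀ _ hM']

/-- The path agrees at time `s` with the chain driven by the rings over a grid of `M` steps, except on
an event of probability `O(1 / M)`. -/
lemma prob_chain_ne [IsProbabilityMeasure P] (hv : ∀ n ∈ Finset.Icc 1 N, 0 < v n)
    (hX : IsParticleSystem v C X P) {s t : ℝ≥0} (hst : s ≤ t) {M : ℕ} (hM : M ≠ 0) :
    ∃ D : Set Ω, P.real D ≤ (totalRate v N * s) ^ 2 / M ∧ ∀ᵐ ω ∂P, ω ∉ D →
      X s ω = chain (fun i => rings C (gridTime s t M i) (gridTime s t M (i + 1)) ω) M := by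
  have hM' : (M : ℝ) ≠ 0 := by exact_mod_cast hM
  refine ⟨⋃ i ∈ Finset.range M,
    {ω | ∀ o, rings C (gridTime s t M i) (gridTime s t M (i + 1)) ω ≠ ringVector o}, ?_, ?_⟩
  · refine (measureReal_biUnion_finset_le _ _).trans ?_
    have h1 : ∀ i ∈ Finset.range M, P.real
        {ω | ∀ o, rings C (gridTime s t M i) (gridTime s t M (i + 1)) ω ≠ ringVector o} ≤
        (totalRate v N * (s / M)) ^ 2 := by
      intro i hi
      rw [Finset.mem_range] at hi
      refine (prob_not_ringVector_le hv hX (gridTime_mono hst hM (Nat.le_succ i))).trans (le_of_eq ?_)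
      rw [gridTime, gridTime, if_pos (by omega), if_pos (by omega)]
      push_cast
      congr 2
      ring
    refine (Finset.sum_le_sum h1).trans (le_of_eq ?_)
    rw [Finset.sum_const, Finset.card_range, nsmul_eq_mul]
    field_simp
  · filter_upwards [ae_ringStep hX, hX.init] with ω h1 h2 hD
    simp only [Finset.mem_range, Set.mem_iUnion, not_exists] at hD
    have key : ∀ i ≤ M, X (gridTime s t M i) ω =
        chain (fun i => rings C (gridTime s t M i) (gridTime s t M (i + 1)) ω) i := by
      intro i
      induction i with
      | zero =>
        intro _
        rw [chain, ← h2]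
        simp [gridTime]
      | succ i ih =>
        intro hi
        have h3 := hD i (by omega)
        simp only [Set.mem_ofPred_eq, not_forall, not_not] at h3
        obtain ⟨o, ho⟩ := h3
        rw [chain, ← ih (by omega), ho, ringStep_ringVector]
        exact h1 _ _ (gridTime_mono hst hM (Nat.le_succ i)) o ho
    have := key M le_rfl
    rwa [gridTime_self hM] at this

/-- A property of configurations which is preserved by jumps holds at all times. -/
lemma ae_invariant [IsProbabilityMeasure P] (hv : ∀ n ∈ Finset.Icc 1 N, 0 < v n)
    (hX : IsParticleSystem v C X P) {Q : Config N → Prop} (h0 : Q (packed N))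
    (h : ∀ p x, Q x → Q (jump p x)) (s : ℝ≥0) : ∀ᵐ ω ∂P, Q (X s ω) := by
  have key : P.real {ω | ¬ Q (X s ω)} ≤ 0 := by
    refine ge_of_tendsto (tendsto_const_div_atTop_nhds_zero_nat ((totalRate v N * s) ^ 2)) ?_
    filter_upwards [eventually_ne_atTop 0] with M hM
    obtain ⟨D, hD, hc⟩ := prob_chain_ne hv hX (le_refl s) hM
    refine le_trans ?_ hD
    refine ENNReal.toReal_mono (measure_ne_top _ _) (measure_mono_ae ?_)
    filter_upwards [hc] with ω hω hQ
    by_contra hnD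
    refine hQ ?_
    rw [hω hnD]
    exact chain_invariant h0 h _ M
  rw [ae_iff]
  exact (measureReal_eq_zero_iff).mp (le_antisymm key measureReal_nonneg)

/-- The Markov property: the future rings are independent of the present configuration. -/
lemma prob_inter_rings [IsProbabilityMeasure P] (hv : ∀ n ∈ Finset.Icc 1 N, 0 < v n)
    (hX : IsParticleSystem v C X P) {s t : ℝ≥0} (hst : s ≤ t) (S : Set (Config N))
    (A : Set (Particle N → ℕ)) :
    P.real (X s ⁻¹' S ∩ rings C s t ⁻¹' A) = P.real (X s ⁻¹' S) * P.real (rings C s t ⁻¹' A) := by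
  have key : |P.real (X s ⁻¹' S ∩ rings C s t ⁻¹' A) -
      P.real (X s ⁻¹' S) * P.real (rings C s t ⁻¹' A)| ≤ 0 := by
    refine ge_of_tendsto (tendsto_const_div_atTop_nhds_zero_nat (2 * (totalRate v N * s) ^ 2)) ?_
    filter_upwards [eventually_ne_atTop 0] with M hM
    obtain ⟨D, hD, hc⟩ := prob_chain_ne hv hX hst hM
    set F : Ω → Config N := fun ω =>
      chain (fun i => rings C (gridTime s t M i) (gridTime s t M (i + 1)) ω) M with hF
    -- The chain uses only the increments with index below `M`, and `rings C s t` those of index `M`.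
    have hind : IndepFun F (rings C s t) P := by
      classical
      have h1 := (iIndepFun_rings_nat hX (gridTime_mono hst hM)).indepFun_finset
        (Finset.univ ×ˢ Finset.range M) (Finset.univ ×ˢ {M})
        (by
          rw [Finset.disjoint_product]
          exact Or.inr (by simp))
        (fun i => (measurable_pi_apply i.1).comp (measurable_rings hX _ _))
      have h2 := h1.comp
        (φ := fun c => chain (fun i p => if h : (p, i) ∈ Finset.univ ×ˢ Finset.range M then
          c ⟨(p, i), h⟩ else 0) M)
        (ψ := fun c p => c ⟨(p, M), by simp⟩) (Measurable.of_discrete) (Measurable.of_discrete)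
      refine (h2.congr (ae_of_all _ fun ω => ?_) (ae_of_all _ fun ω => ?_))
      · refine chain_congr M fun i hi => ?_
        funext p
        simp [hi]
      · funext p
        simp only [Function.comp]
        rw [gridTime_self hM, gridTime, if_neg (by omega)]
    have h1 : P.real (F ⁻¹' S ∩ rings C s t ⁻¹' A) =
        P.real (F ⁻¹' S) * P.real (rings C s t ⁻¹' A) := by
      simp only [measureReal_def]
      rw [hind.measure_inter_preimage_eq_mul S A (MeasurableSet.of_discrete)
        (MeasurableSet.of_discrete), ENNReal.toReal_mul]
    have h2 : |P.real (X s ⁻¹' S ∩ rings C s t ⁻¹' A) - P.real (F ⁻¹' S ∩ rings C s t ⁻¹' A)| ≤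
        P.real D := abs_measureReal_sub_le (hc.mono fun ω hω hnD => by
      simp only [Set.mem_inter_iff, Set.mem_preimage, hω hnD, hF])
    have h3 : |P.real (X s ⁻¹' S) - P.real (F ⁻¹' S)| ≤ P.real D :=
      abs_measureReal_sub_le (hc.mono fun ω hω hnD => by
        simp only [Set.mem_preimage, hω hnD, hF])
    have h4 : P.real (rings C s t ⁻¹' A) ≤ 1 := measureReal_le_one
    have h5 : 0 ≤ P.real (rings C s t ⁻¹' A) := measureReal_nonneg
    rw [h1] at h2
    rw [show 2 * (totalRate v N * s) ^ 2 / (M : ℝ) = 2 * ((totalRate v N * s) ^ 2 / M) by ring]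
    rw [abs_le] at h2 h3 ⊢
    constructor <;> nlinarith
  exact sub_eq_zero.mp (abs_eq_zero.mp (le_antisymm key (abs_nonneg _)))

end Clocks

/-! ### The law of the particle system -/

section ForwardLaw

variable {N : ℕ} {Ω : Type*} [MeasurableSpace Ω] {v : ℕ → ℝ} {C : Particle N → ℝ≥0 → Ω → ℕ}
  {X : ℝ≥0 → Ω → Config N} {P : Measure Ω} [IsProbabilityMeasure P]

open Classical in
lemma prob_jump_eq (hX : IsParticleSystem v C X P) (s : ℝ≥0) (p : Particle N) (x : Config N) :
    P.real (X s ⁻¹' (jump p ⁻¹' {x})) =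
      ∑ y ∈ sources x with jump p y = x, P.real (X s ⁻¹' {y}) := by
  have hm : ∀ S : Set (Config N), (P.map (X s)).real S = P.real (X s ⁻¹' S) := fun S =>
    map_measureReal_apply (hX.measurable s) MeasurableSet.of_discrete
  have : IsProbabilityMeasure (P.map (X s)) :=
    Measure.isProbabilityMeasure_map (hX.measurable s).aemeasurable
  simp only [← hm]
  rw [sum_measureReal_singleton]
  refine congrArg _ ?_
  ext y
  simp only [Set.mem_preimage, Set.mem_singleton_iff, Finset.coe_filter, Set.mem_ofPred_eq]
  exact ⟨fun h => ⟨mem_sources_of_jump h, h⟩, fun h => h.2⟩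

/-- The configuration changes only if a clock rings. -/
lemma abs_prob_sub_le (hv : ∀ n ∈ Finset.Icc 1 N, 0 < v n) (hX : IsParticleSystem v C X P)
    {s t : ℝ≥0} (hst : s ≤ t) (x : Config N) :
    |P.real (X t ⁻¹' {x}) - P.real (X s ⁻¹' {x})| ≤ totalRate v N * (t - s) := by
  have hm : MeasurableSet {ω | rings C s t ω = ringVector none} :=
    measurable_rings hX s t (measurableSet_singleton (ringVector none))
  refine (abs_measureReal_sub_le (D := {ω | rings C s t ω = ringVector none}ᶜ) ?_).trans ?_
  · filter_upwards [ae_ringStep hX] with ω h hD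
    simp only [Set.mem_compl_iff, not_not] at hD
    rw [Set.mem_preimage, Set.mem_preimage, h s t hst none hD]
    rfl
  · rw [probReal_compl_eq_one_sub hm, prob_ringVector hv hX hst, optionRate, one_mul]
    have := Real.one_sub_le_exp_neg (totalRate v N * (t - s))
    linarith

/-- The forward equation, up to terms of second order. -/
lemma abs_prob_sub_sub_le (hv : ∀ n ∈ Finset.Icc 1 N, 0 < v n) (hX : IsParticleSystem v C X P)
    {s t : ℝ≥0} (hst : s ≤ t) (x : Config N) :
    |P.real (X t ⁻¹' {x}) - P.real (X s ⁻¹' {x}) - (t - s) *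
      ∑ p : Particle N, v p.level * (P.real (X s ⁻¹' (jump p ⁻¹' {x})) - P.real (X s ⁻¹' {x}))| ≤
      2 * (totalRate v N * (t - s)) ^ 2 := by
  have hts : (0 : ℝ) ≤ t - s := sub_nonneg.mpr (by exact_mod_cast hst)
  -- Up to the event of two rings, the configuration `x` is reached through exactly one `A o`.
  set A : Option (Particle N) → Set Ω := fun o =>
    X s ⁻¹' (jumpOption o ⁻¹' {x}) ∩ rings C s t ⁻¹' {ringVector o} with hA
  have h1 : |P.real (X t ⁻¹' {x}) - P.real (⋃ o ∈ (Finset.univ : Finset (Option (Particle N))), A o)|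
      ≤ (totalRate v N * (t - s)) ^ 2 := by
    refine (abs_measureReal_sub_le ?_).trans (prob_not_ringVector_le hv hX hst)
    filter_upwards [ae_ringStep hX] with ω h hD
    simp only [not_forall, not_not] at hD
    obtain ⟨o, ho⟩ := hD
    simp only [hA, Finset.mem_univ, Set.iUnion_true, Set.mem_iUnion, Set.mem_inter_iff,
      Set.mem_preimage, Set.mem_singleton_iff, h s t hst o ho, ho]
    constructor
    · exact fun h => ⟨o, h, rfl⟩
    · rintro ⟨o', h1, h2⟩
      rwa [ringVector_injective h2]
  have h2 : P.real (⋃ o ∈ (Finset.univ : Finset (Option (Particle N))), A o) =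
      Real.exp (-(totalRate v N * (t - s))) * (P.real (X s ⁻¹' {x}) + (t - s) *
        ∑ p : Particle N, v p.level * P.real (X s ⁻¹' (jump p ⁻¹' {x}))) := by
    rw [measureReal_biUnion_finset]
    · have h3 : ∀ o, P.real (A o) = P.real (X s ⁻¹' (jumpOption o ⁻¹' {x})) *
          (optionRate v (t - s) o * Real.exp (-(totalRate v N * (t - s)))) := fun o => by
        rw [hA, prob_inter_rings hv hX hst, ← prob_ringVector hv hX hst]
        rfl
      rw [Finset.sum_congr rfl fun o _ => h3 o, Fintype.sum_option, Finset.mul_sum, mul_add,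
        Finset.mul_sum]
      refine congrArg₂ (· + ·) ?_ (Finset.sum_congr rfl fun p _ => ?_)
      · simp only [optionRate, jumpOption, Set.preimage_id]
        ring
      · simp only [optionRate, jumpOption]
        ring
    · intro o _ o' _ hne
      refine Set.disjoint_left.mpr fun ω h h' => hne ?_
      exact ringVector_injective (h.2.symm.trans h'.2)
    · exact fun o _ => (hX.measurable s MeasurableSet.of_discrete).inter
        (measurable_rings hX s t (measurableSet_singleton _))
  have hq : (t - s : ℝ) * ∑ p : Particle N, v p.level * P.real (X s ⁻¹' (jump p ⁻¹' {x})) ≤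
      totalRate v N * (t - s) := by
    rw [mul_comm]
    refine mul_le_mul_of_nonneg_right (Finset.sum_le_sum fun p _ => ?_) hts
    exact mul_le_of_le_one_right (v_level_pos hv p).le measureReal_le_one
  have hq0 : 0 ≤ (t - s : ℝ) * ∑ p : Particle N, v p.level * P.real (X s ⁻¹' (jump p ⁻¹' {x})) :=
    mul_nonneg hts (Finset.sum_nonneg fun p _ =>
      mul_nonneg (v_level_pos hv p).le measureReal_nonneg)
  have hz : 0 ≤ totalRate v N * ((t : ℝ) - s) := mul_nonneg (totalRate_nonneg hv) hts
  have e : (t - s : ℝ) * ∑ p : Particle N, v p.level *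
      (P.real (X s ⁻¹' (jump p ⁻¹' {x})) - P.real (X s ⁻¹' {x})) =
      (t - s : ℝ) * (∑ p : Particle N, v p.level * P.real (X s ⁻¹' (jump p ⁻¹' {x}))) -
        totalRate v N * (t - s) * P.real (X s ⁻¹' {x}) := by
    rw [Finset.sum_congr rfl fun p _ => mul_sub (v p.level) _ _, Finset.sum_sub_distrib,
      ← Finset.sum_mul, totalRate]
    ring
  rw [e]
  rw [h2] at h1
  have hu0 : 0 ≤ P.real (X s ⁻¹' {x}) := measureReal_nonneg
  have hu1 : P.real (X s ⁻¹' {x}) ≤ 1 := measureReal_le_one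
  generalize (t - s : ℝ) * ∑ p : Particle N, v p.level * P.real (X s ⁻¹' (jump p ⁻¹' {x})) = q at *
  generalize totalRate v N * ((t : ℝ) - s) = z at *
  generalize P.real (X s ⁻¹' {x}) = u at *
  generalize P.real (X t ⁻¹' {x}) = w at *
  have hE1 := Real.one_sub_le_exp_neg z
  have hE2 : Real.exp (-z) ≤ 1 := Real.exp_le_one_iff.mpr (by linarith)
  have hE3 : Real.exp (-z) * (1 + z) ≤ 1 := by
    have h3 := Real.add_one_le_exp z
    have h4 : Real.exp (-z) * Real.exp z = 1 := by rw [← Real.exp_add]; simp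
    have h5 := Real.exp_pos (-z)
    nlinarith
  generalize Real.exp (-z) = E at *
  have hE4 : E - 1 + z ≤ z ^ 2 := by nlinarith
  have k1 : 0 ≤ (E - 1 + z) * u := mul_nonneg (by linarith) hu0
  have k2 : (E - 1 + z) * u ≤ z ^ 2 := by nlinarith
  have k3 : 0 ≤ (1 - E) * q := mul_nonneg (by linarith) hq0
  have k4 : (1 - E) * q ≤ z ^ 2 := by nlinarith
  rw [abs_le] at h1 ⊢
  constructor <;> nlinarith

open Classical in
/-- The forward equation. -/
lemma hasDerivWithinAt_prob (hv : ∀ n ∈ Finset.Icc 1 N, 0 < v n) (hX : IsParticleSystem v C X P)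
    (x : Config N) {a : ℝ} (ha : 0 ≤ a) :
    HasDerivWithinAt (fun τ : ℝ => P.real (X τ.toNNReal ⁻¹' {x}))
      (∑ p : Particle N, v p.level * ((∑ y ∈ sources x with jump p y = x,
        P.real (X a.toNNReal ⁻¹' {y})) - P.real (X a.toNNReal ⁻¹' {x}))) (Set.Ici a) a := by
  simp only [← prob_jump_eq hX]
  rw [hasDerivWithinAt_iff_isLittleO]
  have h := (Asymptotics.isLittleO_pow_sub_sub a (one_lt_two)).mono
    (nhdsWithin_le_nhds (s := Set.Ici a))
  refine Asymptotics.IsBigO.trans_isLittleO ?_ h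
  refine Asymptotics.IsBigO.of_bound (2 * totalRate v N ^ 2) ?_
  filter_upwards [self_mem_nhdsWithin] with τ hτ
  have hτ' : a ≤ τ := hτ
  have hk := abs_prob_sub_sub_le hv hX (Real.toNNReal_le_toNNReal hτ') x
  rw [Real.coe_toNNReal _ ha, Real.coe_toNNReal _ (ha.trans hτ')] at hk
  rw [Real.norm_eq_abs, smul_eq_mul]
  refine hk.trans (le_of_eq ?_)
  rw [norm_pow, norm_norm, Real.norm_eq_abs, sq_abs]
  ring

lemma continuous_prob (hv : ∀ n ∈ Finset.Icc 1 N, 0 < v n) (hX : IsParticleSystem v C X P)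
    (x : Config N) : Continuous fun τ : ℝ => P.real (X τ.toNNReal ⁻¹' {x}) := by
  have h : LipschitzWith (totalRate v N).toNNReal fun s : ℝ≥0 => P.real (X s ⁻¹' {x}) := by
    refine LipschitzWith.of_dist_le_mul fun s t => ?_
    rw [Real.coe_toNNReal _ (totalRate_nonneg hv)]
    wlog hst : s ≤ t generalizing s t
    · rw [dist_comm, dist_comm s t]
      exact this t s (le_of_not_ge hst)
    · have h1 : (0 : ℝ) ≤ t - s := sub_nonneg.mpr (by exact_mod_cast hst)
      rw [dist_comm, dist_comm s t, Real.dist_eq, NNReal.dist_eq, abs_of_nonneg h1]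
      exact abs_prob_sub_le hv hX hst x
  exact h.continuous.comp continuous_real_toNNReal

open Classical in
/-- Uniqueness for the forward equation: the transitions increase the positions, which are bounded
below by those of the packed configuration. -/
lemma eq_zero_of_forward {d : Config N → ℝ → ℂ} (hcont : ∀ x, ContinuousOn (d x) (Set.Ici 0))
    (h0 : ∀ x, d x 0 = 0)
    (hlow : ∀ x τ, 0 ≤ τ → (∃ p, x p < packed N p) → d x τ = 0)
    (hpat : ∀ x τ, 0 ≤ τ → x ∉ pattern N → d x τ = 0)
    (hder : ∀ x ∈ pattern N, ∀ τ, 0 ≤ τ → HasDerivWithinAt (d x)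
      (∑ p : Particle N, (v p.level : ℂ) *
        ((∑ y ∈ sources x with jump p y = x, d y τ) - d x τ)) (Set.Ici τ) τ)
    (x : Config N) (τ : ℝ) (hτ : 0 ≤ τ) : d x τ = 0 := by
  induction hn : ∑ q, (x q - packed N q).toNat using Nat.strong_induction_on generalizing x τ with
  | _ n ih =>
  by_cases hx : x ∈ pattern N
  swap
  · exact hpat x τ hτ hx
  have hbelow : ∀ y ∈ sources x, y ≠ x → ∀ τ, 0 ≤ τ → d y τ = 0 := by
    intro y hy hne τ hτ
    by_cases hl : ∃ p, y p < packed N p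
    · exact hlow y τ hτ hl
    push Not at hl
    simp only [sources, Fintype.mem_piFinset, Finset.mem_insert, Finset.mem_singleton] at hy
    obtain ⟨q, hq⟩ := Function.ne_iff.mp hne
    refine ih _ ?_ y τ hτ rfl
    rw [← hn]
    refine Finset.sum_lt_sum (fun r _ => ?_) ⟨q, Finset.mem_univ q, ?_⟩
    · have := hy r; omega
    · have := hy q; have := hl q; omega
  -- The equation at `x` reduces to `d' = -c d`, as only the term `y = x` of the inflow remains.
  set c : ℂ := ∑ p : Particle N, if jump p x = x then 0 else (v p.level : ℂ) with hc
  have hder' : ∀ τ, 0 ≤ τ → HasDerivWithinAt (d x) (-c * d x τ) (Set.Ici τ) τ := by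
    intro τ hτ
    refine (hder x hx τ hτ).congr_deriv ?_
    rw [hc, neg_mul, Finset.sum_mul, ← Finset.sum_neg_distrib]
    refine Finset.sum_congr rfl fun p _ => ?_
    have e : ∑ y ∈ sources x with jump p y = x, d y τ = if jump p x = x then d x τ else 0 := by
      rw [Finset.sum_filter, Finset.sum_eq_single_of_mem x]
      · simp [sources]
      · intro y hy hne
        rw [hbelow y hy hne τ hτ, ite_self]
    rw [e]
    split_ifs <;> ring
  have hconst := constant_of_has_deriv_right_zero (f := fun τ : ℝ => Complex.exp (c * τ) * d x τ)
    (a := 0) (b := τ) ?_ ?_ τ (Set.right_mem_Icc.mpr hτ)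
  · simp only [h0, mul_zero, mul_eq_zero, Complex.exp_ne_zero, false_or] at hconst
    exact hconst
  · refine ContinuousOn.mul ?_ ((hcont x).mono Set.Icc_subset_Ici_self)
    fun_prop
  · intro σ hσ
    have h1 : HasDerivAt (fun τ : ℝ => Complex.exp (c * τ)) (Complex.exp (c * σ) * c) σ := by
      have := ((hasDerivAt_id (σ : ℂ)).const_mul c).cexp.comp_ofReal
      simpa using this
    refine (h1.hasDerivWithinAt.fun_mul (hder' σ hσ.1)).congr_deriv ?_
    ring

/-- The one-time marginals of the particle system are explicit: `density`, multiplied by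
`exp (-(v_1 + ⋯ + v_N) t)` and normalized at time `0`, solves the forward equation with the initial
value of the particle system. -/
theorem hasPatternLaw (hv : ∀ n ∈ Finset.Icc 1 N, 0 < v n) (hX : IsParticleSystem v C X P)
    (t : ℝ≥0) {Γ : CircleContour} (hΓ : Γ.Inside 0)
    (hvΓ : ∀ n ∈ Finset.Icc 1 N, Γ.Inside (v n)) :
    ∃ κ : ℂ, HasPatternLaw v Γ t P (X t) κ := by
  classical
  have hv' : ∀ n ∈ Finset.Icc 1 N, v n ≠ 0 := fun n hn => (hv n hn).ne'
  set R : ℂ := ∑ n ∈ Finset.Icc 1 N, (v n : ℂ) with hR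
  set κ : ℂ := (density v Γ 0 (packed N))⁻¹ with hκ
  have hinv := ae_invariant hv hX (Q := fun x => x ∈ pattern N ∧ ∀ p, packed N p ≤ x p)
    ⟨packed_mem_pattern N, fun p => le_rfl⟩ (fun p x h => ⟨jump_mem_pattern h.1 p, fun q => by
      rcases jump_apply_eq_or (y := x) p q with h1 | h1 <;> have := h.2 q <;> omega⟩)
  have hu0 : ∀ x s, ¬ (x ∈ pattern N ∧ ∀ p, packed N p ≤ x p) → P.real (X s ⁻¹' {x}) = 0 := by
    intro x s hx
    rw [measureReal_eq_zero_iff, ← compl_compl (X s ⁻¹' {x}), ← mem_ae_iff]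
    filter_upwards [hinv s] with ω hω
    intro h
    have h' : X s ω = x := h
    rw [h'] at hω
    exact hx hω
  have hκ' : κ * density v Γ 0 (packed N) = 1 :=
    inv_mul_cancel₀ (density_zero_packed_ne_zero hv' hΓ hvΓ)
  have hmain := eq_zero_of_forward (v := v) (N := N) (d := fun x τ =>
    (P.real (X τ.toNNReal ⁻¹' {x}) : ℂ) - κ * (Complex.exp (-R * τ) * density v Γ τ x))
    ?_ ?_ ?_ ?_ ?_
  · refine ⟨κ * Complex.exp (-R * t), fun x hx => ?_⟩
    have := hmain x t t.2
    simp only [Real.toNNReal_coe] at this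
    rw [sub_eq_zero.mp this, density, patternFun_of_mem _ hx, topDet]
    ring
  · intro x
    refine ContinuousOn.sub ?_ ?_
    · exact (Complex.continuous_ofReal.comp (continuous_prob hv hX x)).continuousOn
    · refine ContinuousOn.mul continuousOn_const (ContinuousOn.mul (by fun_prop) ?_)
      by_cases hx : x ∈ pattern N
      · exact fun τ _ =>
          (hasDerivAt_density hv' hΓ hvΓ hx τ).continuousAt.continuousWithinAt
      · simp only [density_of_not_mem _ hx]
        exact continuousOn_const
  · intro x
    have h0 : P.real (X 0 ⁻¹' {x}) = if packed N = x then 1 else 0 := by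
      split_ifs with h
      · rw [← probReal_univ (μ := P)]
        refine measureReal_congr ?_
        filter_upwards [hX.init] with ω hω
        exact propext ⟨fun _ => trivial, fun _ => hω.trans h⟩
      · rw [measureReal_eq_zero_iff, ← compl_compl (X 0 ⁻¹' {x}), ← mem_ae_iff]
        filter_upwards [hX.init] with ω hω h'
        exact h (hω.symm.trans h')
    simp only [Real.toNNReal_zero, h0, Complex.ofReal_zero, mul_zero, Complex.exp_zero, one_mul]
    split_ifs with h
    · rw [← h, hκ']
      simp
    · rw [density_zero_eq_zero hΓ hvΓ (Ne.symm h)]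
      simp
  · rintro x τ _ ⟨p, hp⟩
    simp only [density_eq_zero_of_lt hΓ hvΓ τ hp]
    rw [hu0 x _ fun h => (h.2 p).not_gt hp]
    simp
  · intro x τ _ hx
    simp only [density_of_not_mem _ hx]
    rw [hu0 x _ fun h => hx h.1]
    simp
  · intro x hx τ hτ
    have h1 := (hasDerivWithinAt_prob hv hX x hτ).ofReal_comp
    have h2 : HasDerivAt (fun τ : ℝ => Complex.exp (-R * τ)) (Complex.exp (-R * τ) * -R) τ := by
      have := ((hasDerivAt_id (τ : ℂ)).const_mul (-R)).cexp.comp_ofReal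
      simpa using this
    have h3 := (h2.fun_mul (hasDerivAt_density hv' hΓ hvΓ hx τ)).const_mul κ
    refine (h1.fun_sub h3.hasDerivWithinAt).congr_deriv ?_
    push_cast
    simp only [Finset.sum_sub_distrib, ← Finset.mul_sum, mul_sub, ← hR]
    have e : ∀ p : Particle N, (v p.level : ℂ) * (κ * (Complex.exp (-R * τ) *
        ∑ y ∈ sources x with jump p y = x, density v Γ τ y)) = κ * Complex.exp (-R * τ) *
        ((v p.level : ℂ) * ∑ y ∈ sources x with jump p y = x, density v Γ τ y) := fun p => by ring
    have e' : ∀ p : Particle N, (v p.level : ℂ) * (κ * (Complex.exp (-R * τ) *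
        density v Γ τ x)) = κ * Complex.exp (-R * τ) *
        ((v p.level : ℂ) * density v Γ τ x) := fun p => by ring
    simp only [e, e', ← Finset.mul_sum]
    ring

end ForwardLaw

end GTParticles

end

theorem proposition1 (N : ℕ) (v : ℕ → ℝ) (hv : ∀ n ∈ Finset.Icc 1 N, 0 < v n)
    {Ω : Type*} [MeasurableSpace Ω] (P : Measure Ω) [IsProbabilityMeasure P]
    (C : GTParticles.Particle N → ℝ≥0 → Ω → ℕ) (X : ℝ≥0 → Ω → GTParticles.Config N)
    (hX : GTParticles.IsParticleSystem v C X P) (t : ℝ≥0)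
    (Γ₀ Γ₁ : GTParticles.CircleContour)
    (hΓ₀ : Γ₀.Inside 0 ∧ ∀ n ∈ Finset.Icc 1 N, Γ₀.Inside (v n))
    (hΓ₁ : Γ₁.Outside 0 ∧ ∀ n ∈ Finset.Icc 1 N, Γ₁.Inside (v n)) :
    (∀ᵐ ω ∂P, X t ω ∈ GTParticles.pattern N) ∧
    (∀ (m : ℕ) (y : Fin m → ℤ × ℕ), (∀ i, (y i).2 ∈ Finset.Icc 1 N) →
      (GTParticles.correlation P (X t) y : ℂ) =
        (Matrix.of fun i j => GTParticles.kernel v Γ₀ Γ₁ t (y i) (y j)).det) ∧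
    (∀ n ∈ Finset.Icc 1 N, ∀ k ∈ Finset.Icc 1 n, ∀ l ∈ Finset.Icc 1 n,
      HasSum (fun x : ℤ => GTParticles.Psi v Γ₀ t n k x * GTParticles.Phi v Γ₁ t n l x)
        (if k = l then 1 else 0)) ∧
    (∀ n ∈ Finset.Icc 1 N,
      Submodule.span ℂ {f | ∃ l ∈ Finset.Icc 1 n, f = GTParticles.Phi v Γ₁ t n l} =
        GTParticles.spaceV v n) := by
  have hv' : ∀ n ∈ Finset.Icc 1 N, v n ≠ 0 := fun n hn => (hv n hn).ne'
  have hpat := GTParticles.ae_invariant hv hX (GTParticles.packed_mem_pattern N)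
    (fun p x hx => GTParticles.jump_mem_pattern hx p) t
  obtain ⟨κ, hlaw⟩ := GTParticles.hasPatternLaw hv hX t hΓ₀.1 hΓ₀.2
  refine ⟨hpat, fun m y hy => ?_, fun n hn k hk l hl => ?_, fun n hn => ?_⟩
  · exact GTParticles.correlation_eq_det hv' hΓ₀.1 hΓ₀.2 hΓ₁.1 hΓ₁.2 (hX.measurable t) hpat hlaw hy
  · have hnN := (Finset.mem_Icc.mp hn).2
    exact GTParticles.hasSum_Psi_mul_Phi hΓ₀.1 hk hl (GTParticles.inside_of_le hΓ₀.2 hnN)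
      (GTParticles.inside_of_le hΓ₁.2 hnN) t
  · have hnN := (Finset.mem_Icc.mp hn).2
    exact GTParticles.span_Phi_eq_spaceV hΓ₀.1 (GTParticles.inside_of_le hΓ₀.2 hnN)
      hΓ₁.1 (GTParticles.inside_of_le hΓ₁.2 hnN) t
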